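/- Conventions. For a Lie group the bracket on its Lie algebra is that of right-invariant vector fields; manifolds are smooth, Hausdorff, second countable, finite dimensional. For a bivector field $\pi$, $\pi^\sharp(\alpha)=\pi(\alpha,\cdot)$ and $\tfrac12[\pi,\pi](df,dg,dh)=\{f,\{g,h\}\}+\{g,\{h,f\}\}+\{h,\{f,g\}\}$ with $\{f,g\}=\pi(df,dg)$. On $\mathbb TM=TM\oplus T^*M$ use $\langle (X,\alpha),(Y,\beta)\rangle=\beta(X)+\alpha(Y)$; an almost Dirac structure is a smooth subbundle $L\subset\mathbb TM$ with $L=L^\perp$, and it is a $\phi$-twisted Dirac structure if $\Gamma(L)$ is closed under $[\![(X,\alpha),(Y,\beta)]\!]_\phi=([X,Y],\mathcal L_X\beta-i_Yd\alpha+i_Yi_X\phi)$. A smooth map $f:(M,L)\to(M',L')$ is f-Dirac if $L'_{f(x)}=\{(df(X),\beta) : (X,f^*\beta)\in L_x\}$ for all $x\in M$; the backward image of $L'$ is $\{(X,f^*\beta) : (df(X),\beta)\in L'\}$. A map $J:(M,L)\to(S,L_S,\phi_S)$ is a strong Dirac map if $L$ is a $J^*\phi_S$-twisted Dirac structure, $J$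 is f-Dirac, and $\ker(dJ)\cap (L\cap TM)=0$. Data. Let $(\mathfrak d,\mathfrak g)$ be a Manin pair: $\mathfrak d$ is a real Lie algebra of dimension $2n$ with an invariant nondegenerate symmetric form $\langle\cdot,\cdot\rangle$ of signature $(n,n)$, and $\mathfrak g\subset\mathfrak d$ is a Lie subalgebra that is maximal isotropic. Let it be integrated by a connected Lie group $D$ and a connected closed subgroup $G\subset D$; put $S=D/G$, let $\rho_S:\mathfrak d\to\mathfrak X(S)$ be the infinitesimal action $\rho_S(u)_x=\frac{d}{dt}|_{t=0}\exp(tu)\cdot x$ induced by left multiplication and $\rho=\rho_S|_{\mathfrak g}$. Fix $s\in\Omega^1(S,\mathfrak d)$ with $\rho_S\circ s=\mathrm{id}_{TS}$ and isotropic image (an isotropic connection splitting), and a linear $j:\mathfrak g^*\to\mathfrak d$ with isotropic image and $\langle j\mu,v\rangle=\mu(v)$ for $v\in\mathfrak g$. Let $s^*(u)=\langle u,s(\cdot)\rangle\in\Omega^1(S)$ for $u\in\mathfrak d$, $\sigma=s^*|_{\mathfrak g}$, $\phi_S=\frac12\langle ds,s\rangle+\frac16\langle[s,s],s\rangle$,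 $L_S=\{(\rho(v),\sigma(v)) : v\in\mathfrak g\}$, $C_S=\{(\rho_S(j\mu),s^*(j\mu)) : \mu\in\mathfrak g^*\}$. Let $F:\mathfrak g\to\wedge^2\mathfrak g$ and $\chi\in\wedge^3\mathfrak g$ be given by $F(v)(\mu,\nu)=\langle v,[j\mu,j\nu]\rangle$ and $\chi(\mu,\nu,\kappa)=\langle[j\mu,j\nu],j\kappa\rangle$; let $\bar\sigma=(\rho_S\circ j)^*:T^*S\to\mathfrak g$, and $\bar\rho=j^*\circ s:TS\to\mathfrak g$ with $\mu(j^*u)=\langle u,j\mu\rangle$. A Hamiltonian quasi-Poisson $\mathfrak g$-space is $(M,\pi,\rho_M,J)$ where $M$ is a manifold, $\pi$ a bivector field, $\rho_M:\mathfrak g\to\mathfrak X(M)$ an infinitesimal action and $J:M\to S$ a smooth map such that $\mathcal L_{\rho_M(v)}\pi=-\rho_M(F(v))$ for all $v\in\mathfrak g$, $\frac12[\pi,\pi]=\rho_M(\chi)$, $dJ\circ\rho_M=\rho$ and $\pi^\sharp J^*=\rho_M\bar\sigma$. Let $\mathcal M_s(\mathfrak d,\mathfrak g)$ be the category whose objects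 are the strong Dirac maps $J:(M,L)\to(S,L_S,\phi_S)$ and whose morphisms are the smooth f-Dirac maps $f:M\to M'$ with $J'\circ f=J$. Let $\mathcal M_j(\mathfrak d,\mathfrak g)$ be the category whose objects are the Hamiltonian quasi-Poisson $\mathfrak g$-spaces and whose morphisms are the smooth $\mathfrak g$-equivariant maps $f:M\to M'$ (that is, $df\circ\rho_M=\rho_{M'}$) with $f_*\pi=\pi'$ and $J'\circ f=J$. Theorem. (i) Let $J:(M,L)\to(S,L_S,\phi_S)$ be a strong Dirac map. There is a unique linear $\rho_M:\mathfrak g\to\{\text{sections of }TM\}$ with $dJ\circ\rho_M=\rho$ and $(\rho_M(v),J^*\sigma(v))\in L$ for all $v\in\mathfrak g$. The backward image $C$ of $C_S$ under $J$ is a smooth almost Dirac structure with $\mathbb TM=L\oplus C$. There is a unique bivector field $\pi$ with $\pi^\sharp=\mathrm{pr}_{TM}|_L\circ(\mathrm{pr}_{TM}|_C)^*$, where $C^*\cong L$ by the pairing. With these, $(M,\pi,\rho_M,J)$ is a Hamiltonian quasi-Poisson $\mathfrak g$-space. (ii) Let $(M,\pi,\rho_M,J)$ be a Hamiltonian quasi-Poisson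 $\mathfrak g$-space. Put $\hat\rho_M(v)=(\rho_M(v),J^*\sigma(v))$ for $v\in\mathfrak g$, $T=\rho_M\circ\bar\rho\circ dJ:TM\to TM$ and $h(\alpha)=(\pi^\sharp(\alpha),\alpha-T^*\alpha)$ for $\alpha\in T^*M$. Then $L=\{\hat\rho_M(v)+h(\alpha) : v\in\mathfrak g,\ \alpha\in T^*M\}$ is a $J^*\phi_S$-twisted Dirac structure on $M$ for which $J:(M,L)\to(S,L_S,\phi_S)$ is a strong Dirac map. The constructions in (i) and (ii) are inverse to each other. With the identity on underlying smooth maps they define mutually inverse functors, hence an isomorphism of categories $\mathcal M_s(\mathfrak d,\mathfrak g)\cong\mathcal M_j(\mathfrak d,\mathfrak g)$. -/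

import Mathlib

open scoped Manifold ContDiff
open Bundle CategoryTheory

universe u

noncomputable section

namespace QPDirac

/-! ### Dirac geometry on a smooth manifold -/

section Dirac

variable {E : Type*} [NormedAddCommGroup E] [NormedSpace ℝ E]
  {M : Type*} [TopologicalSpace M] [ChartedSpace E M]
  {E' : Type*} [NormedAddCommGroup E'] [NormedSpace ℝ E']
  {M' : Type*} [TopologicalSpace M'] [ChartedSpace E' M']
  {F : Type*} [NormedAddCommGroup F] [NormedSpace ℝ F]

/-- The tangent space `T_x M`. -/
abbrev Tan (E : Type*) [NormedAddCommGroup E] [NormedSpace ℝ E]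
    {M : Type*} [TopologicalSpace M] [ChartedSpace E M] (x : M) : Type _ :=
  TangentSpace 𝓘(ℝ, E) x

/-- The cotangent space `T*_x M`. -/
abbrev Cot (E : Type*) [NormedAddCommGroup E] [NormedSpace ℝ E]
    {M : Type*} [TopologicalSpace M] [ChartedSpace E M] (x : M) : Type _ :=
  TangentSpace 𝓘(ℝ, E) x →L[ℝ] ℝ

/-- The fibre `T_x M ⊕ T*_x M`. -/
abbrev BigTan (E : Type*) [NormedAddCommGroup E] [NormedSpace ℝ E]
    {M : Type*} [TopologicalSpace M] [ChartedSpace E M] (x : M) : Type _ :=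
  Tan E x × Cot E x

/-- The symmetric pairing `⟨(X₁, α₁), (X₂, α₂)⟩ = α₂(X₁) + α₁(X₂)`. -/
def bigPairing {x : M} (a b : BigTan E x) : ℝ := b.2 a.1 + a.2 b.1

/-- A vector field is smooth on `U`. -/
def SmoothVFOn [IsManifold 𝓘(ℝ, E) ∞ M] (X : ∀ x : M, Tan E x) (U : Set M) : Prop :=
  ContMDiffOn 𝓘(ℝ, E) (𝓘(ℝ, E).prod 𝓘(ℝ, E)) ∞
    (fun x => TotalSpace.mk' E (E := fun x : M => TangentSpace 𝓘(ℝ, E) x) x (X x)) U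

/-- An `F`-valued 1-form is smooth on `U`. -/
def SmoothFormOn [IsManifold 𝓘(ℝ, E) ∞ M] (α : ∀ x : M, Tan E x →L[ℝ] F) (U : Set M) : Prop :=
  ContMDiffOn 𝓘(ℝ, E) (𝓘(ℝ, E).prod 𝓘(ℝ, E →L[ℝ] F)) ∞
    (fun x => TotalSpace.mk' (E →L[ℝ] F)
      (E := fun x : M => TangentSpace 𝓘(ℝ, E) x →L[ℝ] Trivial M F x) x (α x)) U

/-- A section of `TM ⊕ T*M` is smooth on `U`. -/
def SmoothBigOn [IsManifold 𝓘(ℝ, E) ∞ M] (e : ∀ x : M, BigTan E x) (U : Set M) : Prop :=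
  SmoothVFOn (fun x => (e x).1) U ∧ SmoothFormOn (fun x => (e x).2) U

/-- The differential of a real function, as a covector. -/
def dfun (f : M → ℝ) (x : M) : Cot E x := mfderiv 𝓘(ℝ, E) 𝓘(ℝ, ℝ) f x

/-- A 1-form written in the preferred chart at `x`. -/
def chartForm (α : ∀ x : M, Tan E x →L[ℝ] F) (x : M) (y : E) : E →L[ℝ] F :=
  (α ((extChartAt 𝓘(ℝ, E) x).symm y)).comp
    (mfderiv 𝓘(ℝ, E) 𝓘(ℝ, E) (extChartAt 𝓘(ℝ, E) x).symm y)

/-- The exterior derivative of an `F`-valued 1-form,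
`(dα)_x(u, v) = ∂_u α(v) - ∂_v α(u)`, computed in the preferred chart at `x`
(by which `T_x M` is identified with the model space). -/
def extD (α : ∀ x : M, Tan E x →L[ℝ] F) (x : M) : Tan E x →L[ℝ] Tan E x →L[ℝ] F :=
  let A : E →L[ℝ] E →L[ℝ] F := fderiv ℝ (chartForm α x) (extChartAt 𝓘(ℝ, E) x x)
  (A - A.flip : E →L[ℝ] E →L[ℝ] F)

/-- The Lie derivative of a 1-form (Cartan's formula). -/
def lieForm (X : ∀ x : M, Tan E x) (α : ∀ x : M, Cot E x) (x : M) : Cot E x :=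
  extD α x (X x) + dfun (fun y => α y (X y)) x

/-- The Courant bracket twisted by a 3-form `φ`, where `φ x u v` is the covector `φ_x(u, v, ·)`:
`([X₁, X₂], ℒ_{X₁} α₂ - i_{X₂} dα₁ + i_{X₂} i_{X₁} φ)`. -/
def courant (φ : ∀ x : M, Tan E x → Tan E x → Cot E x) (e₁ e₂ : ∀ x : M, BigTan E x) (x : M) :
    BigTan E x :=
  (VectorField.mlieBracket 𝓘(ℝ, E) (fun y => (e₁ y).1) (fun y => (e₂ y).1) x,
    lieForm (fun y => (e₁ y).1) (fun y => (e₂ y).2) x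
      - extD (fun y => (e₁ y).2) x (e₂ x).1 + φ x (e₁ x).1 (e₂ x).1)

/-- An almost Dirac structure: a smooth subbundle of `TM ⊕ T*M` with Lagrangian fibres.
As the pairing has split signature, Lagrangian (maximal isotropic) means equal to the
orthogonal; then the rank is constant, and smoothness of the subbundle means that every element
of a fibre extends to a smooth local section. -/
structure IsAlmostDirac [IsManifold 𝓘(ℝ, E) ∞ M]
    (L : ∀ x : M, Submodule ℝ (BigTan E x)) : Prop where
  lagrangian : ∀ (x : M) (a : BigTan E x), a ∈ L x ↔ ∀ b ∈ L x, bigPairing a b = 0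
  smooth : ∀ (x : M), ∀ a ∈ L x, ∃ U : Set M, IsOpen U ∧ x ∈ U ∧
    ∃ e : ∀ y : M, BigTan E y, SmoothBigOn e U ∧ (∀ y ∈ U, e y ∈ L y) ∧ e x = a

/-- A `φ`-twisted Dirac structure: sections of `L` are closed under the Courant bracket. -/
structure IsDirac [IsManifold 𝓘(ℝ, E) ∞ M] (φ : ∀ x : M, Tan E x → Tan E x → Cot E x)
    (L : ∀ x : M, Submodule ℝ (BigTan E x)) : Prop extends IsAlmostDirac L where
  integrable : ∀ e₁ e₂ : ∀ x : M, BigTan E x,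
    SmoothBigOn e₁ Set.univ → SmoothBigOn e₂ Set.univ →
    (∀ x, e₁ x ∈ L x) → (∀ x, e₂ x ∈ L x) → ∀ x, courant φ e₁ e₂ x ∈ L x

/-- The differential `(df)_x : T_x M → T_{f x} M'`. -/
abbrev tmap (E E' : Type*) [NormedAddCommGroup E] [NormedSpace ℝ E]
    [NormedAddCommGroup E'] [NormedSpace ℝ E']
    {M : Type*} [TopologicalSpace M] [ChartedSpace E M]
    {M' : Type*} [TopologicalSpace M'] [ChartedSpace E' M'] (f : M → M') (x : M) :
    Tan E x →L[ℝ] Tan E' (f x) :=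
  mfderiv 𝓘(ℝ, E) 𝓘(ℝ, E') f x

/-- The codifferential `(df)_x^* : T*_{f x} M' → T*_x M`. -/
def cotmap (E E' : Type*) [NormedAddCommGroup E] [NormedSpace ℝ E]
    [NormedAddCommGroup E'] [NormedSpace ℝ E']
    {M : Type*} [TopologicalSpace M] [ChartedSpace E M]
    {M' : Type*} [TopologicalSpace M'] [ChartedSpace E' M'] (f : M → M') (x : M) :
    Cot E' (f x) →ₗ[ℝ] Cot E x where
  toFun β := β.comp (tmap E E' f x)
  map_add' _ _ := ContinuousLinearMap.add_comp _ _ _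
  map_smul' _ _ := ContinuousLinearMap.smul_comp _ _ _

/-- `L'` is the forward image of `L` under `f`, i.e. `f` is an f-Dirac map. -/
def IsForwardDirac (f : M → M') (L : ∀ x : M, Submodule ℝ (BigTan E x))
    (L' : ∀ x : M', Submodule ℝ (BigTan E' x)) : Prop :=
  ∀ (x : M) (Y : Tan E' (f x)) (β : Cot E' (f x)),
    (Y, β) ∈ L' (f x) ↔ ∃ X : Tan E x, tmap E E' f x X = Y ∧ (X, cotmap E E' f x β) ∈ L x

/-- The backward image `{(X, f^*β) | (df X, β) ∈ L'}`. -/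
def backwardImage (f : M → M') (L' : ∀ x : M', Submodule ℝ (BigTan E' x)) (x : M) :
    Submodule ℝ (BigTan E x) :=
  ((L' (f x)).comap ((tmap E E' f x).toLinearMap.prodMap LinearMap.id)).map
    (LinearMap.id.prodMap (cotmap E E' f x))

/-- The pull-back of a 3-form. -/
def pullThree (f : M → M') (φ : ∀ y : M', Tan E' y → Tan E' y → Cot E' y) (x : M)
    (a b : Tan E x) : Cot E x :=
  cotmap E E' f x (φ (f x) (tmap E E' f x a) (tmap E E' f x b))

/-- `f : (M, L, f^*φ') → (M', L', φ')` is a strong Dirac map: `L` is a Dirac structure twisted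
by `f^*φ'`, `f` is f-Dirac, and `ker(df) ∩ ker(L) = 0` where `ker(L) = L ∩ TM`. -/
structure IsStrongDirac [IsManifold 𝓘(ℝ, E) ∞ M] (f : M → M')
    (L : ∀ x : M, Submodule ℝ (BigTan E x))
    (φ' : ∀ y : M', Tan E' y → Tan E' y → Cot E' y)
    (L' : ∀ x : M', Submodule ℝ (BigTan E' x)) : Prop where
  dirac : IsDirac (pullThree f φ') L
  forward : IsForwardDirac f L L'
  transversal : ∀ (x : M) (X : Tan E x),
    tmap E E' f x X = 0 → (X, (0 : Cot E x)) ∈ L x → X = 0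

/-- A bivector field, given by `π^♯ : T*M → TM`, `β(π^♯ α) = π(α, β)`, smooth and skew. -/
structure IsBivector [IsManifold 𝓘(ℝ, E) ∞ M] (biv : ∀ x : M, Cot E x →L[ℝ] Tan E x) : Prop where
  smooth : ContMDiff 𝓘(ℝ, E) (𝓘(ℝ, E).prod 𝓘(ℝ, (E →L[ℝ] ℝ) →L[ℝ] E)) ∞
    (fun x => TotalSpace.mk' ((E →L[ℝ] ℝ) →L[ℝ] E)
      (E := fun x : M => (TangentSpace 𝓘(ℝ, E) x →L[ℝ] Trivial M ℝ x) →L[ℝ]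
        TangentSpace 𝓘(ℝ, E) x) x (biv x))
  skew : ∀ (x : M) (α β : Cot E x), β (biv x α) = - α (biv x β)

/-- The bracket `{f, g} = π(df, dg)`. -/
def bivBracket (biv : ∀ x : M, Cot E x →L[ℝ] Tan E x) (f g : M → ℝ) (x : M) : ℝ :=
  dfun (E := E) g x (biv x (dfun f x))

/-- The Lie derivative of a bivector field, `(ℒ_X π)(df, dg)`. -/
def lieBiv (X : ∀ x : M, Tan E x) (biv : ∀ x : M, Cot E x →L[ℝ] Tan E x) (f g : M → ℝ)
    (x : M) : ℝ :=
  dfun (E := E) (bivBracket biv f g) x (X x)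
    - bivBracket biv (fun y => dfun (E := E) f y (X y)) g x
    - bivBracket biv f (fun y => dfun (E := E) g y (X y)) x

/-- The Schouten bracket `[π, π](df, dg, dh)` of a bivector field with itself, i.e. twice the
Jacobiator of `{·, ·}`. -/
def schoutenSelf (biv : ∀ x : M, Cot E x →L[ℝ] Tan E x) (f g h : M → ℝ) (x : M) : ℝ :=
  2 * (bivBracket biv f (bivBracket biv g h) x + bivBracket biv g (bivBracket biv h f) x
    + bivBracket biv h (bivBracket biv f g) x)

/-- `π` is the bivector associated with the transversal almost Dirac structures `L` and `C`:
`π^♯ = pr_{TM}|_L ∘ (pr_{TM}|_C)^*`, where `C^* ≅ L` by the pairing. That is, `π^♯ α` is the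
tangent part of the element of `L` whose pairing with every `c ∈ C` is `α(pr_{TM} c)`. -/
def IsAssocBivector (L C : ∀ x : M, Submodule ℝ (BigTan E x))
    (biv : ∀ x : M, Cot E x →L[ℝ] Tan E x) : Prop :=
  ∀ (x : M) (α : Cot E x), ∃ γ : Cot E x, (biv x α, γ) ∈ L x ∧
    ∀ c ∈ C x, bigPairing (biv x α, γ) c = α c.1

end Dirac

/-! ### Manin pairs, group pairs and splittings -/

section Manin

/-- A Manin pair on a finite dimensional real vector space `𝔡`: a Lie bracket, an invariant
nondegenerate symmetric form, and a Lie subalgebra `𝔤` that is equal to its own orthogonal.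
(A form with such a subspace has signature `(n, n)` with `n = dim 𝔤`, and in signature `(n, n)`
the maximal isotropic subspaces are those equal to their orthogonal.) -/
structure ManinPair (𝔡 : Type*) [NormedAddCommGroup 𝔡] [NormedSpace ℝ 𝔡] where
  bracket : 𝔡 →L[ℝ] 𝔡 →L[ℝ] 𝔡
  bracket_self : ∀ a, bracket a a = 0
  jacobi : ∀ a b c, bracket a (bracket b c) = bracket (bracket a b) c + bracket b (bracket a c)
  form : 𝔡 →L[ℝ] 𝔡 →L[ℝ] ℝ
  form_symm : ∀ a b, form a b = form b a
  form_nondeg : ∀ a, (∀ b, form a b = 0) → a = 0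
  form_invariant : ∀ a b c, form (bracket a b) c + form b (bracket a c) = 0
  sub : Submodule ℝ 𝔡
  bracket_mem : ∀ a ∈ sub, ∀ b ∈ sub, bracket a b ∈ sub
  lagrangian : ∀ a, a ∈ sub ↔ ∀ b ∈ sub, form a b = 0

variable {𝔡 : Type*} [NormedAddCommGroup 𝔡] [NormedSpace ℝ 𝔡] [FiniteDimensional ℝ 𝔡]

/-- The bracket of `𝔤`. -/
def ManinPair.subBracket (P : ManinPair 𝔡) (a b : P.sub) : P.sub :=
  ⟨P.bracket a b, P.bracket_mem a a.2 b b.2⟩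

/-- The right-invariant vector field on a Lie group with value `v` at the unit. -/
def rightField {ED : Type*} [NormedAddCommGroup ED] [NormedSpace ℝ ED]
    {D : Type*} [TopologicalSpace D] [ChartedSpace ED D] [Group D]
    (v : Tan ED (1 : D)) (a : D) : Tan ED a :=
  (mfderiv 𝓘(ℝ, ED) 𝓘(ℝ, ED) (fun b : D => b * a) 1 v : ED)

/-- The group pair `(D, G)` integrates the Manin pair `(𝔡, 𝔤)`, and `D ⧸ G` carries the
quotient manifold structure, i.e. the unique one for which `p : D → D ⧸ G` is a submersion.
`𝔡` is identified with `T_1 D` carrying the bracket of right-invariant vector fields (so that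
infinitesimal left actions are Lie algebra homomorphisms), and `𝔤` with the Lie algebra of `G`,
which is the tangent space at `1` of the fibre `G` of `p`. -/
structure GroupPair (P : ManinPair 𝔡)
    (ED : Type*) [NormedAddCommGroup ED] [NormedSpace ℝ ED]
    (ES : Type*) [NormedAddCommGroup ES] [NormedSpace ℝ ES]
    {D : Type*} [TopologicalSpace D] [ChartedSpace ED D] [Group D] (G : Subgroup D)
    [ChartedSpace ES (D ⧸ G)] where
  ident : 𝔡 ≃L[ℝ] Tan ED (1 : D)
  ident_bracket : ∀ a b,
    VectorField.mlieBracket 𝓘(ℝ, ED) (rightField (ident a)) (rightField (ident b))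
      = rightField (ident (P.bracket a b))
  isClosed : IsClosed (G : Set D)
  isConnected : IsConnected (G : Set D)
  isSubmersion : Manifold.IsSubmersion 𝓘(ℝ, ED) 𝓘(ℝ, ES) ∞ (fun a : D => (a : D ⧸ G))
  sub_eq : ∀ a, a ∈ P.sub ↔ tmap ED ES (fun a : D => (a : D ⧸ G)) 1 (ident a) = 0

/-- An isotropic splitting `j : 𝔤^* → 𝔡` of `𝔤 → 𝔡 → 𝔤^*`. -/
structure IsotropicSplitting (P : ManinPair 𝔡) where
  toFun : Module.Dual ℝ P.sub →ₗ[ℝ] 𝔡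
  splits : ∀ (μ : Module.Dual ℝ P.sub) (v : P.sub), P.form (toFun μ) v = μ v
  isotropic : ∀ μ ν, P.form (toFun μ) (toFun ν) = 0

namespace IsotropicSplitting

variable {P : ManinPair 𝔡} (j : IsotropicSplitting P)

/-- The cobracket `F(v)(μ, ν) = ⟨v, [jμ, jν]⟩`. -/
def cobracket (v : P.sub) (μ ν : Module.Dual ℝ P.sub) : ℝ :=
  P.form v (P.bracket (j.toFun μ) (j.toFun ν))

/-- The trivector `χ(μ, ν, κ) = ⟨[jμ, jν], jκ⟩`. -/
def chi (μ ν κ : Module.Dual ℝ P.sub) : ℝ :=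
  P.form (P.bracket (j.toFun μ) (j.toFun ν)) (j.toFun κ)

/-- The dual `j^* : 𝔡 ≅ 𝔡^* → 𝔤^{**} = 𝔤`, i.e. `μ(j^* a) = ⟨a, jμ⟩`. -/
def star : 𝔡 →L[ℝ] P.sub :=
  LinearMap.toContinuousLinearMap
    ((Module.evalEquiv ℝ P.sub).symm.toLinearMap ∘ₗ
      LinearMap.lcomp ℝ ℝ j.toFun ∘ₗ
      (ContinuousLinearMap.coeLM ℝ ∘ₗ P.form.toLinearMap))

end IsotropicSplitting

variable {ED : Type*} [NormedAddCommGroup ED] [NormedSpace ℝ ED]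
    {ES : Type*} [NormedAddCommGroup ES] [NormedSpace ℝ ES]
    {D : Type*} [TopologicalSpace D] [ChartedSpace ED D] [Group D] {G : Subgroup D}
    [ChartedSpace ES (D ⧸ G)] {P : ManinPair 𝔡}

/-- The infinitesimal dressing action `ρ_S : 𝔡 → T_x S`, `S = D ⧸ G`, the derivative at the unit
of `a ↦ a • x`. -/
def GroupPair.rhoS (Q : GroupPair P ED ES G) (x : D ⧸ G) : 𝔡 →L[ℝ] Tan ES x :=
  ((mfderiv 𝓘(ℝ, ED) 𝓘(ℝ, ES) (fun a : D => a • x) 1 : ED →L[ℝ] ES) :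
    Tan ED (1 : D) →L[ℝ] Tan ES x).comp (Q.ident : 𝔡 →L[ℝ] Tan ED (1 : D))

/-- An isotropic connection splitting `s ∈ Ω¹(S, 𝔡)`. -/
structure ConnectionSplitting [IsManifold 𝓘(ℝ, ES) ∞ (D ⧸ G)] (Q : GroupPair P ED ES G) where
  toFun : ∀ x : D ⧸ G, Tan ES x →L[ℝ] 𝔡
  smooth : SmoothFormOn toFun Set.univ
  splits : ∀ (x : D ⧸ G) (X : Tan ES x), Q.rhoS x (toFun x X) = X
  isotropic : ∀ (x : D ⧸ G) (X Y : Tan ES x), P.form (toFun x X) (toFun x Y) = 0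

variable [IsManifold 𝓘(ℝ, ES) ∞ (D ⧸ G)] {Q : GroupPair P ED ES G}

namespace ConnectionSplitting

variable (s : ConnectionSplitting Q)

/-- The dual `s^* : 𝔡 → T*S`, `s^*(a)(X) = ⟨a, s(X)⟩`; its restriction to `𝔤` is `σ`. -/
def star (x : D ⧸ G) : 𝔡 →ₗ[ℝ] Cot ES x where
  toFun a := (P.form a).comp (s.toFun x)
  map_add' a b := by rw [map_add, ContinuousLinearMap.add_comp]
  map_smul' c a := by rw [map_smul, ContinuousLinearMap.smul_comp]; rfl

/-- The 3-form `φ_S = ½⟨ds, s⟩ + ⅙⟨[s, s], s⟩`, as `(X, Y) ↦ φ_S(X, Y, ·)`. Evaluated on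
`(X, Y, Z)` it is half the cyclic sum of `⟨ds(X, Y), s(Z)⟩` plus `⟨[s(X), s(Y)], s(Z)⟩`. -/
def phiS (x : D ⧸ G) (X Y : Tan ES x) : Cot ES x :=
  (1 / 2 : ℝ) • ((P.form (extD s.toFun x X Y)).comp (s.toFun x)
      + (P.form (s.toFun x X)).comp (extD s.toFun x Y)
      - (P.form (s.toFun x Y)).comp (extD s.toFun x X))
    + (P.form (P.bracket (s.toFun x X) (s.toFun x Y))).comp (s.toFun x)

/-- The isomorphism `(ρ_S, s^*) : 𝔡_S → TS ⊕ T*S`. -/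
def toBig (x : D ⧸ G) : 𝔡 →ₗ[ℝ] BigTan ES x :=
  (Q.rhoS x).toLinearMap.prod (s.star x)

/-- The Dirac structure `L_S = {(ρ(v), σ(v)) | v ∈ 𝔤}`. -/
def LS (x : D ⧸ G) : Submodule ℝ (BigTan ES x) := P.sub.map (s.toBig x)

/-- The almost Dirac structure `C_S = {(ρ_S(jμ), s^*(jμ)) | μ ∈ 𝔤^*}`. -/
def CS (j : IsotropicSplitting P) (x : D ⧸ G) : Submodule ℝ (BigTan ES x) :=
  (LinearMap.range j.toFun).map (s.toBig x)

end ConnectionSplitting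

/-- `σ̄ = (ρ_S ∘ j)^* : T*S → 𝔤^{**} = 𝔤`, i.e. `μ(σ̄ ξ) = ξ(ρ_S(jμ))`. -/
def sigmaBar (Q : GroupPair P ED ES G) (j : IsotropicSplitting P) (x : D ⧸ G) (ξ : Cot ES x) :
    P.sub :=
  (Module.evalEquiv ℝ P.sub).symm (ξ.toLinearMap ∘ₗ (Q.rhoS x).toLinearMap ∘ₗ j.toFun)

/-! ### Hamiltonian quasi-Poisson spaces and the two constructions -/

section Spaces

variable {E : Type*} [NormedAddCommGroup E] [NormedSpace ℝ E]
  {M : Type*} [TopologicalSpace M] [ChartedSpace E M]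

/-- Evaluation of an infinitesimal action at a point, `𝔤 → T_x M`. -/
def evalAct (ρ : P.sub →ₗ[ℝ] ∀ x : M, Tan E x) (x : M) : P.sub →ₗ[ℝ] Tan E x :=
  (LinearMap.proj x : (∀ x : M, Tan E x) →ₗ[ℝ] Tan E x) ∘ₗ ρ

/-- The dual `ρ_M^* : T*_x M → 𝔤^*`. -/
def dualAct (ρ : P.sub →ₗ[ℝ] ∀ x : M, Tan E x) (x : M) (α : Cot E x) : Module.Dual ℝ P.sub :=
  α.toLinearMap ∘ₗ evalAct ρ x

/-- An infinitesimal action of `𝔤` on `M`. -/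
structure IsInfAction [IsManifold 𝓘(ℝ, E) ∞ M] (ρ : P.sub →ₗ[ℝ] ∀ x : M, Tan E x) : Prop where
  smooth : ∀ v, SmoothVFOn (ρ v) Set.univ
  bracket : ∀ v w, VectorField.mlieBracket 𝓘(ℝ, E) (ρ v) (ρ w) = ρ (P.subBracket v w)

/-- Quasi-Poisson `𝔤`-spaces: `ℒ_{ρ_M(v)} π = -ρ_M(F(v))` and `½[π, π] = ρ_M(χ)`. -/
structure IsQuasiPoisson [IsManifold 𝓘(ℝ, E) ∞ M] (j : IsotropicSplitting P)
    (biv : ∀ x : M, Cot E x →L[ℝ] Tan E x) (ρ : P.sub →ₗ[ℝ] ∀ x : M, Tan E x) : Prop where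
  bivector : IsBivector biv
  action : IsInfAction ρ
  lie : ∀ (v : P.sub) (f g : M → ℝ), ContMDiff 𝓘(ℝ, E) 𝓘(ℝ, ℝ) ∞ f →
    ContMDiff 𝓘(ℝ, E) 𝓘(ℝ, ℝ) ∞ g → ∀ x : M,
    lieBiv (ρ v) biv f g x = - j.cobracket v (dualAct ρ x (dfun f x)) (dualAct ρ x (dfun g x))
  schouten : ∀ f g h : M → ℝ, ContMDiff 𝓘(ℝ, E) 𝓘(ℝ, ℝ) ∞ f →
    ContMDiff 𝓘(ℝ, E) 𝓘(ℝ, ℝ) ∞ g → ContMDiff 𝓘(ℝ, E) 𝓘(ℝ, ℝ) ∞ h → ∀ x : M,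
    (1 / 2 : ℝ) * schoutenSelf biv f g h x
      = j.chi (dualAct ρ x (dfun f x)) (dualAct ρ x (dfun g x)) (dualAct ρ x (dfun h x))

/-- Hamiltonian quasi-Poisson `𝔤`-spaces: `J` is `𝔤`-equivariant and `π^♯ J^* = ρ_M σ̄`. -/
structure IsHamiltonianQP [IsManifold 𝓘(ℝ, E) ∞ M] (Q : GroupPair P ED ES G)
    (j : IsotropicSplitting P) (J : M → D ⧸ G)
    (biv : ∀ x : M, Cot E x →L[ℝ] Tan E x) (ρ : P.sub →ₗ[ℝ] ∀ x : M, Tan E x) : Prop where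
  quasiPoisson : IsQuasiPoisson j biv ρ
  equivariant : ∀ (x : M) (v : P.sub), tmap E ES J x (ρ v x) = Q.rhoS (J x) v
  moment : ∀ (x : M) (ξ : Cot ES (J x)), biv x (cotmap E ES J x ξ) = ρ (sigmaBar Q j (J x) ξ) x

/-- `ρ_M` is the action induced by `J` and `L`: `dJ ∘ ρ_M = ρ` and `(ρ_M(v), J^*σ(v)) ∈ L`. -/
def IsInducedAction (s : ConnectionSplitting Q) (J : M → D ⧸ G)
    (L : ∀ x : M, Submodule ℝ (BigTan E x)) (ρ : P.sub →ₗ[ℝ] ∀ x : M, Tan E x) : Prop :=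
  ∀ (v : P.sub) (x : M), tmap E ES J x (ρ v x) = Q.rhoS (J x) v ∧
    (ρ v x, cotmap E ES J x (s.star (J x) v)) ∈ L x

/-- `ρ̂_M : v ↦ (ρ_M(v), J^*σ(v))`. -/
def rhoHat (s : ConnectionSplitting Q) (J : M → D ⧸ G)
    (ρ : P.sub →ₗ[ℝ] ∀ x : M, Tan E x) (x : M) : P.sub →ₗ[ℝ] BigTan E x :=
  (evalAct ρ x).prod (cotmap E ES J x ∘ₗ s.star (J x) ∘ₗ P.sub.subtype)

/-- `T = ρ_M ∘ ρ̄ ∘ dJ : TM → TM`, where `ρ̄ = j^* ∘ s : TS → 𝔤`. -/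
def Tmap (s : ConnectionSplitting Q) (j : IsotropicSplitting P) (J : M → D ⧸ G)
    (ρ : P.sub →ₗ[ℝ] ∀ x : M, Tan E x) (x : M) : Tan E x →L[ℝ] Tan E x :=
  (LinearMap.toContinuousLinearMap (evalAct ρ x)).comp
    ((j.star.comp (s.toFun (J x))).comp (tmap E ES J x))

/-- `h : α ↦ (π^♯(α), (1 - T^*)α)`. -/
def hMap (s : ConnectionSplitting Q) (j : IsotropicSplitting P) (J : M → D ⧸ G)
    (biv : ∀ x : M, Cot E x →L[ℝ] Tan E x) (ρ : P.sub →ₗ[ℝ] ∀ x : M, Tan E x) (x : M) :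
    Cot E x →ₗ[ℝ] BigTan E x where
  toFun α := (biv x α, α - α.comp (Tmap s j J ρ x))
  map_add' α β := by
    rw [map_add, ContinuousLinearMap.add_comp, Prod.mk_add_mk]; congr 1; abel
  map_smul' c α := by
    rw [map_smul, ContinuousLinearMap.smul_comp, ← smul_sub]; rfl

/-- `L = {ρ̂_M(v) + h(α) | v ∈ 𝔤, α ∈ T*M}`. -/
def diracOf (s : ConnectionSplitting Q) (j : IsotropicSplitting P) (J : M → D ⧸ G)
    (biv : ∀ x : M, Cot E x →L[ℝ] Tan E x) (ρ : P.sub →ₗ[ℝ] ∀ x : M, Tan E x) (x : M) :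
    Submodule ℝ (BigTan E x) :=
  LinearMap.range ((rhoHat s J ρ x).coprod (hMap s j J biv ρ x))

end Spaces

/-! ### The Hamiltonian categories -/

/-- A (finite dimensional, Hausdorff, second countable) smooth manifold with a smooth map `J`
to the manifold `S`. -/
structure ManifoldOver (ES : Type*) [NormedAddCommGroup ES] [NormedSpace ℝ ES]
    (S : Type*) [TopologicalSpace S] [ChartedSpace ES S] where
  dim : ℕ
  carrier : Type u
  [top : TopologicalSpace carrier]
  [charted : ChartedSpace (EuclideanSpace ℝ (Fin dim)) carrier]
  [isManifold : IsManifold (𝓡 dim) ∞ carrier]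
  [t2 : T2Space carrier]
  [secondCountable : SecondCountableTopology carrier]
  J : carrier → S
  smooth : ContMDiff (𝓡 dim) 𝓘(ℝ, ES) ∞ J

attribute [instance] ManifoldOver.top ManifoldOver.charted ManifoldOver.isManifold
  ManifoldOver.t2 ManifoldOver.secondCountable

section Cat

variable {S : Type*} [TopologicalSpace S] [ChartedSpace ES S]

/-- The model space of a manifold over `S`. -/
abbrev ManifoldOver.model (X : ManifoldOver.{u} ES S) : Type := EuclideanSpace ℝ (Fin X.dim)

/-- Smooth maps over `S`. -/
@[ext]
structure ManifoldOver.Hom (X Y : ManifoldOver.{u} ES S) where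
  toFun : X.carrier → Y.carrier
  smooth : ContMDiff (𝓡 X.dim) (𝓡 Y.dim) ∞ toFun
  comm : ∀ x, Y.J (toFun x) = X.J x

/-- The identity map over `S`. -/
def ManifoldOver.Hom.one (X : ManifoldOver.{u} ES S) : ManifoldOver.Hom X X :=
  ⟨id, contMDiff_id, fun _ => rfl⟩

/-- Composition of maps over `S`. -/
def ManifoldOver.Hom.trans {X Y Z : ManifoldOver.{u} ES S} (f : ManifoldOver.Hom X Y)
    (g : ManifoldOver.Hom Y Z) : ManifoldOver.Hom X Z :=
  ⟨g.toFun ∘ f.toFun, g.smooth.comp f.smooth, fun x => (g.comm _).trans (f.comm x)⟩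

instance : Category (ManifoldOver.{u} ES S) where
  Hom := ManifoldOver.Hom
  id := ManifoldOver.Hom.one
  comp := ManifoldOver.Hom.trans

end Cat

/-- An object of `M_s(𝔡, 𝔤)`: a strong Dirac map `J : (M, L) → (S, L_S)`. -/
structure DiracSpace (s : ConnectionSplitting Q) where
  base : ManifoldOver.{u} ES (D ⧸ G)
  L : ∀ x : base.carrier, Submodule ℝ (BigTan base.model x)
  strong : IsStrongDirac base.J L s.phiS s.LS

/-- An object of `M_j(𝔡, 𝔤)`: a Hamiltonian quasi-Poisson `𝔤`-space `(M, π, ρ_M, J)`. -/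
structure QPSpace (Q : GroupPair P ED ES G) (j : IsotropicSplitting P) where
  base : ManifoldOver.{u} ES (D ⧸ G)
  biv : ∀ x : base.carrier, Cot base.model x →L[ℝ] Tan base.model x
  act : P.sub →ₗ[ℝ] ∀ x : base.carrier, Tan base.model x
  ham : IsHamiltonianQP Q j base.J biv act

/-- Morphisms of `M_s(𝔡, 𝔤)`: smooth f-Dirac maps `f` with `J' ∘ f = J`. -/
@[ext]
structure DiracSpace.Hom {s : ConnectionSplitting Q} (X Y : DiracSpace.{u} s) where
  map : ManifoldOver.Hom X.base Y.base
  forward : IsForwardDirac map.toFun X.L Y.L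

/-- Morphisms of `M_j(𝔡, 𝔤)`: smooth `𝔤`-equivariant maps `f` with `f_* π = π'` and
`J' ∘ f = J`. -/
@[ext]
structure QPSpace.Hom {j : IsotropicSplitting P} (X Y : QPSpace.{u} Q j) where
  map : ManifoldOver.Hom X.base Y.base
  push : ∀ (x : X.base.carrier) (β : Cot Y.base.model (map.toFun x)),
    tmap X.base.model Y.base.model map.toFun x
      (X.biv x (cotmap X.base.model Y.base.model map.toFun x β)) = Y.biv (map.toFun x) β
  equivariant : ∀ (x : X.base.carrier) (v : P.sub),
    tmap X.base.model Y.base.model map.toFun x (X.act v x) = Y.act v (map.toFun x)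

section Composition

variable {S : Type*} [TopologicalSpace S] [ChartedSpace ES S]

theorem tmap_comp {X Y Z : ManifoldOver.{u} ES S} (f : ManifoldOver.Hom X Y)
    (g : ManifoldOver.Hom Y Z) (x : X.carrier) :
    tmap X.model Z.model (g.toFun ∘ f.toFun) x =
      (tmap Y.model Z.model g.toFun (f.toFun x)).comp (tmap X.model Y.model f.toFun x) :=
  mfderiv_comp x (g.smooth.mdifferentiable (by simp) _) (f.smooth.mdifferentiable (by simp) _)

theorem cotmap_comp {X Y Z : ManifoldOver.{u} ES S} (f : ManifoldOver.Hom X Y)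
    (g : ManifoldOver.Hom Y Z) (x : X.carrier) (β : Cot Z.model (g.toFun (f.toFun x))) :
    cotmap X.model Z.model (g.toFun ∘ f.toFun) x β =
      cotmap X.model Y.model f.toFun x (cotmap Y.model Z.model g.toFun (f.toFun x) β) := by
  change β.comp (tmap X.model Z.model (g.toFun ∘ f.toFun) x) = _
  rw [tmap_comp]
  rfl

theorem tmap_id {X : ManifoldOver.{u} ES S} (x : X.carrier) :
    tmap X.model X.model (id : X.carrier → X.carrier) x = ContinuousLinearMap.id ℝ _ :=
  mfderiv_id

theorem cotmap_id {X : ManifoldOver.{u} ES S} (x : X.carrier) (β : Cot X.model x) :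
    cotmap X.model X.model (id : X.carrier → X.carrier) x β = β := by
  change β.comp (tmap X.model X.model (id : X.carrier → X.carrier) x) = _
  rw [tmap_id]
  rfl

end Composition

/-- The identity morphism. -/
def DiracSpace.Hom.one {s : ConnectionSplitting Q} (X : DiracSpace.{u} s) : DiracSpace.Hom X X where
  map := ManifoldOver.Hom.one X.base
  forward x Y β := by
    change (Y, β) ∈ X.L x ↔ ∃ Z : Tan X.base.model x,
      tmap X.base.model X.base.model id x Z = Y ∧
        (Z, cotmap X.base.model X.base.model id x β) ∈ X.L x
    rw [cotmap_id (X := X.base) x β, tmap_id (X := X.base) x]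
    exact ⟨fun h => ⟨Y, rfl, h⟩, fun ⟨Z, hZ, h⟩ => by
      have hZ : Z = Y := hZ
      exact hZ ▸ h⟩

/-- Composition of morphisms. -/
def DiracSpace.Hom.trans {s : ConnectionSplitting Q} {X Y Z : DiracSpace.{u} s}
    (f : DiracSpace.Hom X Y) (g : DiracSpace.Hom Y Z) : DiracSpace.Hom X Z where
  map := f.map.trans g.map
  forward x W β := by
    refine (g.forward (f.map.toFun x) W β).trans ?_
    change _ ↔ ∃ U : Tan X.base.model x,
      tmap X.base.model Z.base.model (g.map.toFun ∘ f.map.toFun) x U = W ∧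
        (U, cotmap X.base.model Z.base.model (g.map.toFun ∘ f.map.toFun) x β) ∈ X.L x
    rw [cotmap_comp f.map g.map x β, tmap_comp f.map g.map x]
    constructor
    · rintro ⟨V, hV, h⟩
      obtain ⟨U, hU, h'⟩ := (f.forward x _ _).1 h
      exact ⟨U, (congrArg (tmap Y.base.model Z.base.model g.map.toFun (f.map.toFun x)) hU).trans hV,
        h'⟩
    · rintro ⟨U, hU, h⟩
      exact ⟨tmap X.base.model Y.base.model f.map.toFun x U, hU,
        (f.forward x _ _).2 ⟨U, rfl, h⟩⟩

instance (s : ConnectionSplitting Q) : Category (DiracSpace.{u} s) where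
  Hom := DiracSpace.Hom
  id := DiracSpace.Hom.one
  comp := DiracSpace.Hom.trans

/-- The identity morphism. -/
def QPSpace.Hom.one {j : IsotropicSplitting P} (X : QPSpace.{u} Q j) : QPSpace.Hom X X where
  map := ManifoldOver.Hom.one X.base
  push x β := by
    change tmap X.base.model X.base.model id x
      (X.biv x (cotmap X.base.model X.base.model id x β)) = X.biv x β
    rw [cotmap_id (X := X.base) x β, tmap_id (X := X.base) x]
    rfl
  equivariant x v := by
    change tmap X.base.model X.base.model id x (X.act v x) = X.act v x
    rw [tmap_id (X := X.base) x]
    rfl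

/-- Composition of morphisms. -/
def QPSpace.Hom.trans {j : IsotropicSplitting P} {X Y Z : QPSpace.{u} Q j}
    (f : QPSpace.Hom X Y) (g : QPSpace.Hom Y Z) : QPSpace.Hom X Z where
  map := f.map.trans g.map
  push x β := by
    change tmap X.base.model Z.base.model (g.map.toFun ∘ f.map.toFun) x
      (X.biv x (cotmap X.base.model Z.base.model (g.map.toFun ∘ f.map.toFun) x β)) = _
    rw [cotmap_comp f.map g.map x β, tmap_comp f.map g.map x]
    exact (congrArg (tmap Y.base.model Z.base.model g.map.toFun (f.map.toFun x))
      (f.push x _)).trans (g.push (f.map.toFun x) β)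
  equivariant x v := by
    change tmap X.base.model Z.base.model (g.map.toFun ∘ f.map.toFun) x (X.act v x) = _
    rw [tmap_comp f.map g.map x]
    exact (congrArg (tmap Y.base.model Z.base.model g.map.toFun (f.map.toFun x))
      (f.equivariant x v)).trans (g.equivariant (f.map.toFun x) v)

instance (Q : GroupPair P ED ES G) (j : IsotropicSplitting P) : Category (QPSpace.{u} Q j) where
  Hom := QPSpace.Hom
  id := QPSpace.Hom.one
  comp := QPSpace.Hom.trans

/-- The functor that forgets the Dirac structure. -/
def DiracSpace.forget (s : ConnectionSplitting Q) :
    DiracSpace.{u} s ⥤ ManifoldOver.{u} ES (D ⧸ G) where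
  obj X := X.base
  map f := DiracSpace.Hom.map f

/-- The functor that forgets the bivector field and the action. -/
def QPSpace.forget (Q : GroupPair P ED ES G) (j : IsotropicSplitting P) :
    QPSpace.{u} Q j ⥤ ManifoldOver.{u} ES (D ⧸ G) where
  obj X := X.base
  map f := QPSpace.Hom.map f

end Manin

end QPDirac

end

/-! At a point y of S = D/G, let q = s ∘ ρ_S (`projS`) be the projection of 𝔡 onto the image of s.
Since the image of s is isotropic, the isotropy of ker ρ_S amounts to ⟨qu, v⟩ + ⟨u, qv⟩ = ⟨u, v⟩
(`form_projS_add`), which says precisely that (ρ_S, s^*) : 𝔡 → TS ⊕ T*S is an isometry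
(`bigPairing_toBig`). At the base point the kernel is 𝔤. Elsewhere its isotropy follows from a
homogeneous linear differential equation on the connected space S (`kerForm_eq_zero`).

Linear algebra on M. The backward image C of C_S is always isotropic. If L is strong Dirac, a vector
orthogonal to L + C lies in L, has no cotangent part and is killed by dJ, so it is 0. Hence L and C
are complementary Lagrangians (`IsStrongDirac.sup_eq_top`). Over each ρ(v) the f-Dirac condition
gives a vector and transversality makes it unique, which defines ρ_M. The bivector field sends α to
the tangent part of the L-component of (0, α), and this component must be h(α)
(`IsAssocBivector.spec`). So L is spanned by the generators ρ̂_M(v) + h(α) = (ρ_M(v) + π^♯α,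
J^*s^*(U) + α) with U = v - j(ρ_M^*α), and the tangent part of a generator lies over ρ_S(U).
Conversely these generators span a complement of C for any Hamiltonian quasi-Poisson space.
Smoothness of ρ_M and π is read off from pairings with enough smooth sections
(`smoothBigAt_of_pairing`).

Integrability. For sections (X_i, J^*s^*U_i + df_i) with dJ(X_i) = ρ_S(U_i), the pairing of the
φ_S-twisted Courant bracket of the first two with the third equals ⟨[U₁, U₂], U₃⟩ plus terms
containing derivatives of U_i and f_i (`bigPairing_courant_lift`). On generators with α_i = df_i
this becomes the sum of the defects of all the quasi-Poisson axioms: the bracket relation of the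
action, the formula for the Lie derivative of π and the formula for [π, π]
(`bigPairing_courant_gen`). If the axioms hold, the sum is 0; on a Lagrangian L the pairing depends
only on values at the point, so L is closed under the bracket. If L is Dirac, the sum vanishes for
all choices of v_i and f_i, and setting some of the v_i to 0 isolates each axiom
(`IsStrongDirac.isHamiltonianQP`).

Morphisms are compared pointwise in the same way (`isForwardDirac_iff`). Since the remaining data of
a morphism are propositions about its underlying map, the identities of functors reduce to
identities of objects, which are the uniqueness statements above together with
`IsAssocBivector.diracOf_eq`. -/

noncomputable section

namespace QPDirac

open scoped Topology
open VectorField Set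
set_option linter.unusedSectionVars false

/-! ### Derivatives, vector fields and 1-forms in the preferred charts -/

section Calculus

variable {E : Type*} [NormedAddCommGroup E] [NormedSpace ℝ E]
  {M : Type*} [TopologicalSpace M] [ChartedSpace E M]
  {E' : Type*} [NormedAddCommGroup E'] [NormedSpace ℝ E']
  {M' : Type*} [TopologicalSpace M'] [ChartedSpace E' M']
  {F : Type*} [NormedAddCommGroup F] [NormedSpace ℝ F]
  {F₁ : Type*} [NormedAddCommGroup F₁] [NormedSpace ℝ F₁]
  {F₂ : Type*} [NormedAddCommGroup F₂] [NormedSpace ℝ F₂]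

/-- The differential of a vector valued function. -/
def dvec (f : M → F) (x : M) : Tan E x →L[ℝ] F := mfderiv 𝓘(ℝ, E) 𝓘(ℝ, F) f x

theorem dfun_eq_dvec (f : M → ℝ) (x : M) : dfun (E := E) f x = dvec f x := rfl

/-- Smoothness of a vector valued function at a point. -/
abbrev SmoothAt (E : Type*) [NormedAddCommGroup E] [NormedSpace ℝ E]
    {M : Type*} [TopologicalSpace M] [ChartedSpace E M]
    {F : Type*} [NormedAddCommGroup F] [NormedSpace ℝ F] (f : M → F) (x : M) : Prop :=
  ContMDiffAt 𝓘(ℝ, E) 𝓘(ℝ, F) ∞ f x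

theorem SmoothAt.mdiff {f : M → F} {x : M} (hf : SmoothAt E f x) :
    MDifferentiableAt 𝓘(ℝ, E) 𝓘(ℝ, F) f x := hf.mdifferentiableAt (by simp)

theorem extChartAt_target_nhds (x : M) :
    (extChartAt 𝓘(ℝ, E) x).target ∈ 𝓝 (extChartAt 𝓘(ℝ, E) x x) :=
  extChartAt_target_mem_nhds x

theorem mdiff_chart {f : M → F} {x : M} (hf : MDifferentiableAt 𝓘(ℝ, E) 𝓘(ℝ, F) f x) :
    DifferentiableAt ℝ (f ∘ (extChartAt 𝓘(ℝ, E) x).symm) (extChartAt 𝓘(ℝ, E) x x) := by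
  have := (mdifferentiableAt_iff _ _).1 hf |>.2
  simpa only [writtenInExtChartAt, extChartAt_model_space_eq_id, PartialEquiv.refl_coe,
    Function.id_comp, modelWithCornersSelf_coe, range_id, differentiableWithinAt_univ] using this

theorem dvec_eq_fderiv {f : M → F} {x : M} (hf : MDifferentiableAt 𝓘(ℝ, E) 𝓘(ℝ, F) f x) (v : Tan E x) :
    dvec (E := E) f x v =
      fderiv ℝ (f ∘ (extChartAt 𝓘(ℝ, E) x).symm) (extChartAt 𝓘(ℝ, E) x x) v := by
  have h := hf.mfderiv
  have h2 : dvec (E := E) f x = _ := h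
  rw [h2]
  simp only [writtenInExtChartAt, extChartAt_model_space_eq_id, PartialEquiv.refl_coe,
    Function.id_comp, modelWithCornersSelf_coe, range_id, fderivWithin_univ]
  rfl

theorem dvec_congr {f g : M → F} {x : M} (h : f =ᶠ[𝓝 x] g) :
    dvec (E := E) f x = dvec g x := by
  unfold dvec
  exact h.mfderiv_eq

theorem dvec_comp {g : M' → F} {J : M → M'} {x : M}
    (hg : MDifferentiableAt 𝓘(ℝ, E') 𝓘(ℝ, F) g (J x))
    (hJ : MDifferentiableAt 𝓘(ℝ, E) 𝓘(ℝ, E') J x) (v : Tan E x) :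
    dvec (E := E) (fun y => g (J y)) x v = dvec (E := E') g (J x) (tmap E E' J x v) :=
  congrArg (fun A => A v) (mfderiv_comp x hg hJ)

theorem dvec_const (c : F) (x : M) : dvec (E := E) (fun _ : M => c) x = 0 :=
  mfderiv_const

theorem dvec_bilin (B : F →L[ℝ] F₁ →L[ℝ] F₂) {f : M → F} {g : M → F₁} {x : M}
    (hf : MDifferentiableAt 𝓘(ℝ, E) 𝓘(ℝ, F) f x) (hg : MDifferentiableAt 𝓘(ℝ, E) 𝓘(ℝ, F₁) g x)
    (v : Tan E x) :
    dvec (E := E) (fun y => B (f y) (g y)) x v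
      = B (dvec f x v) (g x) + B (f x) (dvec g x v) := by
  have hfg : MDifferentiableAt 𝓘(ℝ, E) 𝓘(ℝ, F₂) (fun y => B (f y) (g y)) x := by
    have h1 : MDifferentiableAt 𝓘(ℝ, E) 𝓘(ℝ, F × F₁) (fun y => (f y, g y)) x :=
      hf.prodMk_space hg
    have h2 : DifferentiableAt ℝ (fun z : F × F₁ => B z.1 z.2) (f x, g x) := by fun_prop
    exact h2.mdifferentiableAt.comp x h1
  rw [dvec_eq_fderiv hfg, dvec_eq_fderiv hf, dvec_eq_fderiv hg]
  have := (B.hasFDerivAt_of_bilinear (mdiff_chart hf).hasFDerivAt (mdiff_chart hg).hasFDerivAt).fderiv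
  have e : ((fun y => B (f y) (g y)) ∘ (extChartAt 𝓘(ℝ, E) x).symm) =
    fun y => B ((f ∘ (extChartAt 𝓘(ℝ, E) x).symm) y) ((g ∘ (extChartAt 𝓘(ℝ, E) x).symm) y) := rfl
  rw [e, this, add_comm]
  simp only [Function.comp_apply, extChartAt_to_inv]
  rfl

theorem dvec_clm (A : F →L[ℝ] F₁) {f : M → F} {x : M}
    (hf : MDifferentiableAt 𝓘(ℝ, E) 𝓘(ℝ, F) f x) (v : Tan E x) :
    dvec (E := E) (fun y => A (f y)) x v = A (dvec f x v) := by
  have h := dvec_comp (E := E) (E' := F) (g := A) (J := f) A.differentiableAt.mdifferentiableAt hf v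
  rw [h]
  have : dvec (E := F) A (f x) = A := by
    exact (mfderiv_eq_fderiv (f := A)).trans A.fderiv
  rw [this]; rfl

theorem dvec_add {f g : M → F} {x : M}
    (hf : MDifferentiableAt 𝓘(ℝ, E) 𝓘(ℝ, F) f x) (hg : MDifferentiableAt 𝓘(ℝ, E) 𝓘(ℝ, F) g x) :
    dvec (E := E) (fun y => f y + g y) x = dvec f x + dvec g x :=
  mfderiv_add hf hg

theorem dvec_sub {f g : M → F} {x : M}
    (hf : MDifferentiableAt 𝓘(ℝ, E) 𝓘(ℝ, F) f x) (hg : MDifferentiableAt 𝓘(ℝ, E) 𝓘(ℝ, F) g x) :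
    dvec (E := E) (fun y => f y - g y) x = dvec f x - dvec g x :=
  mfderiv_sub hf hg

theorem dvec_neg {f : M → F} {x : M} :
    dvec (E := E) (fun y => - f y) x = - dvec f x :=
  mfderiv_neg

theorem dvec_extChartAt_self [IsManifold 𝓘(ℝ, E) ∞ M] (x : M) (v : Tan E x) :
    dvec (E := E) (extChartAt 𝓘(ℝ, E) x) x v = (v : E) := by
  have : IsManifold 𝓘(ℝ, E) 1 M := IsManifold.of_le (n := ∞) (by simp)
  have := mfderiv_extChartAt_self (I := 𝓘(ℝ, E)) (x := x)
  exact congrArg (fun A => A v) this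

/-- A vector field written in the preferred chart at `x`. -/
def chartVF (X : ∀ x : M, Tan E x) (x : M) (y : E) : E :=
  (mfderiv 𝓘(ℝ, E) 𝓘(ℝ, E) (extChartAt 𝓘(ℝ, E) x).symm y).inverse
    (X ((extChartAt 𝓘(ℝ, E) x).symm y))

/-- Smoothness of a vector field at a point. -/
def SmoothVFAt [IsManifold 𝓘(ℝ, E) ∞ M] (X : ∀ x : M, Tan E x) (x : M) : Prop :=
  ContMDiffAt 𝓘(ℝ, E) (𝓘(ℝ, E).prod 𝓘(ℝ, E)) ∞
    (fun x => TotalSpace.mk' E (E := fun x : M => TangentSpace 𝓘(ℝ, E) x) x (X x)) x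

/-- Smoothness of a 1-form at a point. -/
def SmoothFormAt [IsManifold 𝓘(ℝ, E) ∞ M] (α : ∀ x : M, Tan E x →L[ℝ] F) (x : M) : Prop :=
  ContMDiffAt 𝓘(ℝ, E) (𝓘(ℝ, E).prod 𝓘(ℝ, E →L[ℝ] F)) ∞
    (fun x => TotalSpace.mk' (E →L[ℝ] F)
      (E := fun x : M => TangentSpace 𝓘(ℝ, E) x →L[ℝ] Trivial M F x) x (α x)) x

section Charts

variable [IsManifold 𝓘(ℝ, E) ∞ M]

theorem isManifold_one : IsManifold 𝓘(ℝ, E) 1 M := IsManifold.of_le (n := ∞) (by simp)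

theorem isManifold_two : IsManifold 𝓘(ℝ, E) 2 M :=
  IsManifold.of_le (n := ∞) (WithTop.coe_le_coe.2 le_top)

theorem isInvertible_chart_symm (x : M) {y : E} (hy : y ∈ (extChartAt 𝓘(ℝ, E) x).target) :
    (mfderiv 𝓘(ℝ, E) 𝓘(ℝ, E) (extChartAt 𝓘(ℝ, E) x).symm y).IsInvertible := by
  have := isManifold_one (E := E) (M := M)
  have h := isInvertible_mfderivWithin_extChartAt_symm (I := 𝓘(ℝ, E)) hy
  simpa only [modelWithCornersSelf_coe, range_id, mfderivWithin_univ] using h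

theorem chart_symm_chartVF (X : ∀ x : M, Tan E x) (x : M) {y : E}
    (hy : y ∈ (extChartAt 𝓘(ℝ, E) x).target) :
    mfderiv 𝓘(ℝ, E) 𝓘(ℝ, E) (extChartAt 𝓘(ℝ, E) x).symm y (chartVF (E := E) X x y)
      = X ((extChartAt 𝓘(ℝ, E) x).symm y) :=
  (isInvertible_chart_symm x hy).self_apply_inverse _

/-- The fibre of the tangent bundle at x is the model space, identified through the preferred chart
at x, so that chart has identity derivative at its own centre. -/
theorem mfderiv_chart_symm_self (x : M) (v : E) :
    mfderiv 𝓘(ℝ, E) 𝓘(ℝ, E) (extChartAt 𝓘(ℝ, E) x).symm (extChartAt 𝓘(ℝ, E) x x) v = (v : E) := by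
  have := isManifold_one (E := E) (M := M)
  have h := mfderivWithin_range_extChartAt_symm (I := 𝓘(ℝ, E)) (x := x)
  simp only [modelWithCornersSelf_coe, range_id, mfderivWithin_univ] at h
  exact congrArg (fun A : E →L[ℝ] E => A v) h

theorem chartVF_self (X : ∀ x : M, Tan E x) (x : M) :
    chartVF X x (extChartAt 𝓘(ℝ, E) x x) = X x := by
  have h := chart_symm_chartVF X x (mem_extChartAt_target (I := 𝓘(ℝ, E)) x)
  have h2 := mfderiv_chart_symm_self (E := E) x (chartVF X x (extChartAt 𝓘(ℝ, E) x x))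
  have h3 : X ((extChartAt 𝓘(ℝ, E) x).symm (extChartAt 𝓘(ℝ, E) x x)) = (X x : E) := by
    rw [extChartAt_to_inv]
  exact (h2.symm.trans h).trans h3

theorem SmoothVFAt.mdiff {X : ∀ x : M, Tan E x} {x : M} (hX : SmoothVFAt X x) :
    MDifferentiableAt 𝓘(ℝ, E) (𝓘(ℝ, E).prod 𝓘(ℝ, E))
    (fun x => TotalSpace.mk' E (E := fun x : M => TangentSpace 𝓘(ℝ, E) x) x (X x)) x :=
  ContMDiffAt.mdifferentiableAt hX (by simp)

theorem chartVF_differentiableAt [CompleteSpace E] {X : ∀ x : M, Tan E x} {x : M}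
    (hX : SmoothVFAt X x) :
    DifferentiableAt ℝ (chartVF X x) (extChartAt 𝓘(ℝ, E) x x) := by
  have := isManifold_two (E := E) (M := M)
  have h := MDifferentiableWithinAt.differentiableWithinAt_mpullbackWithin_vectorField
    (I := 𝓘(ℝ, E)) (s := univ) (V := X) hX.mdiff.mdifferentiableWithinAt
  simp only [modelWithCornersSelf_coe, range_id, preimage_univ, inter_univ,
    mpullbackWithin_univ] at h
  exact (differentiableWithinAt_univ (E := E) (F := E)).1 h

theorem mlieBracket_eq_chart (X Y : ∀ x : M, Tan E x) (x : M) :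
    mlieBracket 𝓘(ℝ, E) X Y x =
      (lieBracket ℝ (chartVF X x) (chartVF Y x) (extChartAt 𝓘(ℝ, E) x x) : E) := by
  have := isManifold_one (E := E) (M := M)
  rw [← mlieBracketWithin_univ, mlieBracketWithin_apply, mfderiv_extChartAt_self]
  refine (congrArg (fun A : E →L[ℝ] E => A _)
    (ContinuousLinearMap.inverse_id (R := ℝ) (M := E))).trans ?_
  simp only [modelWithCornersSelf_coe, range_id, preimage_univ, inter_univ,
    mpullbackWithin_univ]
  exact congrFun (lieBracketWithin_univ (𝕜 := ℝ) (E := E)) _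

theorem chartForm_chartVF (α : ∀ x : M, Tan E x →L[ℝ] F) (X : ∀ x : M, Tan E x) (x : M) :
    (fun y => chartForm α x y (chartVF X x y)) =ᶠ[𝓝 (extChartAt 𝓘(ℝ, E) x x)]
      (fun z => α z (X z)) ∘ (extChartAt 𝓘(ℝ, E) x).symm := by
  filter_upwards [extChartAt_target_mem_nhds (I := 𝓘(ℝ, E)) x] with y hy
  exact congrArg (α ((extChartAt 𝓘(ℝ, E) x).symm y)) (chart_symm_chartVF X x hy)

theorem chartForm_self (α : ∀ x : M, Tan E x →L[ℝ] F) (x : M) (v : Tan E x) :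
    chartForm α x (extChartAt 𝓘(ℝ, E) x x) v = α x v := by
  have h3 : (α ((extChartAt 𝓘(ℝ, E) x).symm (extChartAt 𝓘(ℝ, E) x x)) : E →L[ℝ] F) = α x := by
    rw [extChartAt_to_inv]
  have h2 := mfderiv_chart_symm_self (E := E) x v
  calc chartForm α x (extChartAt 𝓘(ℝ, E) x x) v
      = (α ((extChartAt 𝓘(ℝ, E) x).symm (extChartAt 𝓘(ℝ, E) x x)) : E →L[ℝ] F)
        (mfderiv 𝓘(ℝ, E) 𝓘(ℝ, E) (extChartAt 𝓘(ℝ, E) x).symm (extChartAt 𝓘(ℝ, E) x x) v : E) := rfl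
    _ = (α x : E →L[ℝ] F) (v : E) := by rw [h3]; exact congrArg (α x : E →L[ℝ] F) h2

/-- The trivialization at x of the bundle of F-valued covectors is composition with the derivative
of the inverse chart. Smoothness thus becomes that of a map into a fixed normed space. -/
theorem smoothFormAt_iff {α : ∀ x : M, Tan E x →L[ℝ] F} {x : M} :
    SmoothFormAt α x ↔ SmoothAt E (fun y => chartForm α x (extChartAt 𝓘(ℝ, E) x y)) x := by
  have := isManifold_one (E := E) (M := M)
  unfold SmoothFormAt
  rw [contMDiffAt_hom_bundle]
  have : ContMDiffAt 𝓘(ℝ, E) 𝓘(ℝ, E) ∞ (fun y : M => y) x := contMDiffAt_id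
  simp only [this, true_and]
  apply Filter.EventuallyEq.contMDiffAt_iff
  filter_upwards [(chartAt E x).open_source.mem_nhds (mem_chart_source E x)] with y hy
  have h := TangentBundle.symmL_trivializationAt (I := 𝓘(ℝ, E)) hy
  simp only [modelWithCornersSelf_coe, range_id, mfderivWithin_univ] at h
  ext v
  simp only [ContinuousLinearMap.inCoordinates, chartForm, h]
  have h3 : (α ((extChartAt 𝓘(ℝ, E) x).symm (extChartAt 𝓘(ℝ, E) x y)) : E →L[ℝ] F) = α y := by
    rw [(extChartAt 𝓘(ℝ, E) x).left_inv (by simpa using hy)]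
  refine (congrArg (fun A : F →L[ℝ] F => A _)
    (Bundle.Trivial.continuousLinearMapAt_trivialization ℝ M F y)).trans ?_
  exact congrArg (fun A : E →L[ℝ] F => A
    (mfderiv 𝓘(ℝ, E) 𝓘(ℝ, E) (extChartAt 𝓘(ℝ, E) x).symm (extChartAt 𝓘(ℝ, E) x y) v : E)) h3.symm

theorem chartForm_differentiableAt {α : ∀ x : M, Tan E x →L[ℝ] F} {x : M}
    (hα : SmoothFormAt α x) :
    DifferentiableAt ℝ (chartForm α x) (extChartAt 𝓘(ℝ, E) x x) := by
  have h := mdiff_chart (smoothFormAt_iff.1 hα).mdiff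
  refine h.congr_of_eventuallyEq ?_
  filter_upwards [extChartAt_target_mem_nhds (I := 𝓘(ℝ, E)) x] with y hy
  simp only [Function.comp_apply, (extChartAt 𝓘(ℝ, E) x).right_inv hy]

/-- Cartan's formula for the exterior derivative of a 1-form. -/
theorem extD_apply [CompleteSpace E] {α : ∀ x : M, Tan E x →L[ℝ] F} {X Y : ∀ x : M, Tan E x} {x : M}
    (hα : SmoothFormAt α x) (hX : SmoothVFAt X x) (hY : SmoothVFAt Y x)
    (hαX : MDifferentiableAt 𝓘(ℝ, E) 𝓘(ℝ, F) (fun y => α y (X y)) x)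
    (hαY : MDifferentiableAt 𝓘(ℝ, E) 𝓘(ℝ, F) (fun y => α y (Y y)) x) :
    extD α x (X x) (Y x) = dvec (fun y => α y (Y y)) x (X x) - dvec (fun y => α y (X y)) x (Y x)
      - α x (mlieBracket 𝓘(ℝ, E) X Y x) := by
  have hA := chartForm_differentiableAt hα
  have hX' := chartVF_differentiableAt hX
  have hY' := chartVF_differentiableAt hY
  have e1 := (hA.hasFDerivAt.clm_apply hY'.hasFDerivAt).fderiv
  have e2 := (hA.hasFDerivAt.clm_apply hX'.hasFDerivAt).fderiv
  rw [dvec_eq_fderiv hαX, dvec_eq_fderiv hαY, ← (chartForm_chartVF α X x).fderiv_eq,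
    ← (chartForm_chartVF α Y x).fderiv_eq, e1, e2, ← chartForm_self α x, mlieBracket_eq_chart]
  have hx := chartVF_self X x
  have hy := chartVF_self Y x
  -- The derivatives of X and Y produced by the product rule are exactly those in [X, Y]; what
  -- survives is the antisymmetrized derivative of the form.
  have key : ∀ (A : E →L[ℝ] F) (DA : E →L[ℝ] E →L[ℝ] F) (DX DY : E →L[ℝ] E) (a b : E),
      (DA - DA.flip) a b = (A ∘SL DY + DA.flip b) a - (A ∘SL DX + DA.flip a) b - A (DY a - DX b) := by
    intro A DA DX DY a b
    simp only [_root_.sub_apply, _root_.add_apply,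
      ContinuousLinearMap.flip_apply, ContinuousLinearMap.comp_apply, map_sub]
    abel
  rw [lieBracket, hx, hy]
  exact key _ _ _ _ _ _

end Charts

end Calculus

/-! ### Pointwise smoothness, d² = 0 and coordinate vector fields -/

section Smoothness

variable {E : Type*} [NormedAddCommGroup E] [NormedSpace ℝ E]
  {M : Type*} [TopologicalSpace M] [ChartedSpace E M] [IsManifold 𝓘(ℝ, E) ∞ M]
  {E' : Type*} [NormedAddCommGroup E'] [NormedSpace ℝ E']
  {M' : Type*} [TopologicalSpace M'] [ChartedSpace E' M'] [IsManifold 𝓘(ℝ, E') ∞ M']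
  {F : Type*} [NormedAddCommGroup F] [NormedSpace ℝ F]

theorem smoothVFOn_univ {X : ∀ x : M, Tan E x} :
    SmoothVFOn X univ ↔ ∀ x, SmoothVFAt X x := by
  simp only [SmoothVFOn, contMDiffOn_univ]; rfl

theorem smoothFormOn_univ {α : ∀ x : M, Tan E x →L[ℝ] F} :
    SmoothFormOn α univ ↔ ∀ x, SmoothFormAt α x := by
  simp only [SmoothFormOn, contMDiffOn_univ]; rfl

theorem SmoothVFOn.at {X : ∀ x : M, Tan E x} {U : Set M} (h : SmoothVFOn X U) (hU : IsOpen U)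
    {x : M} (hx : x ∈ U) : SmoothVFAt X x :=
  ContMDiffOn.contMDiffAt h (hU.mem_nhds hx)

theorem SmoothFormOn.at {α : ∀ x : M, Tan E x →L[ℝ] F} {U : Set M} (h : SmoothFormOn α U)
    (hU : IsOpen U) {x : M} (hx : x ∈ U) : SmoothFormAt α x :=
  ContMDiffOn.contMDiffAt h (hU.mem_nhds hx)

theorem SmoothFormAt.apply {α : ∀ x : M, Tan E x →L[ℝ] F} {X : ∀ x : M, Tan E x} {x : M}
    (hα : SmoothFormAt α x) (hX : SmoothVFAt X x) : SmoothAt E (fun y => α y (X y)) x := by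
  have h := ContMDiffAt.clm_bundle_apply (F₁ := E) (F₂ := F) (b := fun y : M => y)
    (E₁ := fun x : M => TangentSpace 𝓘(ℝ, E) x) (E₂ := Trivial M F) hα hX
  exact (contMDiffAt_totalSpace.1 h).2

theorem smoothVFAt_iff {X : ∀ x : M, Tan E x} {x : M} :
    SmoothVFAt X x ↔ SmoothAt E (fun y => dvec (E := E) (extChartAt 𝓘(ℝ, E) x) y (X y)) x := by
  have := isManifold_one (E := E) (M := M)
  unfold SmoothVFAt
  rw [contMDiffAt_totalSpace]
  have : ContMDiffAt 𝓘(ℝ, E) 𝓘(ℝ, E) ∞ (fun y : M => y) x := contMDiffAt_id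
  simp only [this, true_and]
  apply Filter.EventuallyEq.contMDiffAt_iff
  filter_upwards [(chartAt E x).open_source.mem_nhds (mem_chart_source E x)] with y hy
  have h := TangentBundle.continuousLinearMapAt_trivializationAt (I := 𝓘(ℝ, E)) hy
  refine Eq.trans ?_ (congrArg (fun A : E →L[ℝ] E => A (X y)) h)
  symm
  exact congrFun (Trivialization.coe_linearMapAt_of_mem (R := ℝ) _ (by simpa using hy)) _

theorem smoothAt_chart (x : M) : SmoothAt E (extChartAt 𝓘(ℝ, E) x) x :=
  contMDiffAt_extChartAt

theorem chartForm_dvec {g : M → F} {x : M}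
    (hg : ∀ᶠ y in 𝓝 x, MDifferentiableAt 𝓘(ℝ, E) 𝓘(ℝ, F) g y) :
    ∀ᶠ z in 𝓝 (extChartAt 𝓘(ℝ, E) x x), chartForm (dvec (E := E) g) x z =
      fderiv ℝ (g ∘ (extChartAt 𝓘(ℝ, E) x).symm) z := by
  have hc : Filter.Tendsto (extChartAt 𝓘(ℝ, E) x).symm (𝓝 (extChartAt 𝓘(ℝ, E) x x)) (𝓝 x) := by
    have := (continuousAt_extChartAt_symm (I := 𝓘(ℝ, E)) x).tendsto
    rwa [extChartAt_to_inv] at this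
  filter_upwards [hc.eventually hg, extChartAt_target_mem_nhds (I := 𝓘(ℝ, E)) x] with z hz hzt
  have h1 : MDifferentiableAt 𝓘(ℝ, E) 𝓘(ℝ, E) (extChartAt 𝓘(ℝ, E) x).symm z := by
    have := isManifold_one (E := E) (M := M)
    have := mdifferentiableWithinAt_extChartAt_symm (I := 𝓘(ℝ, E)) hzt
    simpa only [modelWithCornersSelf_coe, range_id, mdifferentiableWithinAt_univ] using this
  have h2 := mfderiv_comp z hz h1
  exact h2.symm.trans mfderiv_eq_fderiv

theorem SmoothAt.eventually_mdiff {g : M → F} {x : M} (hg : SmoothAt E g x) :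
    ∀ᶠ y in 𝓝 x, MDifferentiableAt 𝓘(ℝ, E) 𝓘(ℝ, F) g y := by
  have h1 : ContMDiffAt 𝓘(ℝ, E) 𝓘(ℝ, F) 1 g x := hg.of_le (by simp)
  have := isManifold_one (E := E) (M := M)
  filter_upwards [(contMDiffAt_iff_contMDiffAt_nhds (by simp)).1 h1] with y hy
  exact hy.mdifferentiableAt (by simp)

theorem SmoothAt.contDiffAt_chart {g : M → F} {x : M} (hg : SmoothAt E g x) :
    ContDiffAt ℝ ∞ (g ∘ (extChartAt 𝓘(ℝ, E) x).symm) (extChartAt 𝓘(ℝ, E) x x) := by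
  have := (contMDiffAt_iff.1 hg).2
  simpa only [extChartAt_model_space_eq_id, PartialEquiv.refl_coe,
    Function.id_comp, modelWithCornersSelf_coe, range_id, contDiffWithinAt_univ] using this

theorem smoothFormAt_dvec {g : M → F} {x : M} (hg : SmoothAt E g x) :
    SmoothFormAt (dvec (E := E) g) x := by
  rw [smoothFormAt_iff]
  have h1 : ContDiffAt ℝ ∞ (fderiv ℝ (g ∘ (extChartAt 𝓘(ℝ, E) x).symm)) (extChartAt 𝓘(ℝ, E) x x) :=
    hg.contDiffAt_chart.fderiv_right (by simp)
  have h2 : SmoothAt E (fun y => fderiv ℝ (g ∘ (extChartAt 𝓘(ℝ, E) x).symm)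
      (extChartAt 𝓘(ℝ, E) x y)) x := h1.contMDiffAt.comp x (smoothAt_chart x)
  refine h2.congr_of_eventuallyEq ?_
  exact (continuousAt_extChartAt (I := 𝓘(ℝ, E)) x).eventually (chartForm_dvec hg.eventually_mdiff)

theorem extD_dvec {g : M → F} {x : M} (hg : SmoothAt E g x) : extD (dvec (E := E) g) x = 0 := by
  have h1 := hg.contDiffAt_chart
  have h2 : IsSymmSndFDerivAt ℝ (g ∘ (extChartAt 𝓘(ℝ, E) x).symm) (extChartAt 𝓘(ℝ, E) x x) :=
    h1.isSymmSndFDerivAt (by simp; exact WithTop.coe_le_coe.2 le_top)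
  have h3 : fderiv ℝ (chartForm (dvec (E := E) g) x) (extChartAt 𝓘(ℝ, E) x x) =
      fderiv ℝ (fderiv ℝ (g ∘ (extChartAt 𝓘(ℝ, E) x).symm)) (extChartAt 𝓘(ℝ, E) x x) :=
    Filter.EventuallyEq.fderiv_eq (chartForm_dvec hg.eventually_mdiff)
  unfold extD
  rw [h3]
  have : ∀ A : E →L[ℝ] E →L[ℝ] F, (∀ u v, A u v = A v u) → A - A.flip = 0 := by
    intro A hA
    ext u v
    simp [hA u v]
  exact this _ fun u v => h2 u v

/-- The bracket of vector fields is the commutator of the derivations of functions. -/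
theorem dvec_mlieBracket [CompleteSpace E] {g : M → F} {X Y : ∀ x : M, Tan E x} {x : M}
    (hg : SmoothAt E g x) (hX : SmoothVFAt X x) (hY : SmoothVFAt Y x) :
    dvec (E := E) g x (mlieBracket 𝓘(ℝ, E) X Y x) =
      dvec (fun y => dvec (E := E) g y (Y y)) x (X x)
        - dvec (fun y => dvec (E := E) g y (X y)) x (Y x) := by
  have hd := smoothFormAt_dvec hg
  have h := extD_apply hd hX hY (hd.apply hX).mdiff (hd.apply hY).mdiff
  rw [extD_dvec hg] at h
  have h' : (0 : F) = _ := h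
  rw [eq_comm, sub_eq_zero] at h'
  exact h'.symm

theorem extD_eq [CompleteSpace E] {α : ∀ x : M, Tan E x →L[ℝ] F} {X Y : ∀ x : M, Tan E x} {x : M}
    (hα : SmoothFormAt α x) (hX : SmoothVFAt X x) (hY : SmoothVFAt Y x) :
    extD α x (X x) (Y x) = dvec (fun y => α y (Y y)) x (X x) - dvec (fun y => α y (X y)) x (Y x)
      - α x (mlieBracket 𝓘(ℝ, E) X Y x) :=
  extD_apply hα hX hY (hα.apply hX).mdiff (hα.apply hY).mdiff

/-- The vector field that is constant in the preferred chart at `x`. -/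
def coordVF (x : M) (v : E) (y : M) : Tan E y :=
  (mfderiv 𝓘(ℝ, E) 𝓘(ℝ, E) (extChartAt 𝓘(ℝ, E) x).symm (extChartAt 𝓘(ℝ, E) x y) v : E)

theorem dvec_chart_coordVF (x : M) (v : E) :
    ∀ᶠ y in 𝓝 x, dvec (E := E) (extChartAt 𝓘(ℝ, E) x) y (coordVF x v y) = v := by
  have := isManifold_one (E := E) (M := M)
  filter_upwards [(chartAt E x).open_source.mem_nhds (mem_chart_source E x)] with y hy
  have hy' : y ∈ (extChartAt 𝓘(ℝ, E) x).source := by simpa using hy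
  have h := mfderiv_extChartAt_comp_mfderivWithin_extChartAt_symm' (I := 𝓘(ℝ, E)) hy'
  simp only [modelWithCornersSelf_coe, range_id, mfderivWithin_univ] at h
  exact congrArg (fun A : E →L[ℝ] E => A v) h

theorem smoothVFAt_coordVF (x : M) (v : E) : SmoothVFAt (coordVF (E := E) x v) x := by
  rw [smoothVFAt_iff]
  exact (contMDiffAt_const (c := v)).congr_of_eventuallyEq (dvec_chart_coordVF x v)

theorem coordVF_self (x : M) (v : E) : coordVF (E := E) x v x = (v : E) :=
  mfderiv_chart_symm_self x v

/-- In finite dimensions an operator is the sum of the rank one operators built from its values on a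
basis. -/
theorem smoothAt_clm_of_apply {F₁ : Type*} [NormedAddCommGroup F₁] [NormedSpace ℝ F₁]
    [FiniteDimensional ℝ F₁] {A : M → F₁ →L[ℝ] F} {x : M}
    (h : ∀ v, SmoothAt E (fun y => A y v) x) : SmoothAt E A x := by
  let b := Module.finBasis ℝ F₁
  have e : A = fun y => ∑ i, (ContinuousLinearMap.smulRightL ℝ F₁ F
      (LinearMap.toContinuousLinearMap (b.coord i))) (A y (b i)) := by
    ext y v
    conv_lhs => rw [← b.sum_repr v, map_sum]
    simp only [map_smul]
    simp
  rw [e]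
  refine contMDiffAt_finsetSum fun i _ => ?_
  exact (ContinuousLinearMap.contMDiff _).contMDiffAt.comp x (h (b i))

theorem smoothFormAt_of_apply [FiniteDimensional ℝ E] {α : ∀ x : M, Tan E x →L[ℝ] F} {x : M}
    (h : ∀ X : ∀ x : M, Tan E x, SmoothVFAt X x → SmoothAt E (fun y => α y (X y)) x) :
    SmoothFormAt α x := by
  rw [smoothFormAt_iff]
  refine smoothAt_clm_of_apply fun v => ?_
  refine (h _ (smoothVFAt_coordVF x v)).congr_of_eventuallyEq ?_
  filter_upwards [(chartAt E x).open_source.mem_nhds (mem_chart_source E x)] with y hy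
  have h3 : (α ((extChartAt 𝓘(ℝ, E) x).symm (extChartAt 𝓘(ℝ, E) x y)) : E →L[ℝ] F) = α y := by
    rw [(extChartAt 𝓘(ℝ, E) x).left_inv (by simpa using hy)]
  exact congrArg (fun A : E →L[ℝ] F => A (coordVF (E := E) x v y)) h3

end Smoothness

/-! ### Smooth sections, pull-backs of forms and bundle maps -/

section Sections

variable {E : Type*} [NormedAddCommGroup E] [NormedSpace ℝ E]
  {M : Type*} [TopologicalSpace M] [ChartedSpace E M] [IsManifold 𝓘(ℝ, E) ∞ M]
  {E' : Type*} [NormedAddCommGroup E'] [NormedSpace ℝ E']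
  {M' : Type*} [TopologicalSpace M'] [ChartedSpace E' M'] [IsManifold 𝓘(ℝ, E') ∞ M']
  {F : Type*} [NormedAddCommGroup F] [NormedSpace ℝ F]
  {F₁ : Type*} [NormedAddCommGroup F₁] [NormedSpace ℝ F₁]

theorem SmoothVFAt.add {X Y : ∀ x : M, Tan E x} {x : M} (hX : SmoothVFAt X x)
    (hY : SmoothVFAt Y x) : SmoothVFAt (fun y => X y + Y y) x :=
  ContMDiffAt.add_section hX hY

theorem SmoothVFAt.sub {X Y : ∀ x : M, Tan E x} {x : M} (hX : SmoothVFAt X x)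
    (hY : SmoothVFAt Y x) : SmoothVFAt (fun y => X y - Y y) x :=
  ContMDiffAt.sub_section hX hY

theorem SmoothVFAt.smul {X : ∀ x : M, Tan E x} {f : M → ℝ} {x : M} (hf : SmoothAt E f x)
    (hX : SmoothVFAt X x) : SmoothVFAt (fun y => f y • X y) x :=
  ContMDiffAt.smul_section hf hX

theorem SmoothVFAt.sum {ι : Type*} {s : Finset ι} {X : ι → ∀ x : M, Tan E x} {x : M}
    (hX : ∀ i ∈ s, SmoothVFAt (X i) x) : SmoothVFAt (fun y => ∑ i ∈ s, X i y) x :=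
  ContMDiffAt.sum_section hX

theorem SmoothVFAt.congr {X Y : ∀ x : M, Tan E x} {x : M} (hX : SmoothVFAt X x)
    (h : ∀ᶠ y in 𝓝 x, Y y = X y) : SmoothVFAt Y x := by
  refine ContMDiffAt.congr_of_eventuallyEq hX ?_
  filter_upwards [h] with y hy
  rw [hy]

theorem smoothVFAt_zero (x : M) : SmoothVFAt (fun y : M => (0 : Tan E y)) x :=
  (contMDiff_zeroSection ℝ _).contMDiffAt

theorem SmoothFormAt.add {α β : ∀ x : M, Tan E x →L[ℝ] F} {x : M} (hα : SmoothFormAt α x)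
    (hβ : SmoothFormAt β x) : SmoothFormAt (fun y => α y + β y) x :=
  ContMDiffAt.add_section hα hβ

theorem SmoothFormAt.smul {α : ∀ x : M, Tan E x →L[ℝ] F} {f : M → ℝ} {x : M}
    (hf : SmoothAt E f x) (hα : SmoothFormAt α x) : SmoothFormAt (fun y => f y • α y) x :=
  ContMDiffAt.smul_section hf hα

theorem SmoothFormAt.congr {α β : ∀ x : M, Tan E x →L[ℝ] F} {x : M} (hα : SmoothFormAt α x)
    (h : ∀ᶠ y in 𝓝 x, β y = α y) : SmoothFormAt β x := by
  refine ContMDiffAt.congr_of_eventuallyEq hα ?_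
  filter_upwards [h] with y hy
  rw [hy]

theorem smoothFormAt_zero (x : M) : SmoothFormAt (fun y : M => (0 : Tan E y →L[ℝ] F)) x :=
  (contMDiff_zeroSection ℝ _).contMDiffAt

theorem smoothAt_form_tmap {J : M → M'} (hJ : ContMDiff 𝓘(ℝ, E) 𝓘(ℝ, E') ∞ J)
    {α : ∀ y : M', Tan E' y →L[ℝ] F} {X : ∀ x : M, Tan E x} {x : M}
    (hα : SmoothFormAt α (J x)) (hX : SmoothVFAt X x) :
    SmoothAt E (fun y => α (J y) (tmap E E' J y (X y))) x := by
  have h1 : ContMDiffAt 𝓘(ℝ, E) (𝓘(ℝ, E').prod 𝓘(ℝ, E')) ∞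
      (fun y => TotalSpace.mk' E' (E := fun x : M' => TangentSpace 𝓘(ℝ, E') x) (J y)
        (tmap E E' J y (X y))) x :=
    (hJ.contMDiff_tangentMap (m := ∞) (by simp)).contMDiffAt.comp x hX
  have h2 := ContMDiffAt.comp x hα hJ.contMDiffAt
  have h := ContMDiffAt.clm_bundle_apply (F₁ := E') (F₂ := F) (b := J)
    (E₁ := fun x : M' => TangentSpace 𝓘(ℝ, E') x) (E₂ := Trivial M' F) h2 h1
  exact (contMDiffAt_totalSpace.1 h).2

theorem SmoothFormAt.pullback [FiniteDimensional ℝ E] {J : M → M'}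
    (hJ : ContMDiff 𝓘(ℝ, E) 𝓘(ℝ, E') ∞ J)
    {α : ∀ y : M', Tan E' y →L[ℝ] F} {x : M} (hα : SmoothFormAt α (J x)) :
    SmoothFormAt (fun y => (α (J y)).comp (tmap E E' J y)) x :=
  smoothFormAt_of_apply fun _ hX => smoothAt_form_tmap hJ hα hX

theorem extD_congr {α β : ∀ x : M, Tan E x →L[ℝ] F} {x : M} (h : ∀ᶠ y in 𝓝 x, α y = β y) :
    extD α x = extD β x := by
  have hc : Filter.Tendsto (extChartAt 𝓘(ℝ, E) x).symm (𝓝 (extChartAt 𝓘(ℝ, E) x x)) (𝓝 x) := by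
    have := (continuousAt_extChartAt_symm (I := 𝓘(ℝ, E)) x).tendsto
    rwa [extChartAt_to_inv] at this
  have h2 : chartForm α x =ᶠ[𝓝 (extChartAt 𝓘(ℝ, E) x x)] chartForm β x := by
    filter_upwards [hc.eventually h] with z hz
    simp only [chartForm, hz]
  unfold extD
  rw [h2.fderiv_eq]

/-- `d(A dg) = dA ∧ dg`. -/
theorem extD_comp_dvec [FiniteDimensional ℝ E] {A : M → F₁ →L[ℝ] F} {g : M → F₁} {x : M}
    (hA : SmoothAt E A x) (hg : SmoothAt E g x) (u v : Tan E x) :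
    extD (fun y => (A y).comp (dvec (E := E) g y)) x u v =
      dvec (E := E) A x u (dvec (E := E) g x v) - dvec (E := E) A x v (dvec (E := E) g x u) := by
  have : CompleteSpace E := FiniteDimensional.complete ℝ E
  have hu := smoothVFAt_coordVF (E := E) x u
  have hv := smoothVFAt_coordVF (E := E) x v
  have hd := smoothFormAt_dvec hg
  have hAd : SmoothFormAt (fun y => (A y).comp (dvec (E := E) g y)) x :=
    smoothFormAt_of_apply fun X hX => hA.clm_apply (hd.apply hX)
  have h := extD_eq hAd hu hv
  have e1 := dvec_bilin (E := E) (ContinuousLinearMap.id ℝ (F₁ →L[ℝ] F)) hA.mdiff (hd.apply hu).mdiff v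
  have e2 := dvec_bilin (E := E) (ContinuousLinearMap.id ℝ (F₁ →L[ℝ] F)) hA.mdiff (hd.apply hv).mdiff u
  have hb := dvec_mlieBracket hg hu hv
  have cu : coordVF (E := E) x u x = u := coordVF_self (E := E) x u
  have cv : coordVF (E := E) x v x = v := coordVF_self (E := E) x v
  simp only [ContinuousLinearMap.comp_apply, hb, map_sub, cu, cv,
    ContinuousLinearMap.id_apply] at h e1 e2 ⊢
  rw [h, e1, e2]
  abel

/-- The exterior derivative commutes with pull-backs. -/
theorem extD_pullback [FiniteDimensional ℝ E] [FiniteDimensional ℝ E'] {J : M → M'}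
    (hJ : ContMDiff 𝓘(ℝ, E) 𝓘(ℝ, E') ∞ J)
    {α : ∀ y : M', Tan E' y →L[ℝ] F} {x : M} (hα : SmoothFormAt α (J x)) (u v : Tan E x) :
    extD (fun y => (α (J y)).comp (tmap E E' J y)) x u v
      = extD α (J x) (tmap E E' J x u) (tmap E E' J x v) := by
  have := isManifold_one (E := E') (M := M')
  -- Near J x one has α = A ∘ dψ with ψ a chart and A a matrix of coefficients. Both sides become dA
  -- ∧ dψ and are compared by the chain rule.
  set ψ := extChartAt 𝓘(ℝ, E') (J x) with hψ
  let A : M' → E' →L[ℝ] F := fun y => chartForm α (J x) (ψ y)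
  have hA : SmoothAt E' A (J x) := smoothFormAt_iff.1 hα
  have hψs : SmoothAt E' ψ (J x) := smoothAt_chart (J x)
  have hsrc : ∀ᶠ y in 𝓝 (J x), y ∈ (chartAt E' (J x)).source :=
    (chartAt E' (J x)).open_source.mem_nhds (mem_chart_source E' _)
  have hloc : ∀ y ∈ (chartAt E' (J x)).source, α y = (A y).comp (dvec (E := E') ψ y) := by
    intro y hy
    have hy' : y ∈ (extChartAt 𝓘(ℝ, E') (J x)).source := by simpa using hy
    have h := mfderivWithin_extChartAt_symm_comp_mfderiv_extChartAt' (I := 𝓘(ℝ, E')) hy'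
    simp only [modelWithCornersSelf_coe, range_id, mfderivWithin_univ] at h
    have h3 : (α ((extChartAt 𝓘(ℝ, E') (J x)).symm (extChartAt 𝓘(ℝ, E') (J x) y)) : E' →L[ℝ] F)
        = α y := by
      rw [(extChartAt 𝓘(ℝ, E') (J x)).left_inv hy']
    ext w
    have h4 := congrArg (fun B : E' →L[ℝ] E' => (α y : E' →L[ℝ] F) (B w)) h
    have h5 := congrArg (fun B : E' →L[ℝ] F => B ((mfderiv 𝓘(ℝ, E') 𝓘(ℝ, E')
      (extChartAt 𝓘(ℝ, E') (J x)).symm (extChartAt 𝓘(ℝ, E') (J x) y) :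
        E' →L[ℝ] E') (dvec (E := E') ψ y w))) h3
    exact h4.symm.trans h5.symm
  have h1 : extD α (J x) = extD (fun y => (A y).comp (dvec (E := E') ψ y)) (J x) :=
    extD_congr (hsrc.mono fun y hy => hloc y hy)
  have hAJ : SmoothAt E (fun y => A (J y)) x := ContMDiffAt.comp x hA hJ.contMDiffAt
  have hψJ : SmoothAt E (fun y => ψ (J y)) x := ContMDiffAt.comp x hψs hJ.contMDiffAt
  have hJd : ∀ y, MDifferentiableAt 𝓘(ℝ, E) 𝓘(ℝ, E') J y := fun y =>
    hJ.contMDiffAt.mdifferentiableAt (by simp)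
  have h2 : extD (fun y => (α (J y)).comp (tmap E E' J y)) x =
      extD (fun y => (A (J y)).comp (dvec (E := E) (fun z => ψ (J z)) y)) x := by
    apply extD_congr
    filter_upwards [hJ.continuous.continuousAt.eventually hsrc] with y hy
    ext w
    have hd := dvec_comp (E := E) (E' := E') (g := ψ) (J := J) (x := y)
      (mdifferentiableAt_extChartAt hy) (hJd y) w
    simp only [ContinuousLinearMap.comp_apply]
    rw [hd, hloc _ hy]
    rfl
  rw [h2, h1, extD_comp_dvec hA hψs, extD_comp_dvec hAJ hψJ,
    dvec_comp hA.mdiff (hJd x), dvec_comp hA.mdiff (hJd x), dvec_comp hψs.mdiff (hJd x),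
    dvec_comp hψs.mdiff (hJd x)]

/-- Smoothness of a bivector field (as a bundle map) at a point. -/
def SmoothBivAt (biv : ∀ x : M, Cot E x →L[ℝ] Tan E x) (x : M) : Prop :=
  ContMDiffAt 𝓘(ℝ, E) (𝓘(ℝ, E).prod 𝓘(ℝ, (E →L[ℝ] ℝ) →L[ℝ] E)) ∞
    (fun x => TotalSpace.mk' ((E →L[ℝ] ℝ) →L[ℝ] E)
      (E := fun x : M => (TangentSpace 𝓘(ℝ, E) x →L[ℝ] Trivial M ℝ x) →L[ℝ]
        TangentSpace 𝓘(ℝ, E) x) x (biv x)) x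

theorem SmoothBivAt.apply {biv : ∀ x : M, Cot E x →L[ℝ] Tan E x} {α : ∀ x : M, Cot E x} {x : M}
    (hb : SmoothBivAt biv x) (hα : SmoothFormAt α x) : SmoothVFAt (fun y => biv y (α y)) x :=
  ContMDiffAt.clm_bundle_apply (F₁ := E →L[ℝ] ℝ) (F₂ := E) (b := fun y : M => y)
    (E₁ := fun x : M => TangentSpace 𝓘(ℝ, E) x →L[ℝ] Trivial M ℝ x)
    (E₂ := fun x : M => TangentSpace 𝓘(ℝ, E) x) hb hα

/-- It suffices to test on the local sections that have constant coordinates in the trivialization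
at x, since these detect the matrix entries of A. -/
theorem contMDiffAt_hom_of_apply {F₁ F₂ : Type*} {V W : M → Type*}
    [NormedAddCommGroup F₁] [NormedSpace ℝ F₁] [FiniteDimensional ℝ F₁]
    [NormedAddCommGroup F₂] [NormedSpace ℝ F₂]
    [∀ x, AddCommGroup (V x)] [∀ x, Module ℝ (V x)] [∀ x, TopologicalSpace (V x)]
    [∀ x, AddCommGroup (W x)] [∀ x, Module ℝ (W x)] [∀ x, TopologicalSpace (W x)]
    [TopologicalSpace (TotalSpace F₁ V)] [TopologicalSpace (TotalSpace F₂ W)]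
    [FiberBundle F₁ V] [VectorBundle ℝ F₁ V] [FiberBundle F₂ W] [VectorBundle ℝ F₂ W]
    [∀ x, IsTopologicalAddGroup (V x)] [∀ x, ContinuousSMul ℝ (V x)]
    [∀ x, IsTopologicalAddGroup (W x)] [∀ x, ContinuousSMul ℝ (W x)]
    [ContMDiffVectorBundle ∞ F₁ V 𝓘(ℝ, E)]
    {A : ∀ x, V x →L[ℝ] W x} {x : M}
    (h : ∀ v : ∀ x, V x,
      ContMDiffAt 𝓘(ℝ, E) (𝓘(ℝ, E).prod 𝓘(ℝ, F₁)) ∞ (fun y => TotalSpace.mk' F₁ y (v y)) x →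
      ContMDiffAt 𝓘(ℝ, E) (𝓘(ℝ, E).prod 𝓘(ℝ, F₂)) ∞ (fun y => TotalSpace.mk' F₂ y (A y (v y))) x) :
    ContMDiffAt 𝓘(ℝ, E) (𝓘(ℝ, E).prod 𝓘(ℝ, F₁ →L[ℝ] F₂)) ∞
      (fun y => TotalSpace.mk' (F₁ →L[ℝ] F₂) (E := fun x => V x →L[ℝ] W x) y (A y)) x := by
  rw [contMDiffAt_hom_bundle]
  refine ⟨contMDiffAt_id, ?_⟩
  refine smoothAt_clm_of_apply fun ξ => ?_
  have hs : ContMDiffAt 𝓘(ℝ, E) (𝓘(ℝ, E).prod 𝓘(ℝ, F₁)) ∞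
      (fun y => TotalSpace.mk' F₁ y ((trivializationAt F₁ V x).symmL ℝ y ξ)) x := by
    have h1 := (trivializationAt F₁ V x).contMDiffAt_symmL (IB := 𝓘(ℝ, E)) (n := ∞)
      (FiberBundle.mem_baseSet_trivializationAt' x)
    exact ContMDiffAt.clm_bundle_apply (F₁ := F₁) (F₂ := F₁) (b := fun y : M => y)
      (E₁ := Trivial M F₁) (v := fun _ => ξ) h1
      (contMDiffAt_totalSpace.2 ⟨contMDiffAt_id, contMDiffAt_const⟩)
  have h2 := (contMDiffAt_totalSpace.1 (h _ hs)).2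
  refine h2.congr_of_eventuallyEq ?_
  filter_upwards [(trivializationAt F₂ W x).open_baseSet.mem_nhds
    (FiberBundle.mem_baseSet_trivializationAt' x)] with y hy
  exact congrFun (Trivialization.coe_linearMapAt_of_mem (R := ℝ) _ hy) _

theorem smoothBivAt_of_apply [FiniteDimensional ℝ E] {biv : ∀ x : M, Cot E x →L[ℝ] Tan E x} {x : M}
    (h : ∀ α : ∀ x : M, Cot E x, SmoothFormAt α x → SmoothVFAt (fun y => biv y (α y)) x) :
    SmoothBivAt biv x :=
  contMDiffAt_hom_of_apply (F₁ := E →L[ℝ] ℝ) (F₂ := E)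
    (V := fun x : M => TangentSpace 𝓘(ℝ, E) x →L[ℝ] Trivial M ℝ x)
    (W := fun x : M => TangentSpace 𝓘(ℝ, E) x) h

theorem isBivector_smooth_iff {biv : ∀ x : M, Cot E x →L[ℝ] Tan E x} :
    (ContMDiff 𝓘(ℝ, E) (𝓘(ℝ, E).prod 𝓘(ℝ, (E →L[ℝ] ℝ) →L[ℝ] E)) ∞
    (fun x => TotalSpace.mk' ((E →L[ℝ] ℝ) →L[ℝ] E)
      (E := fun x : M => (TangentSpace 𝓘(ℝ, E) x →L[ℝ] Trivial M ℝ x) →L[ℝ]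
        TangentSpace 𝓘(ℝ, E) x) x (biv x))) ↔ ∀ x, SmoothBivAt biv x := Iff.rfl

/-! ### Global functions and vector fields with a prescribed value at a point -/

section Bump

variable [FiniteDimensional ℝ E] [T2Space M]

/-- A linear function of the chart is multiplied by a bump function. The quasi-Poisson axioms are
tested on globally smooth functions, so every covector has to be the differential of one. -/
theorem exists_smooth_dvec_eq (x : M) (α : Cot E x) :
    ∃ f : M → ℝ, ContMDiff 𝓘(ℝ, E) 𝓘(ℝ, ℝ) ∞ f ∧ dvec (E := E) f x = α := by
  obtain ⟨ψ⟩ : Nonempty (SmoothBumpFunction 𝓘(ℝ, E) x) := inferInstance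
  obtain ⟨a, rfl⟩ : ∃ a : E →L[ℝ] ℝ, (a : Cot E x) = α := ⟨α, rfl⟩
  have hg : ContMDiffOn 𝓘(ℝ, E) 𝓘(ℝ, ℝ) ∞ (fun y => a (extChartAt 𝓘(ℝ, E) x y))
      (chartAt E x).source :=
    (ContinuousLinearMap.contMDiff a).comp_contMDiffOn contMDiffOn_extChartAt
  refine ⟨fun y => ψ y • a (extChartAt 𝓘(ℝ, E) x y), ψ.contMDiff_smul hg, ?_⟩
  have h1 : (fun y => ψ y • a (extChartAt 𝓘(ℝ, E) x y)) =ᶠ[𝓝 x]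
      fun y => a (extChartAt 𝓘(ℝ, E) x y) := by
    filter_upwards [ψ.eventuallyEq_one] with y hy
    simp [hy]
  rw [dvec_congr h1]
  ext v
  have h2 := dvec_clm (E := E) a (smoothAt_chart (E := E) x).mdiff v
  exact h2.trans (congrArg a (dvec_extChartAt_self x v))

theorem exists_smooth_vf_eq (x : M) (v : Tan E x) :
    ∃ X : ∀ y : M, Tan E y, (∀ y, SmoothVFAt X y) ∧ X x = v := by
  obtain ⟨ψ, -, hψ⟩ := (SmoothBumpFunction.nhds_basis_tsupport (I := 𝓘(ℝ, E)) x).mem_iff.1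
    ((chartAt E x).open_source.mem_nhds (mem_chart_source E x))
  have hc : ContMDiffOn 𝓘(ℝ, E) (𝓘(ℝ, E).prod 𝓘(ℝ, E)) ∞
    (fun y => TotalSpace.mk' E (E := fun x : M => TangentSpace 𝓘(ℝ, E) x) y (coordVF (E := E) x v y))
    (chartAt E x).source := by
    have := isManifold_one (E := E) (M := M)
    have h1 := (trivializationAt E (TangentSpace 𝓘(ℝ, E) : M → Type _) x).contMDiffOn_symmL
      (IB := 𝓘(ℝ, E)) (n := ∞)
    have hv : ∀ y : M, ContMDiffAt 𝓘(ℝ, E) (𝓘(ℝ, E).prod 𝓘(ℝ, E)) ∞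
        (fun m => TotalSpace.mk' E (E := Trivial M E) m v) y := fun y =>
      contMDiffAt_totalSpace.2 ⟨contMDiffAt_id, contMDiffAt_const⟩
    have h2 := ContMDiffOn.clm_bundle_apply (F₁ := E) (F₂ := E) (b := fun y : M => y)
      (E₁ := Trivial M E) (v := fun _ => v) h1
      (fun y _ => (hv y).contMDiffWithinAt)
    refine ContMDiffOn.congr (h2.mono (by simp)) fun y hy => ?_
    have h := TangentBundle.symmL_trivializationAt (I := 𝓘(ℝ, E)) hy
    simp only [modelWithCornersSelf_coe, range_id, mfderivWithin_univ] at h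
    rw [h]
    rfl
  have := ContMDiffOn.smul_section_of_tsupport ψ.contMDiff.contMDiffOn (chartAt E x).open_source
    hψ hc
  refine ⟨fun y => ψ y • coordVF (E := E) x v y, this, ?_⟩
  simp only [ψ.eq_one, one_smul]
  exact coordVF_self (E := E) x v

end Bump

end Sections

/-! ### Lie brackets of vector fields related by a smooth map -/

section Related

variable {E : Type*} [NormedAddCommGroup E] [NormedSpace ℝ E] [FiniteDimensional ℝ E]
  {M : Type*} [TopologicalSpace M] [ChartedSpace E M] [IsManifold 𝓘(ℝ, E) ∞ M]
  {E' : Type*} [NormedAddCommGroup E'] [NormedSpace ℝ E'] [FiniteDimensional ℝ E']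
  {M' : Type*} [TopologicalSpace M'] [ChartedSpace E' M'] [IsManifold 𝓘(ℝ, E') ∞ M']
  {V : Type*} [NormedAddCommGroup V] [NormedSpace ℝ V] [FiniteDimensional ℝ V]

theorem mdiff_of_contMDiff {J : M → M'} (hJ : ContMDiff 𝓘(ℝ, E) 𝓘(ℝ, E') ∞ J) (x : M) :
    MDifferentiableAt 𝓘(ℝ, E) 𝓘(ℝ, E') J x := hJ.contMDiffAt.mdifferentiableAt (by simp)

/-- Brackets of vector fields that are related by a smooth map to the values of a family of vector
fields `ρ`, with varying coefficients. -/
theorem tmap_mlieBracket_coeff {J : M → M'} (hJ : ContMDiff 𝓘(ℝ, E) 𝓘(ℝ, E') ∞ J)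
    {ρ : ∀ y : M', V →L[ℝ] Tan E' y} (hρ : ∀ v y, SmoothVFAt (fun y => ρ y v) y)
    {X₁ X₂ : ∀ x : M, Tan E x} {U₁ U₂ : M → V} {x : M}
    (hX₁ : SmoothVFAt X₁ x) (hX₂ : SmoothVFAt X₂ x)
    (hU₁ : SmoothAt E U₁ x) (hU₂ : SmoothAt E U₂ x)
    (h₁ : ∀ x, tmap E E' J x (X₁ x) = ρ (J x) (U₁ x))
    (h₂ : ∀ x, tmap E E' J x (X₂ x) = ρ (J x) (U₂ x)) :
    tmap E E' J x (mlieBracket 𝓘(ℝ, E) X₁ X₂ x) =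
      mlieBracket 𝓘(ℝ, E') (fun y => ρ y (U₁ x)) (fun y => ρ y (U₂ x)) (J x)
        + ρ (J x) (dvec (E := E) U₂ x (X₁ x) - dvec (E := E) U₁ x (X₂ x)) := by
  have : CompleteSpace E := FiniteDimensional.complete ℝ E
  have : CompleteSpace E' := FiniteDimensional.complete ℝ E'
  have := isManifold_one (E := E') (M := M')
  set ψ := extChartAt 𝓘(ℝ, E') (J x) with hψ
  have hψs : SmoothAt E' ψ (J x) := smoothAt_chart (J x)
  have hψd := smoothFormAt_dvec hψs
  have hψJ : SmoothAt E (fun y => ψ (J y)) x := ContMDiffAt.comp x hψs hJ.contMDiffAt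
  have hJd := mdiff_of_contMDiff hJ
  -- The bracket formula is applied to the vector valued function ψ ∘ J. Writing dψ ∘ ρ as an
  -- operator valued function A turns the dependence on the coefficients into a product rule, and dψ
  -- is injective at J x.
  let A : M' → V →L[ℝ] E' := fun y => (dvec (E := E') ψ y).comp (ρ y)
  have hA : SmoothAt E' A (J x) := smoothAt_clm_of_apply fun v => hψd.apply (hρ v (J x))
  have hAJ : SmoothAt E (fun y => A (J y)) x := ContMDiffAt.comp x hA hJ.contMDiffAt
  have hev : ∀ᶠ y in 𝓝 x, ∀ v : Tan E y, dvec (E := E) (fun z => ψ (J z)) y v =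
      dvec (E := E') ψ (J y) (tmap E E' J y v) := by
    filter_upwards [hJ.continuous.continuousAt.eventually hψs.eventually_mdiff] with y hy v
    exact dvec_comp hy (hJd y) v
  have e1 : (fun y => dvec (E := E) (fun z => ψ (J z)) y (X₁ y)) =ᶠ[𝓝 x]
      fun y => A (J y) (U₁ y) := by
    filter_upwards [hev] with y hy
    rw [hy, h₁]; rfl
  have e2 : (fun y => dvec (E := E) (fun z => ψ (J z)) y (X₂ y)) =ᶠ[𝓝 x]
      fun y => A (J y) (U₂ y) := by
    filter_upwards [hev] with y hy
    rw [hy, h₂]; rfl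
  have b := dvec_mlieBracket hψJ hX₁ hX₂
  have d1 := dvec_bilin (E := E) (ContinuousLinearMap.id ℝ (V →L[ℝ] E')) hAJ.mdiff hU₁.mdiff (X₂ x)
  have d2 := dvec_bilin (E := E) (ContinuousLinearMap.id ℝ (V →L[ℝ] E')) hAJ.mdiff hU₂.mdiff (X₁ x)
  have c1 := dvec_comp (E := E) hA.mdiff (hJd x) (X₁ x)
  have c2 := dvec_comp (E := E) hA.mdiff (hJd x) (X₂ x)
  have b' := dvec_mlieBracket hψs (hρ (U₁ x) (J x)) (hρ (U₂ x) (J x))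
  have a1 : ∀ v w, dvec (E := E') (fun y => A y v) (J x) w = dvec (E := E') A (J x) w v := by
    intro v w
    have := dvec_clm (E := E') (ContinuousLinearMap.apply ℝ E' v) hA.mdiff w
    exact this
  rw [dvec_congr e1, dvec_congr e2, hev.self_of_nhds] at b
  simp only [ContinuousLinearMap.id_apply] at d1 d2
  rw [d1, d2, c1, c2, h₁, h₂] at b
  have b2 := b'.trans (congrArg₂ (· - ·) (a1 (U₂ x) (ρ (J x) (U₁ x))) (a1 (U₁ x) (ρ (J x) (U₂ x))))
  have inj : ∀ v w : Tan E' (J x), dvec (E := E') ψ (J x) v = dvec (E := E') ψ (J x) w → v = w := by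
    intro v w h
    exact (dvec_extChartAt_self (J x) v).symm.trans (h.trans (dvec_extChartAt_self (J x) w))
  apply inj
  have hAx : ∀ v, dvec (E := E') ψ (J x) (ρ (J x) v) = A (J x) v := fun v => rfl
  rw [b, map_add, b2, hAx, map_sub]
  abel

theorem tmap_mlieBracket {J : M → M'} (hJ : ContMDiff 𝓘(ℝ, E) 𝓘(ℝ, E') ∞ J)
    {X₁ X₂ : ∀ x : M, Tan E x} {Y₁ Y₂ : ∀ y : M', Tan E' y} {x : M}
    (hX₁ : SmoothVFAt X₁ x) (hX₂ : SmoothVFAt X₂ x)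
    (hY₁ : ∀ y, SmoothVFAt Y₁ y) (hY₂ : ∀ y, SmoothVFAt Y₂ y)
    (h₁ : ∀ x, tmap E E' J x (X₁ x) = Y₁ (J x))
    (h₂ : ∀ x, tmap E E' J x (X₂ x) = Y₂ (J x)) :
    tmap E E' J x (mlieBracket 𝓘(ℝ, E) X₁ X₂ x) = mlieBracket 𝓘(ℝ, E') Y₁ Y₂ (J x) := by
  -- The plain statement is the case of constant coefficients (1, 0) and (0, 1) in the family
  -- spanned by Y₁ and Y₂.
  let ρ : ∀ y : M', (ℝ × ℝ) →L[ℝ] Tan E' y := fun y =>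
    (ContinuousLinearMap.fst ℝ ℝ ℝ).smulRight (Y₁ y) + (ContinuousLinearMap.snd ℝ ℝ ℝ).smulRight (Y₂ y)
  have hρ : ∀ v y, SmoothVFAt (fun y => ρ y v) y := fun v y =>
    (SmoothVFAt.smul (contMDiffAt_const (c := v.1)) (hY₁ y)).add
      (SmoothVFAt.smul (contMDiffAt_const (c := v.2)) (hY₂ y))
  have r1 : (fun y => ρ y ((1 : ℝ), (0 : ℝ))) = Y₁ := by funext y; simp [ρ]
  have r2 : (fun y => ρ y ((0 : ℝ), (1 : ℝ))) = Y₂ := by funext y; simp [ρ]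
  have h := tmap_mlieBracket_coeff hJ hρ (x := x) hX₁ hX₂
    (U₁ := fun _ => ((1 : ℝ), (0 : ℝ))) (U₂ := fun _ => ((0 : ℝ), (1 : ℝ)))
    contMDiffAt_const contMDiffAt_const (fun x => (h₁ x).trans (congrFun r1 (J x)).symm)
    (fun x => (h₂ x).trans (congrFun r2 (J x)).symm)
  rw [r1, r2, dvec_const, dvec_const] at h
  rw [h]
  simp

end Related

/-! ### Right-invariant fields and local sections of submersions -/

section Group

variable {ED : Type*} [NormedAddCommGroup ED] [NormedSpace ℝ ED]
  {D : Type*} [TopologicalSpace D] [ChartedSpace ED D] [Group D] [LieGroup 𝓘(ℝ, ED) ∞ D]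

theorem smoothVFAt_rightField (v : Tan ED (1 : D)) (a : D) : SmoothVFAt (rightField v) a := by
  have hm : ContMDiffAt (𝓘(ℝ, ED).prod 𝓘(ℝ, ED)) 𝓘(ℝ, ED) ∞
      (Function.uncurry fun (a b : D) => b * a) (a, 1) :=
    (contMDiff_snd.mul contMDiff_fst).contMDiffAt
  have h := ContMDiffAt.mfderiv (fun (a b : D) => b * a) (fun _ : D => (1 : D)) hm
    contMDiffAt_const (m := ∞) (by simp)
  have hv : ContMDiffAt 𝓘(ℝ, ED) (𝓘(ℝ, ED).prod 𝓘(ℝ, ED)) ∞ (fun _ : D =>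
      TotalSpace.mk' ED (E := (TangentSpace 𝓘(ℝ, ED) : D → Type _)) (1 : D) v) a := contMDiffAt_const
  have hl : ContMDiffAt 𝓘(ℝ, ED) 𝓘(ℝ, ED) ∞ (fun a : D => 1 * a) a :=
    contMDiff_mul_left.contMDiffAt
  have h2 := ContMDiffAt.clm_apply_of_inCoordinates (F₁ := ED) (F₂ := ED)
    (E₁ := (TangentSpace 𝓘(ℝ, ED) : D → Type _)) (E₂ := (TangentSpace 𝓘(ℝ, ED) : D → Type _))
    (b₁ := fun _ : D => (1 : D)) (b₂ := fun a : D => 1 * a) (v := fun _ => v) h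
    hv hl
  -- The derivative of b ↦ b * a at 1 lands over 1 * a, which is only propositionally equal to a.
  have e : ∀ (a b : D) (w : ED), a = b →
      TotalSpace.mk' ED (E := (TangentSpace 𝓘(ℝ, ED) : D → Type _)) a w = TotalSpace.mk' ED b w := by
    rintro a _ w rfl; rfl
  refine ContMDiffAt.congr_of_eventuallyEq h2 (Filter.Eventually.of_forall fun y => ?_)
  exact e y (1 * y) _ (one_mul y).symm

/-- In adapted charts p is the projection onto the first factor; the section freezes the
complementary coordinate at its value for b. -/
theorem exists_local_section {ES : Type*} [NormedAddCommGroup ES] [NormedSpace ℝ ES]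
    {N M : Type*} [TopologicalSpace N] [ChartedSpace ES N] [IsManifold 𝓘(ℝ, ES) ∞ N]
    [TopologicalSpace M] [ChartedSpace ED M] [IsManifold 𝓘(ℝ, ED) ∞ M] {p : M → N} {b : M}
    (h : Manifold.IsSubmersionAt 𝓘(ℝ, ED) 𝓘(ℝ, ES) ∞ p b) :
    ∃ τ : N → M, ContMDiffAt 𝓘(ℝ, ES) 𝓘(ℝ, ED) ∞ τ (p b) ∧ τ (p b) = b ∧
      ∀ᶠ y in 𝓝 (p b), p (τ y) = y := by
  let d := h.domChart
  let c := h.codChart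
  let τ : N → M := fun y => d.symm (h.equiv.symm (c y, (h.equiv (d b)).2))
  have hb : b ∈ d.source := h.mem_domChart_source
  have hpb : p b ∈ c.source := h.mem_codChart_source
  have hw : ∀ z ∈ d.target, c (p (d.symm z)) = (h.equiv z).1 := by
    intro z hz
    have hz' : z ∈ (h.domChart.extend 𝓘(ℝ, ED)).target := by
      simpa [OpenPartialHomeomorph.extend_target] using hz
    simpa using! h.writtenInCharts hz'
  have h0 : h.equiv.symm (c (p b), (h.equiv (d b)).2) = d b := by
    have h1 := hw (d b) (d.map_source hb)
    rw [d.left_inv hb] at h1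
    rw [h1]
    exact h.equiv.symm_apply_apply _
  have hc : ContMDiffAt 𝓘(ℝ, ES) 𝓘(ℝ, ES) ∞ c (p b) :=
    contMDiffAt_of_mem_maximalAtlas h.codChart_mem_maximalAtlas hpb
  have hin : ContMDiffAt 𝓘(ℝ, ES) 𝓘(ℝ, ED) ∞
      (fun y => h.equiv.symm (c y, (h.equiv (d b)).2)) (p b) := by
    have h1 : ContMDiffAt 𝓘(ℝ, ES) 𝓘(ℝ, ES × h.complement) ∞
        (fun y => (c y, (h.equiv (d b)).2)) (p b) := hc.prodMk_space contMDiffAt_const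
    exact (h.equiv.symm : (ES × h.complement) →L[ℝ] ED).contMDiff.contMDiffAt.comp (p b) h1
  have hd : ContMDiffAt 𝓘(ℝ, ED) 𝓘(ℝ, ED) ∞ d.symm (h.equiv.symm (c (p b), (h.equiv (d b)).2)) := by
    rw [h0]
    exact contMDiffAt_symm_of_mem_maximalAtlas h.domChart_mem_maximalAtlas (d.map_source hb)
  refine ⟨τ, hd.comp (p b) hin, ?_, ?_⟩
  · change d.symm _ = b
    rw [h0, d.left_inv hb]
  · have ht : ∀ᶠ y in 𝓝 (p b), h.equiv.symm (c y, (h.equiv (d b)).2) ∈ d.target := by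
      apply hin.continuousAt
      change d.target ∈ 𝓝 (h.equiv.symm (c (p b), (h.equiv (d b)).2))
      rw [h0]
      exact d.open_target.mem_nhds (d.map_source hb)
    filter_upwards [ht, c.open_source.mem_nhds hpb] with y hy hyc
    have h1 := hw _ hy
    rw [h.equiv.apply_symm_apply] at h1
    exact c.injOn (h.source_subset_preimage_source (d.map_target hy)) hyc h1

end Group

/-! ### The dressing action of 𝔡 on S -/

section Dressing

variable {𝔡 : Type*} [NormedAddCommGroup 𝔡] [NormedSpace ℝ 𝔡] [FiniteDimensional ℝ 𝔡]
  {P : ManinPair 𝔡}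
  {ED : Type*} [NormedAddCommGroup ED] [NormedSpace ℝ ED] [FiniteDimensional ℝ ED]
  {ES : Type*} [NormedAddCommGroup ES] [NormedSpace ℝ ES] [FiniteDimensional ℝ ES]
  {D : Type*} [TopologicalSpace D] [ChartedSpace ED D] [Group D] [LieGroup 𝓘(ℝ, ED) ∞ D]
  {G : Subgroup D} [ChartedSpace ES (D ⧸ G)] [IsManifold 𝓘(ℝ, ES) ∞ (D ⧸ G)]
  (Q : GroupPair P ED ES G)

/-- The orbit map a ↦ a • bG is the quotient map after right translation by b, so each dressing
field is related by the quotient map to a right-invariant field. -/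
theorem rhoS_mk (b : D) (u : 𝔡) :
    Q.rhoS (b : D ⧸ G) u
      = tmap ED ES (fun a : D => (a : D ⧸ G)) b (rightField (Q.ident u) b) := by
  have h1 : MDifferentiableAt 𝓘(ℝ, ED) 𝓘(ℝ, ES) (fun a : D => (a : D ⧸ G)) b :=
    mdiff_of_contMDiff Q.isSubmersion.contMDiff b
  have h2 : MDifferentiableAt 𝓘(ℝ, ED) 𝓘(ℝ, ED) (fun a : D => a * b) 1 :=
    (contMDiff_mul_right (n := ∞)).contMDiffAt.mdifferentiableAt (by simp)
  have h := mfderiv_comp_of_eq h1 h2 (one_mul b)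
  have e : (mfderiv 𝓘(ℝ, ED) 𝓘(ℝ, ES) (fun a : D => (a : D ⧸ G)) (1 * b) : ED →L[ℝ] ES) =
      mfderiv 𝓘(ℝ, ED) 𝓘(ℝ, ES) (fun a : D => (a : D ⧸ G)) b := by rw [one_mul]
  exact (congrArg (fun A : ED →L[ℝ] ES => A (Q.ident u)) h).trans
    (congrArg (fun A : ED →L[ℝ] ES => A (rightField (Q.ident u) b : ED)) e)

/-- Relatedness alone gives smoothness after composition with the quotient map; a local section of
the submersion brings it down to S. -/
theorem smoothVFAt_rhoS (u : 𝔡) (y : D ⧸ G) : SmoothVFAt (fun y => Q.rhoS y u) y := by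
  have := isManifold_one (E := ES) (M := D ⧸ G)
  obtain ⟨b, rfl⟩ := QuotientGroup.mk_surjective y
  obtain ⟨τ, hτ, hb, hpτ⟩ := exists_local_section (Q.isSubmersion.isSubmersionAt b)
  have hp : ContMDiff 𝓘(ℝ, ED) 𝓘(ℝ, ES) ∞ (fun a : D => (a : D ⧸ G)) := Q.isSubmersion.contMDiff
  rw [smoothVFAt_iff]
  set ψ := extChartAt 𝓘(ℝ, ES) (b : D ⧸ G)
  have hψ : SmoothAt ES ψ (b : D ⧸ G) := smoothAt_chart _
  have hG : SmoothAt ED (fun a : D => dvec (E := ED) (fun a : D => ψ (a : D ⧸ G)) a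
      (rightField (Q.ident u) a)) (τ (b : D ⧸ G)) := by
    rw [hb]
    exact (smoothFormAt_dvec (ContMDiffAt.comp b hψ hp.contMDiffAt)).apply
      (smoothVFAt_rightField _ b)
  refine (ContMDiffAt.comp (b : D ⧸ G) hG hτ).congr_of_eventuallyEq ?_
  have hcont : Filter.Tendsto (fun y => ((τ y : D) : D ⧸ G)) (𝓝 (b : D ⧸ G)) (𝓝 (b : D ⧸ G)) := by
    have := hp.continuous.continuousAt.comp hτ.continuousAt
    have h2 := this.tendsto
    simp only [Function.comp_apply, hb] at h2
    exact h2
  filter_upwards [hpτ, hcont.eventually hψ.eventually_mdiff] with y hy hyd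
  have h1 := dvec_comp (E := ED) (g := ψ) (J := fun a : D => (a : D ⧸ G)) (x := τ y) hyd
    (mdiff_of_contMDiff hp (τ y)) (rightField (Q.ident u) (τ y))
  rw [← rhoS_mk Q (τ y) u] at h1
  simp only [Function.comp_apply]
  rw [h1, hy]

theorem mlieBracket_rhoS (u v : 𝔡) (y : D ⧸ G) :
    mlieBracket 𝓘(ℝ, ES) (fun y => Q.rhoS y u) (fun y => Q.rhoS y v) y
      = Q.rhoS y (P.bracket u v) := by
  obtain ⟨b, rfl⟩ := QuotientGroup.mk_surjective y
  have h := tmap_mlieBracket (J := fun a : D => (a : D ⧸ G)) (x := b) Q.isSubmersion.contMDiff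
    (smoothVFAt_rightField (Q.ident u) b) (smoothVFAt_rightField (Q.ident v) b)
    (smoothVFAt_rhoS Q u) (smoothVFAt_rhoS Q v)
    (fun a => (rhoS_mk Q a u).symm) (fun a => (rhoS_mk Q a v).symm)
  rw [Q.ident_bracket] at h
  exact h.symm.trans (rhoS_mk Q b _).symm

end Dressing

/-! ### Isotropy of ker ρ_S at every point of S -/

section Isotropy

variable {𝔡 : Type*} [NormedAddCommGroup 𝔡] [NormedSpace ℝ 𝔡] [FiniteDimensional ℝ 𝔡]
  {P : ManinPair 𝔡}
  {ED : Type*} [NormedAddCommGroup ED] [NormedSpace ℝ ED] [FiniteDimensional ℝ ED]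
  {ES : Type*} [NormedAddCommGroup ES] [NormedSpace ℝ ES] [FiniteDimensional ℝ ES]
  {D : Type*} [TopologicalSpace D] [ChartedSpace ED D] [Group D] [LieGroup 𝓘(ℝ, ED) ∞ D]
  {G : Subgroup D} [ChartedSpace ES (D ⧸ G)] [IsManifold 𝓘(ℝ, ES) ∞ (D ⧸ G)]
  {Q : GroupPair P ED ES G} (s : ConnectionSplitting Q)

/-- The projection `s ∘ ρ_S` of `𝔡` onto the image of `s`. -/
def projS (y : D ⧸ G) : 𝔡 →L[ℝ] 𝔡 := (s.toFun y).comp (Q.rhoS y)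

theorem projS_apply (y : D ⧸ G) (v : 𝔡) : projS s y v = s.toFun y (Q.rhoS y v) := rfl

theorem rhoS_projS (y : D ⧸ G) (v : 𝔡) : Q.rhoS y (projS s y v) = Q.rhoS y v :=
  s.splits y _

theorem smoothFormAt_s (y : D ⧸ G) : SmoothFormAt s.toFun y :=
  smoothFormOn_univ.1 s.smooth y

theorem smoothAt_projS (y : D ⧸ G) : SmoothAt ES (projS s) y :=
  smoothAt_clm_of_apply fun v => (smoothFormAt_s s y).apply (smoothVFAt_rhoS Q v y)

theorem dvec_clm_apply {E M F F₁ : Type*} [NormedAddCommGroup E] [NormedSpace ℝ E]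
    [TopologicalSpace M] [ChartedSpace E M] [NormedAddCommGroup F] [NormedSpace ℝ F]
    [NormedAddCommGroup F₁] [NormedSpace ℝ F₁] {A : M → F →L[ℝ] F₁} {x : M}
    (hA : MDifferentiableAt 𝓘(ℝ, E) 𝓘(ℝ, F →L[ℝ] F₁) A x) (v : F) (w : Tan E x) :
    dvec (E := E) (fun y => A y v) x w = dvec (E := E) A x w v :=
  dvec_clm (E := E) (ContinuousLinearMap.apply ℝ F₁ v) hA w

/-- The field z ↦ ρ_S(v - q_z v) is identically 0, so its bracket with ρ_S(u) vanishes. Expanding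
that bracket with variable coefficients gives the claim: to first order, ad u carries the kernels of
ρ_S into one another. -/
theorem rhoS_dvec_projS (y : D ⧸ G) (u v : 𝔡) :
    Q.rhoS y (P.bracket u (v - projS s y v)
      - dvec (E := ES) (projS s) y (Q.rhoS y u) v) = 0 := by
  have hU : SmoothAt ES (fun y => v - projS s y v) y :=
    contMDiffAt_const.sub ((smoothAt_projS s y).clm_apply contMDiffAt_const)
  have ht : ∀ (z : D ⧸ G) (w : Tan ES z), tmap ES ES (id : D ⧸ G → D ⧸ G) z w = w := fun z w =>
    congrArg (fun A : ES →L[ℝ] ES => A w) (mfderiv_id (I := 𝓘(ℝ, ES)) (x := z))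
  have h := tmap_mlieBracket_coeff (J := (id : D ⧸ G → D ⧸ G)) (x := y) contMDiff_id
    (ρ := Q.rhoS) (smoothVFAt_rhoS Q) (X₁ := fun z => Q.rhoS z u) (X₂ := fun z => (0 : Tan ES z))
    (U₁ := fun _ => u) (U₂ := fun z => v - projS s z v)
    (smoothVFAt_rhoS Q u y) (smoothVFAt_zero y) contMDiffAt_const hU
    (fun z => ht z _) (fun z => by rw [ht]; simp only [id, map_sub, rhoS_projS, sub_self])
  have hz : mlieBracket 𝓘(ℝ, ES) (fun z => Q.rhoS z u) (fun z => (0 : Tan ES z)) = 0 :=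
    mlieBracket_zero_right
  have hq : SmoothAt ES (fun z => projS s z v) y :=
    (smoothAt_projS s y).clm_apply contMDiffAt_const
  have hd : dvec (E := ES) (fun z => v - projS s z v) y (Q.rhoS y u)
      = - dvec (E := ES) (projS s) y (Q.rhoS y u) v := by
    rw [dvec_sub (mdifferentiableAt_const (c := v)) hq.mdiff, dvec_const]
    simp only [zero_sub, neg_apply]
    rw [dvec_clm_apply (smoothAt_projS s y).mdiff]
  rw [hz, ht, dvec_const, zero_apply, sub_zero] at h
  rw [sub_eq_add_neg, ← hd, map_add, ← mlieBracket_rhoS]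
  exact h.symm

/-- A function on a connected manifold whose differential is bounded by its norm, and which
vanishes at one point, vanishes identically. -/
theorem eq_zero_of_norm_dvec_le {E N W : Type*} [NormedAddCommGroup E] [NormedSpace ℝ E]
    [TopologicalSpace N] [ChartedSpace E N] [IsManifold 𝓘(ℝ, E) ∞ N] [ConnectedSpace N]
    [NormedAddCommGroup W] [NormedSpace ℝ W] {β : N → W} (hβ : ∀ y, SmoothAt E β y)
    {R : Type*} [NormedAddCommGroup R] [NormedSpace ℝ R]
    {A : ∀ y : N, Tan E y →L[ℝ] R} (hA : ∀ y, SmoothFormAt A y) {c : ℝ} (hc : 0 ≤ c)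
    (h : ∀ (y : N) (w : Tan E y), ‖dvec (E := E) β y w‖ ≤ c * ‖A y w‖ * ‖β y‖)
    {y₀ : N} (h₀ : β y₀ = 0) (y : N) : β y = 0 := by
  have hcont : Continuous β := continuous_iff_continuousAt.2 fun y => (hβ y).continuousAt
  have hclosed : IsClosed {y | β y = 0} := isClosed_eq hcont continuous_const
  -- Near a zero, in a chart, the restriction of β to each radial segment has derivative bounded by
  -- a constant times its norm and starts at 0, so Grönwall's inequality makes it 0. The zero set is
  -- then clopen.
  have hopen : IsOpen {y | β y = 0} := by
    rw [isOpen_iff_mem_nhds]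
    intro x hx
    set ψ := extChartAt 𝓘(ℝ, E) x with hψ
    have hb : ∃ C : ℝ, ∀ᶠ z in 𝓝 (ψ x), ‖chartForm A x z‖ ≤ C := by
      have hc := (chartForm_differentiableAt (hA x)).continuousAt
      refine ⟨‖chartForm A x (ψ x)‖ + 1, ?_⟩
      filter_upwards [hc.norm.eventually_lt_const (lt_add_one _)] with z hz using hz.le
    obtain ⟨C, hC⟩ := hb
    obtain ⟨r, hr, hball⟩ := Metric.mem_nhds_iff.1
      (Filter.inter_mem hC (extChartAt_target_nhds (E := E) x))
    have hder : ∀ z ∈ Metric.ball (ψ x) r, DifferentiableAt ℝ (β ∘ ψ.symm) z ∧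
        ∀ w, ‖fderiv ℝ (β ∘ ψ.symm) z w‖ ≤ c * ‖chartForm A x z w‖ * ‖β (ψ.symm z)‖ := by
      intro z hz
      have hzt : z ∈ ψ.target := (hball hz).2
      have h1 : MDifferentiableAt 𝓘(ℝ, E) 𝓘(ℝ, E) ψ.symm z :=
        ((contMDiffOn_extChartAt_symm (n := ∞) x).contMDiffAt
          ((isOpen_extChartAt_target x).mem_nhds hzt)).mdifferentiableAt (by simp)
      have h2 := (hβ (ψ.symm z)).mdiff
      refine ⟨(h2.comp z h1).differentiableAt, fun w => ?_⟩
      rw [← mfderiv_eq_fderiv]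
      have h5 := dvec_comp (E := E) h2 h1 w
      have h6 := h _ (tmap E E ψ.symm z w)
      rw [← h5] at h6
      exact h6
    have hzero : ∀ z ∈ Metric.ball (ψ x) r, β (ψ.symm z) = 0 := by
      intro z hz
      have hseg : ∀ t ∈ Icc (0 : ℝ) 1, ψ x + t • (z - ψ x) ∈ Metric.ball (ψ x) r := by
        intro t ht
        rw [Metric.mem_ball, dist_eq_norm, add_sub_cancel_left, norm_smul, Real.norm_eq_abs,
          abs_of_nonneg ht.1]
        rw [Metric.mem_ball, dist_eq_norm] at hz
        exact (mul_le_of_le_one_left (norm_nonneg _) ht.2).trans_lt hz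
      have hd : ∀ t ∈ Icc (0 : ℝ) 1, HasDerivAt (fun t : ℝ => β (ψ.symm (ψ x + t • (z - ψ x))))
          (fderiv ℝ (β ∘ ψ.symm) (ψ x + t • (z - ψ x)) (z - ψ x)) t := by
        intro t ht
        have hl : HasDerivAt (fun t : ℝ => ψ x + t • (z - ψ x)) (z - ψ x) t := by
          simpa using ((hasDerivAt_id t).smul_const (z - ψ x)).const_add (ψ x)
        exact (hder _ (hseg t ht)).1.hasFDerivAt.comp_hasDerivAt t hl
      have hg := eq_zero_of_abs_deriv_le_mul_abs_self_of_eq_zero_right (K := c * (C * ‖z - ψ x‖))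
        (fun t ht => (hd t ht).continuousAt.continuousWithinAt)
        (fun t ht => (hd t (Ico_subset_Icc_self ht)).hasDerivWithinAt)
        (by simpa [hψ] using hx)
        (fun t ht => by
          refine ((hder _ (hseg t (Ico_subset_Icc_self ht))).2 _).trans ?_
          gcongr
          refine (ContinuousLinearMap.le_opNorm _ _).trans ?_
          gcongr
          exact (hball (hseg t (Ico_subset_Icc_self ht))).1) 1 (right_mem_Icc.2 zero_le_one)
      simpa using hg
    filter_upwards [(continuousAt_extChartAt (I := 𝓘(ℝ, E)) x).preimage_mem_nhds
      (Metric.ball_mem_nhds _ hr), extChartAt_source_mem_nhds (I := 𝓘(ℝ, E)) x] with y hy hys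
    have := hzero _ hy
    rwa [ψ.left_inv hys] at this
  have : {y | β y = 0} = univ := IsClopen.eq_univ ⟨hclosed, hopen⟩ ⟨y₀, h₀⟩
  exact this.ge (mem_univ y)

/-- The form `⟨p u, p v⟩`, where `p = 1 - s ∘ ρ_S`. -/
def kerForm (y : D ⧸ G) : 𝔡 →L[ℝ] 𝔡 →L[ℝ] ℝ :=
  P.form.bilinearComp (ContinuousLinearMap.id ℝ 𝔡 - projS s y) (ContinuousLinearMap.id ℝ 𝔡 - projS s y)

theorem kerForm_apply (y : D ⧸ G) (u v : 𝔡) :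
    kerForm s y u v = P.form (u - projS s y u) (v - projS s y v) := rfl

theorem smoothAt_sub_projS (y : D ⧸ G) (u : 𝔡) : SmoothAt ES (fun y => u - projS s y u) y :=
  contMDiffAt_const.sub ((smoothAt_projS s y).clm_apply contMDiffAt_const)

theorem dvec_sub_projS (y : D ⧸ G) (u : 𝔡) (w : Tan ES y) :
    dvec (E := ES) (fun y => u - projS s y u) y w = - dvec (E := ES) (projS s) y w u := by
  have hq : SmoothAt ES (fun z => projS s z u) y :=
    (smoothAt_projS s y).clm_apply contMDiffAt_const
  rw [dvec_sub (mdifferentiableAt_const (c := u)) hq.mdiff, dvec_const]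
  simp only [zero_sub, neg_apply]
  rw [dvec_clm_apply (smoothAt_projS s y).mdiff]

theorem smoothAt_bilin {E M F F₁ F₂ : Type*} [NormedAddCommGroup E] [NormedSpace ℝ E]
    [TopologicalSpace M] [ChartedSpace E M] [NormedAddCommGroup F] [NormedSpace ℝ F]
    [NormedAddCommGroup F₁] [NormedSpace ℝ F₁] [NormedAddCommGroup F₂] [NormedSpace ℝ F₂]
    (B : F →L[ℝ] F₁ →L[ℝ] F₂) {f : M → F} {g : M → F₁} {x : M}
    (hf : SmoothAt E f x) (hg : SmoothAt E g x) : SmoothAt E (fun y => B (f y) (g y)) x :=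
  (B.contMDiff.contMDiffAt.comp x hf).clm_apply hg

theorem smoothAt_kerForm (y : D ⧸ G) : SmoothAt ES (kerForm s) y :=
  smoothAt_clm_of_apply fun u => smoothAt_clm_of_apply fun v =>
    smoothAt_bilin P.form (smoothAt_sub_projS s y u) (smoothAt_sub_projS s y v)

/-- The connection form governing the variation of `ker ρ_S`. -/
def kerConn (y : D ⧸ G) : Tan ES y →L[ℝ] 𝔡 →L[ℝ] 𝔡 :=
  ((ContinuousLinearMap.compL ℝ 𝔡 𝔡 𝔡).flip (ContinuousLinearMap.id ℝ 𝔡 - projS s y)).comp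
    (P.bracket.comp (s.toFun y)) - dvec (E := ES) (projS s) y

theorem kerConn_apply (y : D ⧸ G) (w : Tan ES y) (u : 𝔡) :
    kerConn s y w u = P.bracket (s.toFun y w) (u - projS s y u)
      - dvec (E := ES) (projS s) y w u := rfl

theorem smoothFormAt_kerConn (y : D ⧸ G) : SmoothFormAt (kerConn s) y :=
  smoothFormAt_of_apply fun _ hX => smoothAt_clm_of_apply fun u =>
    (smoothAt_bilin P.bracket ((smoothFormAt_s s y).apply hX) (smoothAt_sub_projS s y u)).sub
      (((smoothFormAt_dvec (smoothAt_projS s y)).apply hX).clm_apply contMDiffAt_const)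

theorem rhoS_kerConn (y : D ⧸ G) (w : Tan ES y) (u : 𝔡) : Q.rhoS y (kerConn s y w u) = 0 := by
  have h := rhoS_dvec_projS s y (s.toFun y w) u
  rwa [s.splits] at h

theorem projS_kerConn (y : D ⧸ G) (w : Tan ES y) (u : 𝔡) : projS s y (kerConn s y w u) = 0 := by
  rw [projS_apply, rhoS_kerConn, map_zero]

/-- The product rule gives only the terms with -dq. Adding ad(s(w)) in both slots changes nothing,
by invariance of the form, and the resulting vectors lie in ker ρ_S, where 1 - q is the identity.
The derivative is therefore expressed by `kerForm` itself, a homogeneous linear equation. -/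
theorem dvec_kerForm (y : D ⧸ G) (w : Tan ES y) (u v : 𝔡) :
    dvec (E := ES) (kerForm s) y w u v
      = kerForm s y (kerConn s y w u) v + kerForm s y u (kerConn s y w v) := by
  have h1 : dvec (E := ES) (fun z => kerForm s z u v) y w = dvec (E := ES) (kerForm s) y w u v := by
    have hu : SmoothAt ES (fun z => kerForm s z u) y :=
      (smoothAt_kerForm s y).clm_apply contMDiffAt_const
    rw [dvec_clm_apply hu.mdiff, dvec_clm_apply (smoothAt_kerForm s y).mdiff]
  rw [← h1]
  simp only [kerForm_apply, projS_kerConn, sub_zero]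
  rw [dvec_bilin P.form (smoothAt_sub_projS s y u).mdiff (smoothAt_sub_projS s y v).mdiff,
    dvec_sub_projS, dvec_sub_projS, kerConn_apply, kerConn_apply]
  have := P.form_invariant (s.toFun y w) (u - projS s y u) (v - projS s y v)
  simp only [map_sub, map_neg, _root_.sub_apply, neg_apply] at this ⊢
  linarith

variable [ConnectedSpace D]

/-- At aG the kernel should be Ad_a 𝔤, hence isotropic. Without the adjoint action, the linear
equation `dvec_kerForm` spreads the vanishing from the base point, where the kernel is contained in
𝔤. The factor 2 counts the two terms of that equation. -/
theorem kerForm_eq_zero (y : D ⧸ G) : kerForm s y = 0 := by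
  have : ConnectedSpace (D ⧸ G) :=
    QuotientGroup.mk_surjective.connectedSpace continuous_quot_mk
  refine eq_zero_of_norm_dvec_le (E := ES) (smoothAt_kerForm s) (smoothFormAt_kerConn s)
    zero_le_two (fun y w => ?_) (y₀ := ((1 : D) : D ⧸ G)) ?_ y
  · refine ContinuousLinearMap.opNorm_le_bound₂ _ (by positivity) fun u v => ?_
    rw [dvec_kerForm]
    have h1 := (kerForm s y).le_opNorm₂ (kerConn s y w u) v
    have h2 := (kerForm s y).le_opNorm₂ u (kerConn s y w v)
    have h3 : ‖kerForm s y‖ * ‖kerConn s y w u‖ * ‖v‖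
        ≤ ‖kerForm s y‖ * (‖kerConn s y w‖ * ‖u‖) * ‖v‖ := by
      gcongr
      exact (kerConn s y w).le_opNorm u
    have h4 : ‖kerForm s y‖ * ‖u‖ * ‖kerConn s y w v‖
        ≤ ‖kerForm s y‖ * ‖u‖ * (‖kerConn s y w‖ * ‖v‖) := by
      gcongr
      exact (kerConn s y w).le_opNorm v
    refine (norm_add_le _ _).trans ?_
    linarith
  · have hk : ∀ u : 𝔡, Q.rhoS ((1 : D) : D ⧸ G) u = 0 → u ∈ P.sub := by
      intro u hu
      rw [rhoS_mk] at hu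
      rw [Q.sub_eq]
      have h1 : rightField (Q.ident u) (1 : D) = Q.ident u := by
        have : (fun b : D => b * 1) = id := by ext b; simp
        unfold rightField
        rw [this]
        exact congrArg (fun A : ED →L[ℝ] ED => A _) (mfderiv_id (I := 𝓘(ℝ, ED)) (x := (1 : D)))
      rwa [h1] at hu
    ext u v
    rw [kerForm_apply]
    exact (P.lagrangian _).1 (hk _ (by rw [map_sub, rhoS_projS, sub_self])) _
      (hk _ (by rw [map_sub, rhoS_projS, sub_self]))

theorem form_ker {y : D ⧸ G} {u v : 𝔡} (hu : Q.rhoS y u = 0) (hv : Q.rhoS y v = 0)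
    (s : ConnectionSplitting Q) : P.form u v = 0 := by
  have h : kerForm s y u v = 0 := by rw [kerForm_eq_zero]; rfl
  rwa [kerForm_apply, projS_apply, projS_apply, hu, hv, map_zero, sub_zero, sub_zero] at h

theorem form_projS_projS (y : D ⧸ G) (u v : 𝔡) : P.form (projS s y u) (projS s y v) = 0 :=
  s.isotropic y _ _

/-- Expand ⟨(1 - q)u, (1 - q)v⟩ = 0 and drop ⟨qu, qv⟩ = 0. The identity says that the adjoint of q
is 1 - q, as for a pair of complementary Lagrangians. -/
theorem form_projS_add (y : D ⧸ G) (u v : 𝔡) :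
    P.form (projS s y u) v + P.form u (projS s y v) = P.form u v := by
  have h : kerForm s y u v = 0 := by rw [kerForm_eq_zero]; rfl
  have h2 := form_projS_projS s y u v
  rw [kerForm_apply] at h
  simp only [map_sub, _root_.sub_apply] at h
  linarith

end Isotropy

/-! ### The invariant trilinear form of a Manin pair -/

section ManinAlgebra

variable {𝔡 : Type*} [NormedAddCommGroup 𝔡] [NormedSpace ℝ 𝔡] (P : ManinPair 𝔡)

theorem ManinPair.bracket_swap (a b : 𝔡) : P.bracket a b = - P.bracket b a := by
  have h := P.bracket_self (a + b)
  simp only [map_add, _root_.add_apply, P.bracket_self, zero_add, add_zero] at h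
  exact eq_neg_of_add_eq_zero_right h

/-- The invariant trilinear form `⟨[a, b], c⟩`. -/
def ManinPair.tri (a b c : 𝔡) : ℝ := P.form (P.bracket a b) c

theorem ManinPair.tri_swap (a b c : 𝔡) : P.tri a b c = - P.tri b a c := by
  unfold ManinPair.tri
  rw [P.bracket_swap a b, map_neg, neg_apply]

theorem ManinPair.tri_swap_right (a b c : 𝔡) : P.tri a b c = - P.tri a c b := by
  unfold ManinPair.tri
  have h := P.form_invariant a b c
  rw [P.form_symm b] at h
  linarith

theorem ManinPair.tri_cycle (a b c : 𝔡) : P.tri a b c = P.tri b c a := by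
  rw [P.tri_swap, P.tri_swap_right, neg_neg]

theorem ManinPair.tri_add_left (a a' b c : 𝔡) : P.tri (a + a') b c = P.tri a b c + P.tri a' b c := by
  simp only [ManinPair.tri, map_add, _root_.add_apply]

theorem ManinPair.tri_add_mid (a b b' c : 𝔡) : P.tri a (b + b') c = P.tri a b c + P.tri a b' c := by
  simp only [ManinPair.tri, map_add, _root_.add_apply]

theorem ManinPair.tri_add_right (a b c c' : 𝔡) : P.tri a b (c + c') = P.tri a b c + P.tri a b c' := by
  simp only [ManinPair.tri, map_add]

/-- The algebraic identity behind the compatibility of `φ_S` with the bracket of `𝔡`; `q` is the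
projection onto the image of `s` and `d i` its derivative along `u i`. -/
theorem ManinPair.courant_identity (q : 𝔡 →L[ℝ] 𝔡) (u₁ u₂ u₃ : 𝔡) (d₁ d₂ d₃ : 𝔡 →L[ℝ] 𝔡)
    (hqq : ∀ a b, P.form (q a) (q b) = 0)
    (hq : ∀ a b, P.form (q a) b + P.form a (q b) = P.form a b)
    (hd₁ : ∀ a b, P.form (d₁ a) (q b) + P.form (q a) (d₁ b) = 0)
    (hd₂ : ∀ a b, P.form (d₂ a) (q b) + P.form (q a) (d₂ b) = 0)
    (hd₃ : ∀ a b, P.form (d₃ a) (q b) + P.form (q a) (d₃ b) = 0)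
    (hc₁ : ∀ a b, P.form (d₁ a) (b - q b) = P.tri u₁ (a - q a) (b - q b))
    (hc₂ : ∀ a b, P.form (d₂ a) (b - q b) = P.tri u₂ (a - q a) (b - q b))
    (hc₃ : ∀ a b, P.form (d₃ a) (b - q b) = P.tri u₃ (a - q a) (b - q b))
    (hp : P.tri (u₁ - q u₁) (u₂ - q u₂) (u₃ - q u₃) = 0) :
    P.form u₃ (q (P.bracket u₁ u₂))
      + P.form u₂ (d₁ u₃ - d₃ u₁ - q (P.bracket u₁ u₃)) + P.form u₂ (d₃ u₁)
      - P.form u₁ (d₂ u₃ - d₃ u₂ - q (P.bracket u₂ u₃))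
      + ((1 / 2 : ℝ) * (P.form (d₁ u₂ - d₂ u₁ - q (P.bracket u₁ u₂)) (q u₃)
          + P.form (q u₁) (d₂ u₃ - d₃ u₂ - q (P.bracket u₂ u₃))
          - P.form (q u₂) (d₁ u₃ - d₃ u₁ - q (P.bracket u₁ u₃)))
        + P.tri (q u₁) (q u₂) (q u₃)) = P.tri u₁ u₂ u₃ := by
  have hq' : ∀ a b c, P.form a (q (P.bracket b c)) = P.tri b c (a - q a) := by
    intro a b c
    have h := hq a (P.bracket b c)
    rw [P.form_symm a (P.bracket b c), P.form_symm (q a) (P.bracket b c)] at h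
    simp only [ManinPair.tri, map_sub]
    linarith
  have key : ∀ (d : 𝔡 →L[ℝ] 𝔡) a b,
      P.form (d a) b = P.form (d a) (q b) + P.form (d a) (b - q b) := by
    intro d a b
    rw [map_sub]; ring
  have e : ∀ (d : 𝔡 →L[ℝ] 𝔡) a b, P.form (q a) (d b) = P.form (d b) (q a) :=
    fun d a b => P.form_symm _ _
  have sk : ∀ d : 𝔡 →L[ℝ] 𝔡, (∀ a b, P.form (d a) (q b) + P.form (q a) (d b) = 0) → ∀ a b,
      P.form (d a) (q b) = - P.form (d b) (q a) := fun d hd a b => by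
    have := hd a b
    rw [e d] at this
    linarith
  -- The second argument of the form is split by q and 1 - q. The half along 1 - q is a value of the
  -- trilinear form by `hc₁`; the half along q is skew by `hd₁` and cancels later.
  have f₁ : P.form u₂ (d₁ u₃) = P.form (d₁ u₃) (q u₂) + P.tri u₁ (u₃ - q u₃) (u₂ - q u₂) := by
    rw [P.form_symm, key d₁, hc₁]
  have f₂ : P.form u₁ (d₂ u₃) = P.form (d₂ u₃) (q u₁) + P.tri u₂ (u₃ - q u₃) (u₁ - q u₁) := by
    rw [P.form_symm, key d₂, hc₂]
  have f₃ : P.form u₁ (d₃ u₂) = P.form (d₃ u₂) (q u₁) + P.tri u₃ (u₂ - q u₂) (u₁ - q u₁) := by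
    rw [P.form_symm, key d₃, hc₃]
  simp only [map_sub, _root_.sub_apply, hqq] at hp ⊢
  simp only [hq', f₁, f₂, f₃, e d₁, e d₂, e d₃] at hp ⊢
  rw [sk d₁ hd₁ u₂ u₃, sk d₂ hd₂ u₁ u₃, sk d₃ hd₃ u₁ u₂]
  generalize hP₁ : u₁ - q u₁ = p₁ at *
  generalize hP₂ : u₂ - q u₂ = p₂ at *
  generalize hP₃ : u₃ - q u₃ = p₃ at *
  have hu₁ : u₁ = p₁ + q u₁ := by rw [← hP₁]; abel
  have hu₂ : u₂ = p₂ + q u₂ := by rw [← hP₂]; abel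
  have hu₃ : u₃ = p₃ + q u₃ := by rw [← hP₃]; abel
  generalize q u₁ = q₁ at *
  generalize q u₂ = q₂ at *
  generalize q u₃ = q₃ at *
  have s₁ := P.tri_swap_right u₁ p₃ p₂
  have s₂ := P.tri_cycle p₁ u₂ p₃
  have s₃ := P.tri_swap_right u₃ p₂ p₁
  have s₄ := P.tri_cycle u₃ p₁ p₂
  have s₅ := P.tri_swap_right u₁ u₃ p₂
  have s₆ := P.tri_cycle p₁ u₂ u₃
  -- With u = p + q in each slot this is inclusion–exclusion over the slots occupied by p; the term
  -- with three p's vanishes by `hp`.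
  have g : P.tri u₁ u₂ p₃ + P.tri u₁ p₂ u₃ + P.tri p₁ u₂ u₃ - P.tri u₁ p₂ p₃ - P.tri p₁ u₂ p₃
      - P.tri p₁ p₂ u₃ + P.tri q₁ q₂ q₃ = P.tri u₁ u₂ u₃ := by
    rw [hu₁, hu₂, hu₃]
    simp only [ManinPair.tri_add_left, ManinPair.tri_add_mid, ManinPair.tri_add_right]
    linarith
  linarith

end ManinAlgebra

/-! ### Twisted Courant brackets of sections lying over 𝔡-valued functions -/

section CourantIdentity

variable {𝔡 : Type*} [NormedAddCommGroup 𝔡] [NormedSpace ℝ 𝔡] [FiniteDimensional ℝ 𝔡]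
  {P : ManinPair 𝔡}
  {ED : Type*} [NormedAddCommGroup ED] [NormedSpace ℝ ED] [FiniteDimensional ℝ ED]
  {ES : Type*} [NormedAddCommGroup ES] [NormedSpace ℝ ES] [FiniteDimensional ℝ ES]
  {D : Type*} [TopologicalSpace D] [ChartedSpace ED D] [Group D] [LieGroup 𝓘(ℝ, ED) ∞ D]
  [ConnectedSpace D]
  {G : Subgroup D} [ChartedSpace ES (D ⧸ G)] [IsManifold 𝓘(ℝ, ES) ∞ (D ⧸ G)]
  {Q : GroupPair P ED ES G} (s : ConnectionSplitting Q)
  {E : Type*} [NormedAddCommGroup E] [NormedSpace ℝ E] [FiniteDimensional ℝ E]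
  {M : Type*} [TopologicalSpace M] [ChartedSpace E M] [IsManifold 𝓘(ℝ, E) ∞ M]

/-- This is the derivative of the isotropy relation ⟨qa, qb⟩ = 0. -/
theorem dvec_projS_form_add (y : D ⧸ G) (w : Tan ES y) (a b : 𝔡) :
    P.form (dvec (E := ES) (projS s) y w a) (projS s y b)
      + P.form (projS s y a) (dvec (E := ES) (projS s) y w b) = 0 := by
  have h : ∀ a, SmoothAt ES (fun y => projS s y a) y := fun a =>
    (smoothAt_projS s y).clm_apply contMDiffAt_const
  have h1 := dvec_bilin P.form (h a).mdiff (h b).mdiff w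
  simp only [form_projS_projS] at h1
  rw [dvec_const, dvec_clm_apply (smoothAt_projS s y).mdiff,
    dvec_clm_apply (smoothAt_projS s y).mdiff] at h1
  exact h1.symm

/-- By `rhoS_dvec_projS`, [u, (1 - q)a] - (∂_u q)(a) lies in ker ρ_S, hence is orthogonal to (1 -
q)b. -/
theorem form_dvec_projS (y : D ⧸ G) (u a b : 𝔡) :
    P.form (dvec (E := ES) (projS s) y (Q.rhoS y u) a) (b - projS s y b)
      = P.tri u (a - projS s y a) (b - projS s y b) := by
  have h := form_ker (rhoS_dvec_projS s y u a)
    (show Q.rhoS y (b - projS s y b) = 0 by rw [map_sub, rhoS_projS, sub_self]) s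
  have e : ∀ a b c : 𝔡, P.form (a - b) c = P.form a c - P.form b c := fun a b c => by
    rw [map_sub, _root_.sub_apply]
  rw [e] at h
  unfold ManinPair.tri
  linarith

/-- The vector (1 - q)a acts by the zero tangent vector, so the derivative of q along it vanishes,
and `form_dvec_projS` gives the claim. -/
theorem tri_sub_projS (y : D ⧸ G) (a b c : 𝔡) :
    P.tri (a - projS s y a) (b - projS s y b) (c - projS s y c) = 0 := by
  have h : Q.rhoS y (a - projS s y a) = 0 := by rw [map_sub, rhoS_projS, sub_self]
  rw [← form_dvec_projS, h, map_zero, zero_apply, map_zero, zero_apply]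

/-- The pull-back of the connection splitting. -/
def pullS (J : M → D ⧸ G) (x : M) : Tan E x →L[ℝ] 𝔡 := (s.toFun (J x)).comp (tmap E ES J x)

theorem pullS_apply (J : M → D ⧸ G) (x : M) (X : Tan E x) :
    pullS s J x X = s.toFun (J x) (tmap E ES J x X) := rfl

theorem cotmap_star (J : M → D ⧸ G) (x : M) (u : 𝔡) :
    cotmap E ES J x (s.star (J x) u) = (P.form u).comp (pullS s J x) := rfl

variable {J : M → D ⧸ G}

theorem smoothFormAt_pullS (hJ : ContMDiff 𝓘(ℝ, E) 𝓘(ℝ, ES) ∞ J) (x : M) : SmoothFormAt (pullS (E := E) s J) x :=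
  SmoothFormAt.pullback hJ (smoothFormAt_s s (J x))

theorem tmap_mlieBracket_rhoS (hJ : ContMDiff 𝓘(ℝ, E) 𝓘(ℝ, ES) ∞ J)
    {X₁ X₂ : ∀ x : M, Tan E x} {U₁ U₂ : M → 𝔡} {x : M}
    (hX₁ : SmoothVFAt X₁ x) (hX₂ : SmoothVFAt X₂ x)
    (hU₁ : SmoothAt E U₁ x) (hU₂ : SmoothAt E U₂ x)
    (h₁ : ∀ x, tmap E ES J x (X₁ x) = Q.rhoS (J x) (U₁ x))
    (h₂ : ∀ x, tmap E ES J x (X₂ x) = Q.rhoS (J x) (U₂ x)) :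
    tmap E ES J x (mlieBracket 𝓘(ℝ, E) X₁ X₂ x) = Q.rhoS (J x) (P.bracket (U₁ x) (U₂ x)
      + (dvec (E := E) U₂ x (X₁ x) - dvec (E := E) U₁ x (X₂ x))) := by
  rw [tmap_mlieBracket_coeff hJ (smoothVFAt_rhoS Q) hX₁ hX₂ hU₁ hU₂ h₁ h₂, mlieBracket_rhoS, map_add]

theorem smoothAt_projS_comp (hJ : ContMDiff 𝓘(ℝ, E) 𝓘(ℝ, ES) ∞ J)
    {U : M → 𝔡} {x : M} (hU : SmoothAt E U x) :
    SmoothAt E (fun y => projS s (J y) (U y)) x :=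
  ContMDiffAt.clm_apply ((smoothAt_projS s (J x)).comp x hJ.contMDiffAt) hU

theorem dvec_projS_comp (hJ : ContMDiff 𝓘(ℝ, E) 𝓘(ℝ, ES) ∞ J)
    {X : ∀ x : M, Tan E x} {V U : M → 𝔡} {x : M} (hU : SmoothAt E U x)
    (hX : tmap E ES J x (X x) = Q.rhoS (J x) (V x)) :
    dvec (E := E) (fun y => projS s (J y) (U y)) x (X x)
      = dvec (E := ES) (projS s) (J x) (Q.rhoS (J x) (V x)) (U x)
        + projS s (J x) (dvec (E := E) U x (X x)) := by
  have hq : SmoothAt E (fun y => projS s (J y)) x :=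
    (smoothAt_projS s (J x)).comp x hJ.contMDiffAt
  have h := dvec_bilin (E := E) (ContinuousLinearMap.id ℝ (𝔡 →L[ℝ] 𝔡)) hq.mdiff hU.mdiff (X x)
  refine h.trans ?_
  rw [dvec_comp (smoothAt_projS s (J x)).mdiff (mdiff_of_contMDiff hJ x), hX]
  rfl

theorem pullS_mlieBracket (hJ : ContMDiff 𝓘(ℝ, E) 𝓘(ℝ, ES) ∞ J)
    {X₁ X₂ : ∀ x : M, Tan E x} {U₁ U₂ : M → 𝔡} {x : M}
    (hX₁ : SmoothVFAt X₁ x) (hX₂ : SmoothVFAt X₂ x)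
    (hU₁ : SmoothAt E U₁ x) (hU₂ : SmoothAt E U₂ x)
    (h₁ : ∀ x, tmap E ES J x (X₁ x) = Q.rhoS (J x) (U₁ x))
    (h₂ : ∀ x, tmap E ES J x (X₂ x) = Q.rhoS (J x) (U₂ x)) :
    pullS s J x (mlieBracket 𝓘(ℝ, E) X₁ X₂ x) = projS s (J x) (P.bracket (U₁ x) (U₂ x))
      + projS s (J x) (dvec (E := E) U₂ x (X₁ x)) - projS s (J x) (dvec (E := E) U₁ x (X₂ x)) := by
  rw [pullS_apply, tmap_mlieBracket_rhoS hJ hX₁ hX₂ hU₁ hU₂ h₁ h₂, ← projS_apply, map_add, map_sub]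
  abel

/-- Cartan's formula is applied on M to J^*s, whose value on X_i is qU_i, and naturality of d
returns to S. The X_i need not descend to vector fields on S, and the derivatives of the U_i cancel
against those in the bracket. -/
theorem extD_s_eq (hJ : ContMDiff 𝓘(ℝ, E) 𝓘(ℝ, ES) ∞ J)
    {X₁ X₂ : ∀ x : M, Tan E x} {U₁ U₂ : M → 𝔡} {x : M}
    (hX₁ : SmoothVFAt X₁ x) (hX₂ : SmoothVFAt X₂ x)
    (hU₁ : SmoothAt E U₁ x) (hU₂ : SmoothAt E U₂ x)
    (h₁ : ∀ x, tmap E ES J x (X₁ x) = Q.rhoS (J x) (U₁ x))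
    (h₂ : ∀ x, tmap E ES J x (X₂ x) = Q.rhoS (J x) (U₂ x)) :
    extD s.toFun (J x) (tmap E ES J x (X₁ x)) (tmap E ES J x (X₂ x))
      = dvec (E := ES) (projS s) (J x) (Q.rhoS (J x) (U₁ x)) (U₂ x)
        - dvec (E := ES) (projS s) (J x) (Q.rhoS (J x) (U₂ x)) (U₁ x)
        - projS s (J x) (P.bracket (U₁ x) (U₂ x)) := by
  have : CompleteSpace E := FiniteDimensional.complete ℝ E
  have h := extD_eq (smoothFormAt_pullS s hJ x) hX₁ hX₂
  have e₁ : (fun y => pullS s J y (X₁ y)) = fun y => projS s (J y) (U₁ y) := by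
    funext y; rw [pullS_apply, h₁, projS_apply]
  have e₂ : (fun y => pullS s J y (X₂ y)) = fun y => projS s (J y) (U₂ y) := by
    funext y; rw [pullS_apply, h₂, projS_apply]
  rw [e₁, e₂, dvec_projS_comp s hJ hU₂ (h₁ x), dvec_projS_comp s hJ hU₁ (h₂ x),
    pullS_mlieBracket s hJ hX₁ hX₂ hU₁ hU₂ h₁ h₂] at h
  rw [← extD_pullback hJ (smoothFormAt_s s (J x))]
  refine h.trans ?_
  abel

/-- The pairing of a Courant bracket with a section, in terms of Lie brackets and derivatives. -/
theorem bigPairing_courant {φ : ∀ x : M, Tan E x → Tan E x → Cot E x}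
    {e₁ e₂ e₃ : ∀ x : M, BigTan E x} {x : M}
    (h₁ : SmoothVFAt (fun y => (e₁ y).1) x) (h₁' : SmoothFormAt (fun y => (e₁ y).2) x)
    (h₂ : SmoothVFAt (fun y => (e₂ y).1) x) (h₂' : SmoothFormAt (fun y => (e₂ y).2) x)
    (h₃ : SmoothVFAt (fun y => (e₃ y).1) x) :
    bigPairing (courant φ e₁ e₂ x) (e₃ x) =
      (e₃ x).2 (mlieBracket 𝓘(ℝ, E) (fun y => (e₁ y).1) (fun y => (e₂ y).1) x)
      + dvec (E := E) (fun y => (e₂ y).2 (e₃ y).1) x (e₁ x).1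
      - (e₂ x).2 (mlieBracket 𝓘(ℝ, E) (fun y => (e₁ y).1) (fun y => (e₃ y).1) x)
      - dvec (E := E) (fun y => (e₁ y).2 (e₃ y).1) x (e₂ x).1
      + dvec (E := E) (fun y => (e₁ y).2 (e₂ y).1) x (e₃ x).1
      + (e₁ x).2 (mlieBracket 𝓘(ℝ, E) (fun y => (e₂ y).1) (fun y => (e₃ y).1) x)
      + φ x (e₁ x).1 (e₂ x).1 (e₃ x).1 := by
  have : CompleteSpace E := FiniteDimensional.complete ℝ E
  have c₁ := extD_eq h₂' h₁ h₃
  have c₂ := extD_eq h₁' h₂ h₃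
  simp only [bigPairing, courant, lieForm, _root_.add_apply, _root_.sub_apply, dfun_eq_dvec]
  simp only [c₁, c₂]
  ring

/-- The Courant bracket, twisted by the pull-back of `φ_S`, of sections of the form
`(X, J^* s^* U + df)` with `dJ ∘ X = ρ_S(U)`. -/
theorem bigPairing_courant_lift (hJ : ContMDiff 𝓘(ℝ, E) 𝓘(ℝ, ES) ∞ J)
    {X₁ X₂ X₃ : ∀ x : M, Tan E x} {U₁ U₂ U₃ : M → 𝔡} {f₁ f₂ f₃ : M → ℝ} {x : M}
    (hX₁ : SmoothVFAt X₁ x) (hX₂ : SmoothVFAt X₂ x) (hX₃ : SmoothVFAt X₃ x)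
    (hU₁ : SmoothAt E U₁ x) (hU₂ : SmoothAt E U₂ x) (hU₃ : SmoothAt E U₃ x)
    (hf₁ : SmoothAt E f₁ x) (hf₂ : SmoothAt E f₂ x)
    (h₁ : ∀ x, tmap E ES J x (X₁ x) = Q.rhoS (J x) (U₁ x))
    (h₂ : ∀ x, tmap E ES J x (X₂ x) = Q.rhoS (J x) (U₂ x))
    (h₃ : ∀ x, tmap E ES J x (X₃ x) = Q.rhoS (J x) (U₃ x)) :
    bigPairing (courant (pullThree J s.phiS)
        (fun y => (X₁ y, cotmap E ES J y (s.star (J y) (U₁ y)) + dvec (E := E) f₁ y))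
        (fun y => (X₂ y, cotmap E ES J y (s.star (J y) (U₂ y)) + dvec (E := E) f₂ y)) x)
        (X₃ x, cotmap E ES J x (s.star (J x) (U₃ x)) + dvec (E := E) f₃ x)
      = P.tri (U₁ x) (U₂ x) (U₃ x) + P.form (dvec (E := E) U₂ x (X₁ x)) (U₃ x)
        - P.form (dvec (E := E) U₁ x (X₂ x)) (U₃ x) + P.form (dvec (E := E) U₁ x (X₃ x)) (U₂ x)
        + dvec (E := E) f₃ x (mlieBracket 𝓘(ℝ, E) X₁ X₂ x)
        + dvec (E := E) (fun y => dvec (E := E) f₂ y (X₁ y)) x (X₃ x) := by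
  have : CompleteSpace E := FiniteDimensional.complete ℝ E
  have hα : ∀ {U : M → 𝔡} {f : M → ℝ}, SmoothAt E U x → SmoothAt E f x → SmoothFormAt
      (fun y => cotmap E ES J y (s.star (J y) (U y)) + dvec (E := E) f y) x := by
    intro U f hU hf
    refine SmoothFormAt.add ?_ (smoothFormAt_dvec hf)
    exact smoothFormAt_of_apply fun X hX =>
      smoothAt_bilin P.form hU ((smoothFormAt_pullS s hJ x).apply hX)
  have hpair : ∀ {X : ∀ x : M, Tan E x} {U V : M → 𝔡} {f : M → ℝ} (w : Tan E x),
      SmoothAt E U x → SmoothAt E V x → SmoothAt E f x → SmoothVFAt X x →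
      (∀ x, tmap E ES J x (X x) = Q.rhoS (J x) (V x)) →
      dvec (E := E) (fun y => (cotmap E ES J y (s.star (J y) (U y)) + dvec (E := E) f y) (X y)) x w
        = P.form (dvec (E := E) U x w) (projS s (J x) (V x))
          + P.form (U x) (dvec (E := E) (fun y => projS s (J y) (V y)) x w)
          + dvec (E := E) (fun y => dvec (E := E) f y (X y)) x w := by
    intro X U V f w hU hV hf hX h
    have e : (fun y => (cotmap E ES J y (s.star (J y) (U y)) + dvec (E := E) f y) (X y))
        = fun y => P.form (U y) (projS s (J y) (V y)) + dvec (E := E) f y (X y) := by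
      funext y
      rw [_root_.add_apply, cotmap_star]
      change P.form (U y) (s.toFun (J y) (tmap E ES J y (X y))) + _ = _
      rw [h, projS_apply]
    have hUV : SmoothAt E (fun y => P.form (U y) (projS s (J y) (V y))) x :=
      smoothAt_bilin P.form hU (smoothAt_projS_comp s hJ hV)
    rw [e, dvec_add hUV.mdiff ((smoothFormAt_dvec hf).apply hX).mdiff, _root_.add_apply,
      dvec_bilin P.form hU.mdiff (smoothAt_projS_comp s hJ hV).mdiff]
  have hval : ∀ (U : M → 𝔡) (f : M → ℝ) (w : Tan E x),
      (cotmap E ES J x (s.star (J x) (U x)) + dvec (E := E) f x) w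
        = P.form (U x) (pullS s J x w) + dvec (E := E) f x w := fun U f w => rfl
  have hφ : pullThree J s.phiS x (X₁ x) (X₂ x) (X₃ x) =
      (1 / 2 : ℝ) * (P.form (extD s.toFun (J x) (tmap E ES J x (X₁ x)) (tmap E ES J x (X₂ x)))
          (projS s (J x) (U₃ x))
        + P.form (projS s (J x) (U₁ x))
          (extD s.toFun (J x) (tmap E ES J x (X₂ x)) (tmap E ES J x (X₃ x)))
        - P.form (projS s (J x) (U₂ x))
          (extD s.toFun (J x) (tmap E ES J x (X₁ x)) (tmap E ES J x (X₃ x))))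
        + P.tri (projS s (J x) (U₁ x)) (projS s (J x) (U₂ x)) (projS s (J x) (U₃ x)) := by
    simp only [projS_apply, ← h₁, ← h₂, ← h₃]
    rfl
  rw [bigPairing_courant
    (e₃ := fun y => (X₃ y, cotmap E ES J y (s.star (J y) (U₃ y)) + dvec (E := E) f₃ y))
    hX₁ (hα hU₁ hf₁) hX₂ (hα hU₂ hf₂) hX₃]
  simp only
  rw [hφ, hpair _ hU₂ hU₃ hf₂ hX₃ h₃, hpair _ hU₁ hU₃ hf₁ hX₃ h₃, hpair _ hU₁ hU₂ hf₁ hX₂ h₂,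
    hval U₃, hval U₂, hval U₁, dvec_mlieBracket hf₂ hX₁ hX₃, dvec_mlieBracket hf₁ hX₂ hX₃,
    pullS_mlieBracket s hJ hX₁ hX₂ hU₁ hU₂ h₁ h₂, pullS_mlieBracket s hJ hX₁ hX₃ hU₁ hU₃ h₁ h₃,
    pullS_mlieBracket s hJ hX₂ hX₃ hU₂ hU₃ h₂ h₃, dvec_projS_comp s hJ hU₃ (h₁ x),
    dvec_projS_comp s hJ hU₃ (h₂ x), dvec_projS_comp s hJ hU₂ (h₃ x),
    extD_s_eq s hJ hX₁ hX₂ hU₁ hU₂ h₁ h₂, extD_s_eq s hJ hX₁ hX₃ hU₁ hU₃ h₁ h₃,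
    extD_s_eq s hJ hX₂ hX₃ hU₂ hU₃ h₂ h₃]
  -- All terms free of derivatives of the U_i and f_i add up to ⟨[U₁, U₂], U₃⟩ by pure algebra at
  -- the point J x.
  have key := P.courant_identity (projS s (J x)) (U₁ x) (U₂ x) (U₃ x)
    (dvec (E := ES) (projS s) (J x) (Q.rhoS (J x) (U₁ x)))
    (dvec (E := ES) (projS s) (J x) (Q.rhoS (J x) (U₂ x)))
    (dvec (E := ES) (projS s) (J x) (Q.rhoS (J x) (U₃ x)))
    (form_projS_projS s (J x)) (form_projS_add s (J x))
    (dvec_projS_form_add s (J x) _) (dvec_projS_form_add s (J x) _)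
    (dvec_projS_form_add s (J x) _) (form_dvec_projS s (J x) _) (form_dvec_projS s (J x) _)
    (form_dvec_projS s (J x) _) (tri_sub_projS s (J x) _ _ _)
  -- In the remaining terms a derivative of some U occurs once paired with qU_k and once, after
  -- applying q, with U_k; each such pair merges into one value of the form.
  have a₁ := form_projS_add s (J x) (U₃ x) (dvec (E := E) U₂ x (X₁ x))
  have a₂ := form_projS_add s (J x) (U₃ x) (dvec (E := E) U₁ x (X₂ x))
  have a₃ := form_projS_add s (J x) (U₂ x) (dvec (E := E) U₁ x (X₃ x))
  rw [P.form_symm _ (U₃ x), P.form_symm _ (U₃ x), P.form_symm _ (U₂ x), ← a₁, ← a₂, ← a₃,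
    ← key, P.form_symm (projS s (J x) (U₃ x)), P.form_symm (projS s (J x) (U₃ x)),
    P.form_symm (projS s (J x) (U₂ x)) (dvec (E := E) U₁ x (X₃ x))]
  simp only [map_add, map_sub]
  ring

end CourantIdentity

/-! ### Isotropic and Lagrangian subspaces of T_xM ⊕ T*_xM -/

section Lagrangian

variable {E : Type*} [NormedAddCommGroup E] [NormedSpace ℝ E] [FiniteDimensional ℝ E]
  {M : Type*} [TopologicalSpace M] [ChartedSpace E M]

theorem bigPairing_comm {x : M} (a b : BigTan E x) : bigPairing a b = bigPairing b a :=
  add_comm _ _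

theorem bigPairing_add_right {x : M} (a b c : BigTan E x) :
    bigPairing a (b + c) = bigPairing a b + bigPairing a c := by
  simp only [bigPairing, Prod.fst_add, Prod.snd_add, map_add, _root_.add_apply]
  ring

theorem bigPairing_smul_right {x : M} (r : ℝ) (a b : BigTan E x) :
    bigPairing a (r • b) = r * bigPairing a b := by
  simp only [bigPairing, Prod.smul_fst, Prod.smul_snd, map_smul, _root_.smul_apply, smul_eq_mul]
  ring

/-- The pairing as a linear map in its second argument. -/
def bigPairingL {x : M} (a : BigTan E x) : BigTan E x →ₗ[ℝ] ℝ where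
  toFun := bigPairing a
  map_add' := bigPairing_add_right a
  map_smul' := fun r b => bigPairing_smul_right r a b

theorem bigPairing_add_left {x : M} (a b c : BigTan E x) :
    bigPairing (a + b) c = bigPairing a c + bigPairing b c := by
  rw [bigPairing_comm, bigPairing_add_right, bigPairing_comm c a, bigPairing_comm c b]

theorem bigPairing_sub_left {x : M} (a b c : BigTan E x) :
    bigPairing (a - b) c = bigPairing a c - bigPairing b c := by
  have h := bigPairing_add_left (a - b) b c
  rw [sub_add_cancel] at h
  linarith

theorem eq_zero_of_cot {x : M} {v : Tan E x} (h : ∀ α : Cot E x, α v = 0) : v = 0 := by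
  exact SeparatingDual.eq_zero_of_forall_dual_eq_zero (R := ℝ) (V := E) h

theorem eq_zero_of_bigPairing {x : M} {a : BigTan E x} (h : ∀ b, bigPairing a b = 0) : a = 0 := by
  refine Prod.ext (eq_zero_of_cot fun α => ?_) ?_
  · simpa [bigPairing] using h (0, α)
  · ext v
    simpa [bigPairing] using h (v, 0)

theorem exists_bigPairing_eq {x : M} (f : BigTan E x →ₗ[ℝ] ℝ) :
    ∃ a : BigTan E x, ∀ b, bigPairing a b = f b := by
  have hf : FiniteDimensional ℝ (Tan E x) := inferInstanceAs (FiniteDimensional ℝ E)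
  have hc : FiniteDimensional ℝ (Cot E x) := inferInstanceAs (FiniteDimensional ℝ (E →L[ℝ] ℝ))
  let β : BigTan E x →ₗ[ℝ] Module.Dual ℝ (BigTan E x) :=
    { toFun := bigPairingL
      map_add' := fun a b => LinearMap.ext fun c => bigPairing_add_left a b c
      map_smul' := fun r a => LinearMap.ext fun c => by
        change bigPairing (r • a) c = r * bigPairing a c
        rw [bigPairing_comm, bigPairing_smul_right, bigPairing_comm] }
  have hβ : Function.Injective β := (injective_iff_map_eq_zero β).2 fun a ha =>
    eq_zero_of_bigPairing fun b => congrArg (fun g : Module.Dual ℝ (BigTan E x) => g b) ha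
  obtain ⟨a, ha⟩ := (LinearMap.injective_iff_surjective_of_finrank_eq_finrank
    (Subspace.dual_finrank_eq (K := ℝ) (V := BigTan E x)).symm).1 hβ f
  exact ⟨a, fun b => congrArg (fun g : Module.Dual ℝ (BigTan E x) => g b) ha⟩

/-- A subspace whose orthogonal vanishes is everything. -/
theorem eq_top_of_orthogonal {x : M} {W : Submodule ℝ (BigTan E x)}
    (h : ∀ a : BigTan E x, (∀ b ∈ W, bigPairing a b = 0) → a = 0) : W = ⊤ := by
  by_contra hW
  obtain ⟨f, hf, hW'⟩ := Submodule.exists_le_ker_of_lt_top W (lt_top_iff_ne_top.2 hW)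
  obtain ⟨a, ha⟩ := exists_bigPairing_eq f
  have ha0 : a = 0 := h a fun b hb => (ha b).trans (hW' hb)
  refine hf (LinearMap.ext fun b => ?_)
  rw [← ha, ha0, bigPairing_comm]
  exact (bigPairingL b).map_zero

/-- Isotropy of a subspace. -/
def IsIsotropic {x : M} (W : Submodule ℝ (BigTan E x)) : Prop :=
  ∀ a ∈ W, ∀ b ∈ W, bigPairing a b = 0

/-- A common element is orthogonal to L and to C, hence to everything, and the pairing is
nondegenerate. -/
theorem isCompl_of_isotropic {x : M} {L C : Submodule ℝ (BigTan E x)} (hL : IsIsotropic L)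
    (hC : IsIsotropic C) (h : L ⊔ C = ⊤) : IsCompl L C := by
  refine ⟨disjoint_iff.2 ((Submodule.eq_bot_iff _).2 fun a ha => ?_), codisjoint_iff.2 h⟩
  refine eq_zero_of_bigPairing fun b => ?_
  obtain ⟨l, hl, c, hc, rfl⟩ := Submodule.mem_sup.1 (h.ge (Submodule.mem_top (x := b)))
  rw [bigPairing_add_right, hL a ha.1 l hl, hC a ha.2 c hc, add_zero]

/-- If a is orthogonal to L, its C-component is orthogonal to both L and C, hence zero. -/
theorem lagrangian_of_isotropic {x : M} {L C : Submodule ℝ (BigTan E x)} (hL : IsIsotropic L)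
    (hC : IsIsotropic C) (h : L ⊔ C = ⊤) (a : BigTan E x) :
    a ∈ L ↔ ∀ b ∈ L, bigPairing a b = 0 := by
  refine ⟨fun ha b hb => hL a ha b hb, fun ha => ?_⟩
  obtain ⟨l, hl, c, hc, rfl⟩ := Submodule.mem_sup.1 (h.ge (Submodule.mem_top (x := a)))
  have hc0 : c = 0 := by
    refine eq_zero_of_bigPairing fun b => ?_
    obtain ⟨l', hl', c', hc', rfl⟩ := Submodule.mem_sup.1 (h.ge (Submodule.mem_top (x := b)))
    have h1 := ha l' hl'
    rw [bigPairing_add_left, hL l hl l' hl', zero_add] at h1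
    rw [bigPairing_add_right, h1, hC c hc c' hc', add_zero]
  rw [hc0, add_zero]
  exact hl

theorem IsAlmostDirac.isotropic [IsManifold 𝓘(ℝ, E) ∞ M] {L : ∀ x : M, Submodule ℝ (BigTan E x)}
    (h : IsAlmostDirac L) (x : M) : IsIsotropic (L x) := fun a ha => (h.lagrangian x a).1 ha

end Lagrangian

/-! ### The Courant bracket on isotropic families is tensorial -/

section Tensoriality

variable {E : Type*} [NormedAddCommGroup E] [NormedSpace ℝ E] [FiniteDimensional ℝ E]
  {M : Type*} [TopologicalSpace M] [ChartedSpace E M] [IsManifold 𝓘(ℝ, E) ∞ M]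

theorem SmoothBigOn.vf {e : ∀ x : M, BigTan E x} (h : SmoothBigOn e univ) (x : M) :
    SmoothVFAt (fun y => (e y).1) x := h.1.at isOpen_univ (mem_univ x)

theorem SmoothBigOn.form {e : ∀ x : M, BigTan E x} (h : SmoothBigOn e univ) (x : M) :
    SmoothFormAt (fun y => (e y).2) x := h.2.at isOpen_univ (mem_univ x)

/-- Isotropy makes α_i(X_k) skew in i and k as a function near x, so the derivative and bracket
terms permute cyclically; the twisting term does so by `hφ`. -/
theorem bigPairing_courant_cycle {φ : ∀ x : M, Tan E x → Tan E x → Cot E x}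
    (hφ : ∀ x a b c, φ x a b c = φ x b c a) {L : ∀ x : M, Submodule ℝ (BigTan E x)}
    (hL : ∀ x, IsIsotropic (L x)) {e₁ e₂ e₃ : ∀ x : M, BigTan E x}
    (h₁ : SmoothBigOn e₁ univ) (h₂ : SmoothBigOn e₂ univ) (h₃ : SmoothBigOn e₃ univ)
    (m₁ : ∀ x, e₁ x ∈ L x) (m₂ : ∀ x, e₂ x ∈ L x) (m₃ : ∀ x, e₃ x ∈ L x) (x : M) :
    bigPairing (courant φ e₁ e₂ x) (e₃ x) = bigPairing (courant φ e₂ e₃ x) (e₁ x) := by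
  have e : ∀ {e e' : ∀ x : M, BigTan E x}, (∀ x, e x ∈ L x) → (∀ x, e' x ∈ L x) →
      (fun y => (e y).2 (e' y).1) = fun y => - (e' y).2 (e y).1 := fun {e e'} m m' => by
    funext y
    have := hL y _ (m y) _ (m' y)
    unfold bigPairing at this
    linarith
  rw [bigPairing_courant (h₁.vf x) (h₁.form x) (h₂.vf x) (h₂.form x) (h₃.vf x),
    bigPairing_courant (h₂.vf x) (h₂.form x) (h₃.vf x) (h₃.form x) (h₁.vf x),
    e m₁ m₃, e m₁ m₂, dvec_neg, dvec_neg, hφ x (e₁ x).1,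
    mlieBracket_swap_apply (V := fun y => (e₁ y).1) (W := fun y => (e₃ y).1),
    mlieBracket_swap_apply (V := fun y => (e₁ y).1) (W := fun y => (e₂ y).1)]
  simp only [map_neg, neg_apply]
  ring

/-- The pairing visibly depends on the third section only through its value at x. Cycling moves each
of the other sections into that place in turn, so arbitrary sections may be replaced by generators.
-/
theorem bigPairing_courant_congr {φ : ∀ x : M, Tan E x → Tan E x → Cot E x}
    (hφ : ∀ x a b c, φ x a b c = φ x b c a) {L : ∀ x : M, Submodule ℝ (BigTan E x)}
    (hL : ∀ x, IsIsotropic (L x)) {e₁ e₂ e₃ e₁' e₂' : ∀ x : M, BigTan E x}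
    (h₁ : SmoothBigOn e₁ univ) (h₂ : SmoothBigOn e₂ univ) (h₃ : SmoothBigOn e₃ univ)
    (h₁' : SmoothBigOn e₁' univ) (h₂' : SmoothBigOn e₂' univ)
    (m₁ : ∀ x, e₁ x ∈ L x) (m₂ : ∀ x, e₂ x ∈ L x) (m₃ : ∀ x, e₃ x ∈ L x)
    (m₁' : ∀ x, e₁' x ∈ L x) (m₂' : ∀ x, e₂' x ∈ L x) {x : M}
    (he₁ : e₁ x = e₁' x) (he₂ : e₂ x = e₂' x) :
    bigPairing (courant φ e₁ e₂ x) (e₃ x) = bigPairing (courant φ e₁' e₂' x) (e₃ x) := by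
  rw [bigPairing_courant_cycle hφ hL h₁ h₂ h₃ m₁ m₂ m₃, he₁,
    bigPairing_courant_cycle hφ hL h₂ h₃ h₁' m₂ m₃ m₁', he₂,
    bigPairing_courant_cycle hφ hL h₃ h₁' h₂' m₃ m₁' m₂']

end Tensoriality

/-! ### The decomposition 𝔡 = 𝔤 ⊕ j(𝔤^*) -/

section SplittingAlgebra

variable {𝔡 : Type*} [NormedAddCommGroup 𝔡] [NormedSpace ℝ 𝔡] [FiniteDimensional ℝ 𝔡]
  {P : ManinPair 𝔡} (j : IsotropicSplitting P)

theorem IsotropicSplitting.apply_star (μ : Module.Dual ℝ P.sub) (u : 𝔡) :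
    μ (j.star u) = P.form u (j.toFun μ) := by
  have h := Module.apply_evalEquiv_symm_apply (R := ℝ) (M := P.sub) μ
    ((P.form u).toLinearMap ∘ₗ j.toFun)
  exact h

theorem ManinPair.form_sub (a b : P.sub) : P.form (a : 𝔡) b = 0 :=
  (P.lagrangian a).1 a.2 b b.2

/-- The restriction of `⟨u, ·⟩` to `𝔤`. -/
def ManinPair.res (P : ManinPair 𝔡) (u : 𝔡) : Module.Dual ℝ P.sub :=
  (P.form u).toLinearMap ∘ₗ P.sub.subtype

theorem ManinPair.res_apply (u : 𝔡) (v : P.sub) : P.res u v = P.form u v := rfl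

theorem eq_zero_of_dual {v : P.sub} (h : ∀ μ : Module.Dual ℝ P.sub, μ v = 0) : v = 0 :=
  (Module.forall_dual_apply_eq_zero_iff ℝ v).1 h

/-- The difference of the two sides is orthogonal to 𝔤, hence in 𝔤, and pairs to zero with the image
of j, hence is zero. -/
theorem IsotropicSplitting.star_add_res (u : 𝔡) :
    (j.star u : 𝔡) + j.toFun (P.res u) = u := by
  have h1 : u - (j.star u : 𝔡) - j.toFun (P.res u) ∈ P.sub := by
    rw [P.lagrangian]
    intro b hb
    have h2 := j.splits (P.res u) ⟨b, hb⟩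
    have h3 := P.form_sub (j.star u) ⟨b, hb⟩
    simp only [map_sub, _root_.sub_apply]
    rw [ManinPair.res_apply] at h2
    simp only at h2 h3
    rw [h2, h3]
    ring
  have h4 : (⟨_, h1⟩ : P.sub) = 0 := eq_zero_of_dual fun μ => by
    have h5 := j.splits μ ⟨_, h1⟩
    rw [← h5]
    have h6 := j.apply_star μ u
    rw [← j.splits] at h6
    simp only [map_sub]
    rw [j.isotropic, P.form_symm _ u, h6]
    ring
  have h7 : u - (j.star u : 𝔡) - j.toFun (P.res u) = 0 := congrArg Subtype.val h4
  rw [sub_sub, sub_eq_zero] at h7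
  exact h7.symm

theorem ManinPair.exists_form_eq (P : ManinPair 𝔡) (ℓ : 𝔡 →ₗ[ℝ] ℝ) : ∃ k, ∀ u, P.form k u = ℓ u := by
  let β : 𝔡 →ₗ[ℝ] Module.Dual ℝ 𝔡 := ContinuousLinearMap.coeLM ℝ ∘ₗ P.form.toLinearMap
  have hβ : Function.Injective β := (injective_iff_map_eq_zero β).2 fun a ha =>
    P.form_nondeg a fun b => congrArg (fun g : Module.Dual ℝ 𝔡 => g b) ha
  obtain ⟨a, ha⟩ := (LinearMap.injective_iff_surjective_of_finrank_eq_finrank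
    (Subspace.dual_finrank_eq (K := ℝ) (V := 𝔡)).symm).1 hβ ℓ
  exact ⟨a, fun b => congrArg (fun g : Module.Dual ℝ 𝔡 => g b) ha⟩

end SplittingAlgebra

/-! ### The isometry of 𝔡 with TS ⊕ T*S and the backward image of C_S -/

section Homogeneous

variable {𝔡 : Type*} [NormedAddCommGroup 𝔡] [NormedSpace ℝ 𝔡] [FiniteDimensional ℝ 𝔡]
  {P : ManinPair 𝔡}
  {ED : Type*} [NormedAddCommGroup ED] [NormedSpace ℝ ED] [FiniteDimensional ℝ ED]
  {ES : Type*} [NormedAddCommGroup ES] [NormedSpace ℝ ES] [FiniteDimensional ℝ ES]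
  {D : Type*} [TopologicalSpace D] [ChartedSpace ED D] [Group D] [LieGroup 𝓘(ℝ, ED) ∞ D]
  [ConnectedSpace D]
  {G : Subgroup D} [ChartedSpace ES (D ⧸ G)] [IsManifold 𝓘(ℝ, ES) ∞ (D ⧸ G)]
  {Q : GroupPair P ED ES G} (s : ConnectionSplitting Q) (j : IsotropicSplitting P)

/-- The vector k represents ξ ∘ ρ_S through the form. As ρ_S ∘ q = ρ_S, `form_projS_add` gives ⟨qk,
u⟩ = 0 for all u, so k lies in the kernel. -/
theorem exists_kappa (s : ConnectionSplitting Q) (y : D ⧸ G) (ξ : Cot ES y) :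
    ∃ k : 𝔡, Q.rhoS y k = 0 ∧ ∀ u, P.form k u = ξ (Q.rhoS y u) := by
  obtain ⟨k, hk⟩ := P.exists_form_eq (ξ.toLinearMap ∘ₗ (Q.rhoS y).toLinearMap)
  have hk' : ∀ u, P.form k u = ξ (Q.rhoS y u) := hk
  refine ⟨k, ?_, hk'⟩
  have h0 : projS s y k = 0 := P.form_nondeg _ fun u => by
    have h := form_projS_add s y k u
    rw [hk', hk', rhoS_projS] at h
    linarith
  rw [← rhoS_projS s, h0, map_zero]

theorem sigmaBar_eq {y : D ⧸ G} {ξ : Cot ES y} {k : 𝔡} (hk : ∀ u, P.form k u = ξ (Q.rhoS y u)) :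
    sigmaBar Q j y ξ = j.star k := by
  rw [← sub_eq_zero]
  refine eq_zero_of_dual fun μ => ?_
  have h := Module.apply_evalEquiv_symm_apply (R := ℝ) (M := P.sub) μ
    (ξ.toLinearMap ∘ₗ (Q.rhoS y).toLinearMap ∘ₗ j.toFun)
  have h' : μ (sigmaBar Q j y ξ) = ξ (Q.rhoS y (j.toFun μ)) := h
  rw [map_sub, h', j.apply_star, hk, sub_self]

theorem apply_sigmaBar (y : D ⧸ G) (ξ : Cot ES y) (μ : Module.Dual ℝ P.sub) :
    μ (sigmaBar Q j y ξ) = ξ (Q.rhoS y (j.toFun μ)) :=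
  Module.apply_evalEquiv_symm_apply (R := ℝ) (M := P.sub) μ
    (ξ.toLinearMap ∘ₗ (Q.rhoS y).toLinearMap ∘ₗ j.toFun)

theorem star_apply (y : D ⧸ G) (u : 𝔡) (Y : Tan ES y) : s.star y u Y = P.form u (s.toFun y Y) := rfl

theorem bigPairing_toBig (y : D ⧸ G) (u v : 𝔡) :
    bigPairing (s.toBig y u) (s.toBig y v) = P.form u v := by
  change P.form v (projS s y u) + P.form u (projS s y v) = _
  rw [P.form_symm v, form_projS_add]

theorem toBig_surjective (y : D ⧸ G) : Function.Surjective (s.toBig y) := by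
  rintro ⟨Y, ξ⟩
  obtain ⟨k, hk, hk'⟩ := exists_kappa s y ξ
  refine ⟨s.toFun y Y + k, Prod.ext ?_ ?_⟩
  · change Q.rhoS y (s.toFun y Y + k) = Y
    rw [map_add, s.splits, hk, add_zero]
  · change s.star y (s.toFun y Y + k) = ξ
    ext Z
    rw [star_apply, map_add, _root_.add_apply, s.isotropic, hk', s.splits, zero_add]

/-- Through the isometry this is the equality of 𝔤 with its own orthogonal. -/
theorem mem_LS_of_orthogonal {y : D ⧸ G} {a : BigTan ES y}
    (h : ∀ v : P.sub, bigPairing a (s.toBig y v) = 0) : a ∈ s.LS y := by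
  obtain ⟨u, rfl⟩ := toBig_surjective s y a
  refine ⟨u, (P.lagrangian u).2 fun b hb => ?_, rfl⟩
  rw [← bigPairing_toBig s]
  exact h ⟨b, hb⟩

theorem phiS_cycle (y : D ⧸ G) (a b c : Tan ES y) : s.phiS y a b c = s.phiS y b c a := by
  have hs : ∀ a b : Tan ES y, extD s.toFun y a b = - extD s.toFun y b a := by
    intro a b
    have : ∀ (A : ES →L[ℝ] ES →L[ℝ] 𝔡) (a b : ES), (A - A.flip) a b = - (A - A.flip) b a := by
      intro A a b
      simp only [_root_.sub_apply, ContinuousLinearMap.flip_apply, neg_sub]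
    exact this _ a b
  have hφ : ∀ a b c, s.phiS y a b c = (1 / 2 : ℝ) * (P.form (extD s.toFun y a b) (s.toFun y c)
      + P.form (s.toFun y a) (extD s.toFun y b c) - P.form (s.toFun y b) (extD s.toFun y a c))
      + P.tri (s.toFun y a) (s.toFun y b) (s.toFun y c) := fun a b c => rfl
  rw [hφ, hφ, P.tri_cycle, hs c a, hs b a, map_neg, map_neg,
    P.form_symm (s.toFun y a), P.form_symm (s.toFun y b), P.form_symm (s.toFun y c)]
  ring

variable {E : Type*} [NormedAddCommGroup E] [NormedSpace ℝ E] [FiniteDimensional ℝ E]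
  {M : Type*} [TopologicalSpace M] [ChartedSpace E M] [IsManifold 𝓘(ℝ, E) ∞ M] {J : M → D ⧸ G}

theorem pullThree_cycle (x : M) (a b c : Tan E x) :
    pullThree J s.phiS x a b c = pullThree J s.phiS x b c a :=
  phiS_cycle s (J x) _ _ _

/-- The element `(X, J^* s^* u)` of `T_x M ⊕ T*_x M`. -/
abbrev liftBig (J : M → D ⧸ G) (x : M) (X : Tan E x) (u : 𝔡) : BigTan E x :=
  (X, cotmap E ES J x (s.star (J x) u))

/-- The isometry transported along J: pairings on M of vectors lying over 𝔡 are computed by the form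
of 𝔡. -/
theorem bigPairing_lift {x : M} {X Y : Tan E x} {u v : 𝔡}
    (hX : tmap E ES J x X = Q.rhoS (J x) u) (hY : tmap E ES J x Y = Q.rhoS (J x) v) :
    bigPairing (liftBig s J x X u) (liftBig s J x Y v) = P.form u v := by
  change P.form v (s.toFun (J x) (tmap E ES J x X)) + P.form u (s.toFun (J x) (tmap E ES J x Y)) = _
  rw [hX, hY]
  exact bigPairing_toBig s (J x) u v

theorem mem_backwardImage_CS {x : M} {a : BigTan E x} :
    a ∈ backwardImage J (s.CS j) x ↔ ∃ μ : Module.Dual ℝ P.sub,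
      tmap E ES J x a.1 = Q.rhoS (J x) (j.toFun μ) ∧
        a.2 = cotmap E ES J x (s.star (J x) (j.toFun μ)) := by
  constructor
  · rintro ⟨⟨X, ξ⟩, ⟨u, ⟨μ, rfl⟩, h⟩, rfl⟩
    refine ⟨μ, (congrArg Prod.fst h).symm, ?_⟩
    exact congrArg (cotmap E ES J x) (congrArg Prod.snd h).symm
  · rintro ⟨μ, h1, h2⟩
    refine ⟨(a.1, s.star (J x) (j.toFun μ)), ⟨j.toFun μ, ⟨μ, rfl⟩, Prod.ext h1.symm rfl⟩, ?_⟩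
    exact Prod.ext rfl h2.symm

theorem isIsotropic_backwardImage_CS (x : M) :
    IsIsotropic (backwardImage (E := E) J (s.CS j) x) := by
  intro a ha b hb
  obtain ⟨μ, h1, h2⟩ := (mem_backwardImage_CS s j).1 ha
  obtain ⟨ν, h3, h4⟩ := (mem_backwardImage_CS s j).1 hb
  have h := bigPairing_lift s h1 h3
  rw [j.isotropic] at h
  rw [← h]
  exact congrArg₂ bigPairing (Prod.ext rfl h2) (Prod.ext rfl h4)

/-- Correcting a tangent vector by the action produces elements of the backward image of `C_S`. -/
theorem mem_backwardImage_of_act {x : M} {ρ : P.sub → Tan E x}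
    (hρ : ∀ v, tmap E ES J x (ρ v) = Q.rhoS (J x) v) (X : Tan E x) (μ : Module.Dual ℝ P.sub) :
    liftBig s J x (X - ρ (j.star (pullS s J x X - projS s (J x) (j.toFun μ))))
        (j.toFun μ - (j.star (pullS s J x X - projS s (J x) (j.toFun μ)) : 𝔡))
      ∈ backwardImage J (s.CS j) x := by
  set z := pullS s J x X - projS s (J x) (j.toFun μ) with hz
  -- The vector z = s(dJ X - ρ_S(jμ)) measures how far X is from lying over jμ. Its 𝔤-component is
  -- removed by the action and its component in j(𝔤^*) is absorbed into μ.
  have hdec : (j.star z : 𝔡) = z - j.toFun (P.res z) := eq_sub_of_add_eq (j.star_add_res z)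
  refine (mem_backwardImage_CS s j).2 ⟨μ + P.res z, ?_, ?_⟩
  · have h1 : tmap E ES J x X = Q.rhoS (J x) (z + j.toFun μ) := by
      rw [map_add, hz, map_sub, rhoS_projS, pullS_apply, s.splits, sub_add_cancel]
    change tmap E ES J x (X - ρ (j.star z)) = _
    rw [map_sub, hρ, h1, ← map_sub]
    congr 1
    rw [map_add, hdec]
    abel
  · change cotmap E ES J x (s.star (J x) (j.toFun μ - (j.star z : 𝔡))) = _
    congr 1
    -- Since z lies in the isotropic image of s, s^*z = 0, so the change of coefficient does not
    -- affect the covector.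
    have h2 : j.toFun μ - (j.star z : 𝔡) = j.toFun (μ + P.res z) - z := by
      rw [map_add, hdec]
      abel
    rw [h2, map_sub, sub_eq_self]
    ext Y
    rw [star_apply, hz, map_sub, _root_.sub_apply, pullS_apply, projS_apply, s.isotropic,
      s.isotropic, sub_zero]
    rfl

end Homogeneous

/-! ### The generators of L and their Courant brackets -/

section DiracOf

variable {𝔡 : Type*} [NormedAddCommGroup 𝔡] [NormedSpace ℝ 𝔡] [FiniteDimensional ℝ 𝔡]
  {P : ManinPair 𝔡}
  {ED : Type*} [NormedAddCommGroup ED] [NormedSpace ℝ ED] [FiniteDimensional ℝ ED]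
  {ES : Type*} [NormedAddCommGroup ES] [NormedSpace ℝ ES] [FiniteDimensional ℝ ES]
  {D : Type*} [TopologicalSpace D] [ChartedSpace ED D] [Group D] [LieGroup 𝓘(ℝ, ED) ∞ D]
  [ConnectedSpace D]
  {G : Subgroup D} [ChartedSpace ES (D ⧸ G)] [IsManifold 𝓘(ℝ, ES) ∞ (D ⧸ G)]
  {Q : GroupPair P ED ES G} (s : ConnectionSplitting Q) (j : IsotropicSplitting P)
  {E : Type*} [NormedAddCommGroup E] [NormedSpace ℝ E] [FiniteDimensional ℝ E]
  {M : Type*} [TopologicalSpace M] [ChartedSpace E M] [IsManifold 𝓘(ℝ, E) ∞ M] {J : M → D ⧸ G}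
  {biv : ∀ x : M, Cot E x →L[ℝ] Tan E x} {ρ : P.sub →ₗ[ℝ] ∀ x : M, Tan E x}

theorem dualAct_apply (x : M) (α : Cot E x) (v : P.sub) : dualAct ρ x α v = α (ρ v x) := rfl

/-- The vector part `v - j(ρ_M^* α)` of the generators of `L`. -/
def genCoeff (ρ : P.sub →ₗ[ℝ] ∀ x : M, Tan E x) (x : M) (v : P.sub) (α : Cot E x) : 𝔡 :=
  (v : 𝔡) - j.toFun (dualAct ρ x α)

/-- The generators `ρ̂_M(v) + h(α)` of `L`. -/
def gen (J : M → D ⧸ G) (biv : ∀ x : M, Cot E x →L[ℝ] Tan E x) (ρ : P.sub →ₗ[ℝ] ∀ x : M, Tan E x)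
    (x : M) (v : P.sub) (α : Cot E x) : BigTan E x :=
  (ρ v x + biv x α, cotmap E ES J x (s.star (J x) (genCoeff j ρ x v α)) + α)

theorem rhoHat_add_hMap (x : M) (v : P.sub) (α : Cot E x) :
    rhoHat s J ρ x v + hMap s j J biv ρ x α = gen s j J biv ρ x v α := by
  refine Prod.ext rfl ?_
  change cotmap E ES J x (s.star (J x) v) + (α - α.comp (Tmap s j J ρ x))
    = cotmap E ES J x (s.star (J x) (genCoeff j ρ x v α)) + α
  -- As j^* is adjoint to j, T^*α = J^*s^*(jρ_M^*α). This puts the generators in the form required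
  -- by `bigPairing_courant_lift`.
  have h : α.comp (Tmap s j J ρ x) = cotmap E ES J x (s.star (J x) (j.toFun (dualAct ρ x α))) := by
    ext X
    change dualAct ρ x α (j.star (pullS s J x X)) = P.form (j.toFun (dualAct ρ x α)) (pullS s J x X)
    rw [j.apply_star, P.form_symm]
  rw [h, genCoeff, map_sub, map_sub]
  abel

theorem mem_diracOf {x : M} {a : BigTan E x} :
    a ∈ diracOf s j J biv ρ x ↔ ∃ v α, gen s j J biv ρ x v α = a := by
  constructor
  · rintro ⟨⟨v, α⟩, rfl⟩
    exact ⟨v, α, (rhoHat_add_hMap s j x v α).symm⟩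
  · rintro ⟨v, α, rfl⟩
    exact ⟨(v, α), rhoHat_add_hMap s j x v α⟩

theorem gen_zero (x : M) (v : P.sub) :
    gen s j J biv ρ x v 0 = (ρ v x, cotmap E ES J x (s.star (J x) v)) := by
  have h : dualAct ρ x (0 : Cot E x) = 0 := rfl
  refine Prod.ext ?_ ?_
  · change ρ v x + biv x 0 = ρ v x
    rw [map_zero, add_zero]
  · change cotmap E ES J x (s.star (J x) (genCoeff j ρ x v 0)) + 0 = _
    rw [genCoeff, h, map_zero, sub_zero, add_zero]

theorem rhoHat_mem_diracOf (x : M) (v : P.sub) :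
    (ρ v x, cotmap E ES J x (s.star (J x) v)) ∈ diracOf s j J biv ρ x :=
  (mem_diracOf s j).2 ⟨v, 0, gen_zero s j x v⟩

/-- This is the transpose of the moment condition π^♯J^* = ρ_M σ̄; the sign comes from the skewness
of π. -/
theorem tmap_biv (hskew : ∀ (x : M) (α β : Cot E x), β (biv x α) = - α (biv x β))
    (hm : ∀ (x : M) (ξ : Cot ES (J x)), biv x (cotmap E ES J x ξ) = ρ (sigmaBar Q j (J x) ξ) x)
    (x : M) (α : Cot E x) :
    tmap E ES J x (biv x α) = - Q.rhoS (J x) (j.toFun (dualAct ρ x α)) := by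
  rw [← sub_eq_zero]
  refine eq_zero_of_cot fun ξ => ?_
  have h1 := hskew x α (cotmap E ES J x ξ)
  rw [hm, ← dualAct_apply, apply_sigmaBar] at h1
  have h2 : ξ (tmap E ES J x (biv x α)) = - ξ (Q.rhoS (J x) (j.toFun (dualAct ρ x α))) := h1
  rw [map_sub, map_neg, h2, sub_self]

theorem tmap_gen (hρ : ∀ (x : M) (v : P.sub), tmap E ES J x (ρ v x) = Q.rhoS (J x) v)
    (hbiv : ∀ (x : M) (α : Cot E x),
      tmap E ES J x (biv x α) = - Q.rhoS (J x) (j.toFun (dualAct ρ x α)))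
    (x : M) (v : P.sub) (α : Cot E x) :
    tmap E ES J x (ρ v x + biv x α) = Q.rhoS (J x) (genCoeff j ρ x v α) := by
  rw [map_add, hρ, hbiv, genCoeff, map_sub, sub_eq_add_neg]

theorem isIsotropic_diracOf (hskew : ∀ (x : M) (α β : Cot E x), β (biv x α) = - α (biv x β))
    (hρ : ∀ (x : M) (v : P.sub), tmap E ES J x (ρ v x) = Q.rhoS (J x) v)
    (hbiv : ∀ (x : M) (α : Cot E x),
      tmap E ES J x (biv x α) = - Q.rhoS (J x) (j.toFun (dualAct ρ x α))) (x : M) :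
    IsIsotropic (diracOf s j J biv ρ x) := by
  intro a ha b hb
  obtain ⟨v, α, rfl⟩ := (mem_diracOf s j).1 ha
  obtain ⟨w, β, rfl⟩ := (mem_diracOf s j).1 hb
  have h1 := bigPairing_lift s (tmap_gen j hρ hbiv x v α) (tmap_gen j hρ hbiv x w β)
  -- Both 𝔤 and j(𝔤^*) are isotropic, so only the mixed terms remain; they cancel the pairings of α
  -- and β with the action vectors, and the π-terms cancel by skewness.
  have h2 : P.form (genCoeff j ρ x v α) (genCoeff j ρ x w β)
      = - β (ρ v x) - α (ρ w x) := by
    have e1 := j.splits (dualAct ρ x α) w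
    have e2 := j.splits (dualAct ρ x β) v
    rw [P.form_symm] at e2
    simp only [genCoeff, map_sub, _root_.sub_apply]
    rw [e1, e2, P.form_sub, j.isotropic, dualAct_apply, dualAct_apply]
    ring
  have h3 := hskew x α β
  rw [h2] at h1
  have e : bigPairing (gen s j J biv ρ x v α) (gen s j J biv ρ x w β)
      = bigPairing (liftBig s J x (ρ v x + biv x α) (genCoeff j ρ x v α))
          (liftBig s J x (ρ w x + biv x β) (genCoeff j ρ x w β))
        + (β (ρ v x + biv x α) + α (ρ w x + biv x β)) := by
    simp only [bigPairing, gen, _root_.add_apply]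
    ring
  rw [e, h1, map_add, map_add]
  linarith

/-- This is the correction by the action with μ = 0: (X, 0) = ρ̂_M(w) + c, where w = j^*s(dJ X) and
c is in the backward image of C_S. -/
theorem vec_mem_sup {x : M} {L : Submodule ℝ (BigTan E x)}
    (hρ : ∀ (x : M) (v : P.sub), tmap E ES J x (ρ v x) = Q.rhoS (J x) v)
    (hL : ∀ v, (ρ v x, cotmap E ES J x (s.star (J x) v)) ∈ L) (X : Tan E x) :
    ((X, 0) : BigTan E x) ∈ L ⊔ backwardImage J (s.CS j) x := by
  have h := mem_backwardImage_of_act s j (hρ x) X 0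
  set w := j.star (pullS s J x X - projS s (J x) (j.toFun 0))
  refine Submodule.mem_sup.2 ⟨_, hL w, _, h, Prod.ext ?_ ?_⟩
  · change ρ w x + (X - ρ w x) = X
    abel
  · change cotmap E ES J x (s.star (J x) w) + cotmap E ES J x (s.star (J x) (j.toFun 0 - (w : 𝔡))) = 0
    rw [map_zero, zero_sub, map_neg, map_neg, add_neg_cancel]

theorem diracOf_sup_eq_top
    (hρ : ∀ (x : M) (v : P.sub), tmap E ES J x (ρ v x) = Q.rhoS (J x) v)
    (hbiv : ∀ (x : M) (α : Cot E x),
      tmap E ES J x (biv x α) = - Q.rhoS (J x) (j.toFun (dualAct ρ x α))) (x : M) :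
    diracOf s j J biv ρ x ⊔ backwardImage J (s.CS j) x = ⊤ := by
  refine (Submodule.eq_top_iff').2 fun a => ?_
  have h2 : ((0, a.2) : BigTan E x) ∈ diracOf s j J biv ρ x ⊔ backwardImage J (s.CS j) x := by
    -- The element (0, α) is h(α) plus this vector, which lies over j(ρ_M^*α) because dJ π^♯α =
    -- -ρ_S(jρ_M^*α).
    have hc : ((- biv x a.2, cotmap E ES J x (s.star (J x) (j.toFun (dualAct ρ x a.2)))) :
        BigTan E x) ∈ backwardImage J (s.CS j) x :=
      (mem_backwardImage_CS s j).2 ⟨dualAct ρ x a.2, by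
        change tmap E ES J x (- biv x a.2) = _
        rw [map_neg, hbiv, neg_neg], rfl⟩
    refine Submodule.mem_sup.2 ⟨_, (mem_diracOf s j).2 ⟨0, a.2, rfl⟩, _, hc, Prod.ext ?_ ?_⟩
    · change ρ 0 x + biv x a.2 + - biv x a.2 = 0
      rw [map_zero]
      change 0 + _ + _ = (0 : Tan E x)
      abel
    · change cotmap E ES J x (s.star (J x) (genCoeff j ρ x 0 a.2)) + a.2
        + cotmap E ES J x (s.star (J x) (j.toFun (dualAct ρ x a.2))) = a.2
      rw [genCoeff, ZeroMemClass.coe_zero, zero_sub, map_neg, map_neg]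
      abel
  have h1 := vec_mem_sup s j hρ (rhoHat_mem_diracOf s j (biv := biv) x) a.1
  have h3 := Submodule.add_mem _ h1 h2
  rwa [Prod.mk_add_mk, add_zero, zero_add] at h3

/-! ### Courant brackets of the generators -/

theorem smoothVFAt_act (hρ : ∀ v x, SmoothVFAt (ρ v) x) {w : M → P.sub} {x : M}
    (hw : SmoothAt E w x) : SmoothVFAt (fun y => ρ (w y) y) x := by
  let b := Module.finBasis ℝ P.sub
  have h : SmoothVFAt (fun y => ∑ i, (b.coord i (w y)) • ρ (b i) y) x := by
    refine SmoothVFAt.sum fun i _ => SmoothVFAt.smul ?_ (hρ _ x)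
    exact (LinearMap.toContinuousLinearMap (b.coord i)).contMDiff.contMDiffAt.comp x hw
  refine h.congr (Filter.Eventually.of_forall fun y => ?_)
  have h1 : ρ (w y) = ∑ i, (b.coord i (w y)) • ρ (b i) := by
    conv_lhs => rw [← b.sum_repr (w y), map_sum]
    simp only [map_smul, Module.Basis.coord_apply]
  rw [h1, Finset.sum_apply]
  rfl

theorem smoothAt_j_dualAct (hρ : ∀ v x, SmoothVFAt (ρ v) x) {α : ∀ x : M, Cot E x} {x : M}
    (hα : SmoothFormAt α x) : SmoothAt E (fun y => j.toFun (dualAct ρ y (α y))) x := by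
  let b := Module.finBasis ℝ P.sub
  have h : SmoothAt E (fun y => ∑ i, α y (ρ (b i) y) • j.toFun (b.coord i)) x := by
    refine contMDiffAt_finsetSum fun i _ => ?_
    have h1 : SmoothAt E (fun y => α y (ρ (b i) y)) x := hα.apply (hρ _ x)
    exact h1.smul contMDiffAt_const
  refine h.congr_of_eventuallyEq (Filter.Eventually.of_forall fun y => ?_)
  have h1 : dualAct ρ y (α y) = ∑ i, α y (ρ (b i) y) • b.coord i := by
    refine b.ext fun k => ?_
    simp [dualAct_apply, Finsupp.single_apply]
  simp only [h1, map_sum, map_smul]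

theorem smoothAt_genCoeff (hρ : ∀ v x, SmoothVFAt (ρ v) x) {f : M → ℝ} {x : M}
    (hf : SmoothAt E f x) (v : P.sub) :
    SmoothAt E (fun y => genCoeff j ρ y v (dvec (E := E) f y)) x :=
  contMDiffAt_const.sub (smoothAt_j_dualAct j hρ (smoothFormAt_dvec hf))

/-- The coefficient v - j(ρ_M^*df) varies only inside the isotropic subspace j(𝔤^*), so its
derivative sees only the 𝔤-part v' of the other coefficient. -/
theorem form_dvec_genCoeff (hρ : ∀ v x, SmoothVFAt (ρ v) x) {f : M → ℝ} {x : M}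
    (hf : SmoothAt E f x) (v v' : P.sub) (β : Cot E x) (w : Tan E x) :
    P.form (dvec (E := E) (fun y => genCoeff j ρ y v (dvec (E := E) f y)) x w)
        (genCoeff j ρ x v' β)
      = - dvec (E := E) (fun y => dvec (E := E) f y (ρ v' y)) x w := by
  have hU := smoothAt_genCoeff j hρ hf v
  have h : ∀ u : 𝔡, P.form (dvec (E := E) (fun y => genCoeff j ρ y v (dvec (E := E) f y)) x w) u
      = dvec (E := E) (fun y => P.form (genCoeff j ρ y v (dvec (E := E) f y)) u) x w :=
    fun u => (dvec_clm (E := E) (P.form.flip u) hU.mdiff w).symm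
  have h1 : (fun y => P.form (genCoeff j ρ y v (dvec (E := E) f y)) (v' : 𝔡))
      = fun y => - dvec (E := E) f y (ρ v' y) := by
    funext y
    rw [genCoeff, map_sub, _root_.sub_apply, P.form_sub, j.splits, dualAct_apply, zero_sub]
  have h2 : (fun y => P.form (genCoeff j ρ y v (dvec (E := E) f y)) (j.toFun (dualAct ρ x β)))
      = fun _ => P.form v (j.toFun (dualAct ρ x β)) := by
    funext y
    rw [genCoeff, map_sub, _root_.sub_apply, j.isotropic, sub_zero]
  have e : ∀ a : 𝔡, P.form a (genCoeff j ρ x v' β)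
      = P.form a v' - P.form a (j.toFun (dualAct ρ x β)) := fun a => by rw [genCoeff, map_sub]
  rw [e, h, h, h1, h2, dvec_const, dvec_neg, zero_apply, sub_zero, neg_apply]

theorem smoothBigOn_gen (hJ : ContMDiff 𝓘(ℝ, E) 𝓘(ℝ, ES) ∞ J) (hρ : ∀ v x, SmoothVFAt (ρ v) x)
    (hb : ∀ x, SmoothBivAt biv x) {f : M → ℝ} (hf : ContMDiff 𝓘(ℝ, E) 𝓘(ℝ, ℝ) ∞ f) (v : P.sub) :
    SmoothBigOn (fun y => gen s j J biv ρ y v (dvec (E := E) f y)) univ := by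
  refine ⟨smoothVFOn_univ.2 fun x => ?_, smoothFormOn_univ.2 fun x => ?_⟩
  · exact (hρ v x).add ((hb x).apply (smoothFormAt_dvec hf.contMDiffAt))
  · refine SmoothFormAt.add ?_ (smoothFormAt_dvec hf.contMDiffAt)
    exact smoothFormAt_of_apply fun X hX =>
      smoothAt_bilin P.form (smoothAt_genCoeff j hρ hf.contMDiffAt v)
        ((smoothFormAt_pullS s hJ x).apply hX)

/-- Expand trilinearly along 𝔤 ⊕ j(𝔤^*). Three entries from 𝔤 give 0, two give the action of a
bracket, one gives the cobracket, none gives χ. -/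
theorem tri_genCoeff (x : M) (v₁ v₂ v₃ : P.sub) (α₁ α₂ α₃ : Cot E x) :
    P.tri (genCoeff j ρ x v₁ α₁) (genCoeff j ρ x v₂ α₂) (genCoeff j ρ x v₃ α₃)
      = - α₃ (ρ (P.subBracket v₁ v₂) x) - α₂ (ρ (P.subBracket v₃ v₁) x)
        - α₁ (ρ (P.subBracket v₂ v₃) x)
        + j.cobracket v₁ (dualAct ρ x α₂) (dualAct ρ x α₃)
        + j.cobracket v₂ (dualAct ρ x α₃) (dualAct ρ x α₁)
        + j.cobracket v₃ (dualAct ρ x α₁) (dualAct ρ x α₂)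
        - j.chi (dualAct ρ x α₁) (dualAct ρ x α₂) (dualAct ρ x α₃) := by
  have hv : ∀ a b c : P.sub, P.tri (a : 𝔡) b c = 0 := fun a b c => P.form_sub (P.subBracket a b) c
  have hm : ∀ (a b : P.sub) (α : Cot E x), P.tri (a : 𝔡) b (j.toFun (dualAct ρ x α))
      = α (ρ (P.subBracket a b) x) := fun a b α => by
    rw [← dualAct_apply, ← j.splits, P.form_symm]
    rfl
  have hc : ∀ (a : P.sub) (μ ν : Module.Dual ℝ P.sub),
      P.tri (j.toFun μ) (j.toFun ν) (a : 𝔡) = j.cobracket a μ ν := fun a μ ν => by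
    rw [ManinPair.tri, P.form_symm]
    rfl
  have sl : ∀ a a' b c : 𝔡, P.tri (a - a') b c = P.tri a b c - P.tri a' b c := fun a a' b c => by
    simp only [ManinPair.tri, map_sub, _root_.sub_apply]
  have sm : ∀ a b b' c : 𝔡, P.tri a (b - b') c = P.tri a b c - P.tri a b' c := fun a b b' c => by
    simp only [ManinPair.tri, map_sub, _root_.sub_apply]
  have sr : ∀ a b c c' : 𝔡, P.tri a b (c - c') = P.tri a b c - P.tri a b c' := fun a b c c' => by
    simp only [ManinPair.tri, map_sub]
  simp only [genCoeff, sl, sm, sr]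
  rw [hv, hm, ← P.tri_cycle (v₃ : 𝔡) v₁, hm, P.tri_cycle _ (v₂ : 𝔡) (v₃ : 𝔡), hm,
    P.tri_cycle (v₁ : 𝔡), hc, ← P.tri_cycle _ _ (v₂ : 𝔡), hc, hc]
  simp only [IsotropicSplitting.chi, ManinPair.tri]
  ring

/-- The Courant brackets of the generators measure the failure of the axioms of a quasi-Poisson
space. -/
theorem bigPairing_courant_gen (hJ : ContMDiff 𝓘(ℝ, E) 𝓘(ℝ, ES) ∞ J)
    (hskew : ∀ (x : M) (α β : Cot E x), β (biv x α) = - α (biv x β))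
    (hρJ : ∀ (x : M) (v : P.sub), tmap E ES J x (ρ v x) = Q.rhoS (J x) v)
    (hbiv : ∀ (x : M) (α : Cot E x),
      tmap E ES J x (biv x α) = - Q.rhoS (J x) (j.toFun (dualAct ρ x α)))
    (hρ : ∀ v x, SmoothVFAt (ρ v) x) (hb : ∀ x, SmoothBivAt biv x)
    (v₁ v₂ v₃ : P.sub) {f₁ f₂ f₃ : M → ℝ} {x : M} (hf₁ : ContMDiff 𝓘(ℝ, E) 𝓘(ℝ, ℝ) ∞ f₁)
    (hf₂ : ContMDiff 𝓘(ℝ, E) 𝓘(ℝ, ℝ) ∞ f₂) (hf₃ : ContMDiff 𝓘(ℝ, E) 𝓘(ℝ, ℝ) ∞ f₃) :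
    bigPairing (courant (pullThree J s.phiS) (fun y => gen s j J biv ρ y v₁ (dvec (E := E) f₁ y))
        (fun y => gen s j J biv ρ y v₂ (dvec (E := E) f₂ y)) x)
        (gen s j J biv ρ x v₃ (dvec (E := E) f₃ x)) =
      (dvec (E := E) f₃ x (mlieBracket 𝓘(ℝ, E) (ρ v₁) (ρ v₂) x)
        - dvec (E := E) f₃ x (ρ (P.subBracket v₁ v₂) x))
      + (dvec (E := E) f₂ x (mlieBracket 𝓘(ℝ, E) (ρ v₃) (ρ v₁) x)
        - dvec (E := E) f₂ x (ρ (P.subBracket v₃ v₁) x))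
      + (dvec (E := E) f₁ x (mlieBracket 𝓘(ℝ, E) (ρ v₂) (ρ v₃) x)
        - dvec (E := E) f₁ x (ρ (P.subBracket v₂ v₃) x))
      + (lieBiv (ρ v₁) biv f₂ f₃ x
        + j.cobracket v₁ (dualAct ρ x (dfun f₂ x)) (dualAct ρ x (dfun f₃ x)))
      + (lieBiv (ρ v₂) biv f₃ f₁ x
        + j.cobracket v₂ (dualAct ρ x (dfun f₃ x)) (dualAct ρ x (dfun f₁ x)))
      + (lieBiv (ρ v₃) biv f₁ f₂ x
        + j.cobracket v₃ (dualAct ρ x (dfun f₁ x)) (dualAct ρ x (dfun f₂ x)))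
      + ((1 / 2 : ℝ) * schoutenSelf biv f₁ f₂ f₃ x
        - j.chi (dualAct ρ x (dfun f₁ x)) (dualAct ρ x (dfun f₂ x)) (dualAct ρ x (dfun f₃ x))) := by
  have : CompleteSpace E := FiniteDimensional.complete ℝ E
  have hX : ∀ (v : P.sub) {f : M → ℝ}, ContMDiff 𝓘(ℝ, E) 𝓘(ℝ, ℝ) ∞ f →
      SmoothVFAt (fun y => ρ v y + biv y (dvec (E := E) f y)) x := fun v f hf =>
    (hρ v x).add ((hb x).apply (smoothFormAt_dvec hf.contMDiffAt))
  have hlift := bigPairing_courant_lift s hJ (hX v₁ hf₁) (hX v₂ hf₂) (hX v₃ hf₃)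
    (smoothAt_genCoeff j hρ hf₁.contMDiffAt v₁) (smoothAt_genCoeff j hρ hf₂.contMDiffAt v₂)
    (smoothAt_genCoeff j hρ hf₃.contMDiffAt v₃) hf₁.contMDiffAt hf₂.contMDiffAt (f₃ := f₃)
    (fun y => tmap_gen j hρJ hbiv y v₁ _) (fun y => tmap_gen j hρJ hbiv y v₂ _)
    (fun y => tmap_gen j hρJ hbiv y v₃ _)
  refine hlift.trans ?_
  rw [tri_genCoeff, form_dvec_genCoeff j hρ hf₂.contMDiffAt, form_dvec_genCoeff j hρ hf₁.contMDiffAt,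
    form_dvec_genCoeff j hρ hf₁.contMDiffAt, dvec_mlieBracket hf₃.contMDiffAt (hX v₁ hf₁) (hX v₂ hf₂),
    dvec_mlieBracket hf₃.contMDiffAt (hρ v₁ x) (hρ v₂ x),
    dvec_mlieBracket hf₂.contMDiffAt (hρ v₃ x) (hρ v₁ x),
    dvec_mlieBracket hf₁.contMDiffAt (hρ v₂ x) (hρ v₃ x)]
  have hR : ∀ (v : P.sub) {f : M → ℝ}, ContMDiff 𝓘(ℝ, E) 𝓘(ℝ, ℝ) ∞ f →
      SmoothAt E (fun y => dvec (E := E) f y (ρ v y)) x := fun v f hf =>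
    (smoothFormAt_dvec hf.contMDiffAt).apply (hρ v x)
  have hP : ∀ {f g : M → ℝ}, ContMDiff 𝓘(ℝ, E) 𝓘(ℝ, ℝ) ∞ f → ContMDiff 𝓘(ℝ, E) 𝓘(ℝ, ℝ) ∞ g →
      SmoothAt E (bivBracket (E := E) biv f g) x := fun {f g} hf hg =>
    (smoothFormAt_dvec hg.contMDiffAt).apply ((hb x).apply (smoothFormAt_dvec hf.contMDiffAt))
  have hsplit : ∀ (v : P.sub) {f g : M → ℝ}, ContMDiff 𝓘(ℝ, E) 𝓘(ℝ, ℝ) ∞ f →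
      ContMDiff 𝓘(ℝ, E) 𝓘(ℝ, ℝ) ∞ g →
      dvec (E := E) (fun y => dvec (E := E) g y (ρ v y + biv y (dvec (E := E) f y))) x
        = dvec (E := E) (fun y => dvec (E := E) g y (ρ v y)) x
          + dvec (E := E) (bivBracket (E := E) biv f g) x := by
    intro v f g hf hg
    rw [← dvec_add (hR v hg).mdiff (hP hf hg).mdiff]
    congr 1
    funext y
    rw [map_add]
    rfl
  have hneg : bivBracket (E := E) biv f₁ f₃ = fun y => - bivBracket (E := E) biv f₃ f₁ y := by
    funext y
    exact hskew y _ _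
  -- Skewness takes the function ρ(v)f out of the first slot of π, so that the Lie derivative
  -- consists of the same iterated derivatives as the expanded brackets.
  have hl : ∀ (v : P.sub) (f g : M → ℝ), lieBiv (ρ v) biv f g x
      = dvec (E := E) (bivBracket (E := E) biv f g) x (ρ v x)
        + dvec (E := E) (fun y => dvec (E := E) f y (ρ v y)) x (biv x (dvec (E := E) g x))
        - dvec (E := E) (fun y => dvec (E := E) g y (ρ v y)) x (biv x (dvec (E := E) f x)) := by
    intro v f g
    have h1 := hskew x (dvec (E := E) (fun y => dvec (E := E) f y (ρ v y)) x) (dvec (E := E) g x)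
    change dvec (E := E) (bivBracket (E := E) biv f g) x (ρ v x)
      - dvec (E := E) g x (biv x (dvec (E := E) (fun y => dvec (E := E) f y (ρ v y)) x)) - _ = _
    rw [h1, sub_neg_eq_add]
    rfl
  have hs : schoutenSelf biv f₁ f₂ f₃ x
      = 2 * (dvec (E := E) (bivBracket (E := E) biv f₂ f₃) x (biv x (dvec (E := E) f₁ x))
        + dvec (E := E) (bivBracket (E := E) biv f₃ f₁) x (biv x (dvec (E := E) f₂ x))
        + dvec (E := E) (bivBracket (E := E) biv f₁ f₂) x (biv x (dvec (E := E) f₃ x))) := rfl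
  rw [hl, hl, hl, hs, hsplit v₂ hf₂ hf₃, hsplit v₁ hf₁ hf₃, hsplit v₁ hf₁ hf₂, hneg, dvec_neg]
  simp only [map_add, _root_.add_apply, neg_apply, dfun_eq_dvec]
  ring

end DiracOf

/-! ### From Hamiltonian quasi-Poisson spaces to strong Dirac maps -/

section ToDirac

variable {𝔡 : Type*} [NormedAddCommGroup 𝔡] [NormedSpace ℝ 𝔡] [FiniteDimensional ℝ 𝔡]
  {P : ManinPair 𝔡}
  {ED : Type*} [NormedAddCommGroup ED] [NormedSpace ℝ ED] [FiniteDimensional ℝ ED]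
  {ES : Type*} [NormedAddCommGroup ES] [NormedSpace ℝ ES] [FiniteDimensional ℝ ES]
  {D : Type*} [TopologicalSpace D] [ChartedSpace ED D] [Group D] [LieGroup 𝓘(ℝ, ED) ∞ D]
  [ConnectedSpace D]
  {G : Subgroup D} [ChartedSpace ES (D ⧸ G)] [IsManifold 𝓘(ℝ, ES) ∞ (D ⧸ G)]
  {Q : GroupPair P ED ES G} (s : ConnectionSplitting Q) (j : IsotropicSplitting P)
  {E : Type*} [NormedAddCommGroup E] [NormedSpace ℝ E] [FiniteDimensional ℝ E]
  {M : Type*} [TopologicalSpace M] [ChartedSpace E M] [IsManifold 𝓘(ℝ, E) ∞ M] {J : M → D ⧸ G}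
  {biv : ∀ x : M, Cot E x →L[ℝ] Tan E x} {ρ : P.sub →ₗ[ℝ] ∀ x : M, Tan E x}

theorem IsHamiltonianQP.skew (h : IsHamiltonianQP Q j J biv ρ) (x : M) (α β : Cot E x) :
    β (biv x α) = - α (biv x β) := h.quasiPoisson.bivector.skew x α β

theorem IsHamiltonianQP.tmap_biv (h : IsHamiltonianQP Q j J biv ρ) (x : M) (α : Cot E x) :
    tmap E ES J x (biv x α) = - Q.rhoS (J x) (j.toFun (dualAct ρ x α)) :=
  QPDirac.tmap_biv j h.quasiPoisson.bivector.skew h.moment x α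

theorem IsHamiltonianQP.smooth_act (h : IsHamiltonianQP Q j J biv ρ) (v : P.sub) (x : M) :
    SmoothVFAt (ρ v) x := smoothVFOn_univ.1 (h.quasiPoisson.action.smooth v) x

theorem IsHamiltonianQP.smooth_biv (h : IsHamiltonianQP Q j J biv ρ) (x : M) :
    SmoothBivAt biv x := isBivector_smooth_iff.1 h.quasiPoisson.bivector.smooth x

theorem IsHamiltonianQP.isIsotropic (h : IsHamiltonianQP Q j J biv ρ) (x : M) :
    IsIsotropic (diracOf s j J biv ρ x) :=
  isIsotropic_diracOf s j h.quasiPoisson.bivector.skew h.equivariant (h.tmap_biv j) x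

theorem IsHamiltonianQP.sup_eq_top (h : IsHamiltonianQP Q j J biv ρ) (x : M) :
    diracOf s j J biv ρ x ⊔ backwardImage J (s.CS j) x = ⊤ :=
  diracOf_sup_eq_top s j h.equivariant (h.tmap_biv j) x

variable [T2Space M]

theorem IsHamiltonianQP.isAlmostDirac (hJ : ContMDiff 𝓘(ℝ, E) 𝓘(ℝ, ES) ∞ J)
    (h : IsHamiltonianQP Q j J biv ρ) : IsAlmostDirac (diracOf s j J biv ρ) where
  lagrangian x := lagrangian_of_isotropic (h.isIsotropic s j x)
    (isIsotropic_backwardImage_CS s j x) (h.sup_eq_top s j x)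
  smooth x a ha := by
    obtain ⟨v, α, rfl⟩ := (mem_diracOf s j).1 ha
    obtain ⟨f, hf, rfl⟩ := exists_smooth_dvec_eq x α
    exact ⟨univ, isOpen_univ, mem_univ x, _,
      smoothBigOn_gen s j hJ (h.smooth_act j) (h.smooth_biv j) hf v,
      fun y _ => (mem_diracOf s j).2 ⟨v, _, rfl⟩, rfl⟩

theorem IsHamiltonianQP.isDirac (hJ : ContMDiff 𝓘(ℝ, E) 𝓘(ℝ, ES) ∞ J)
    (h : IsHamiltonianQP Q j J biv ρ) : IsDirac (pullThree J s.phiS) (diracOf s j J biv ρ) where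
  toIsAlmostDirac := h.isAlmostDirac s j hJ
  integrable e₁ e₂ h₁ h₂ m₁ m₂ x := by
    refine ((h.isAlmostDirac s j hJ).lagrangian x _).2 fun b hb => ?_
    obtain ⟨v₁, α₁, he₁⟩ := (mem_diracOf s j).1 (m₁ x)
    obtain ⟨v₂, α₂, he₂⟩ := (mem_diracOf s j).1 (m₂ x)
    obtain ⟨v₃, α₃, rfl⟩ := (mem_diracOf s j).1 hb
    obtain ⟨f₁, hf₁, rfl⟩ := exists_smooth_dvec_eq x α₁
    obtain ⟨f₂, hf₂, rfl⟩ := exists_smooth_dvec_eq x α₂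
    obtain ⟨f₃, hf₃, rfl⟩ := exists_smooth_dvec_eq x α₃
    have hg := fun (v : P.sub) (f : M → ℝ) (hf : ContMDiff 𝓘(ℝ, E) 𝓘(ℝ, ℝ) ∞ f) =>
      smoothBigOn_gen s j hJ (h.smooth_act j) (h.smooth_biv j) hf v
    have mg : ∀ (v : P.sub) (f : M → ℝ) (y : M),
        gen s j J biv ρ y v (dvec (E := E) f y) ∈ diracOf s j J biv ρ y := fun v f y =>
      (mem_diracOf s j).2 ⟨v, _, rfl⟩
    -- By tensoriality the given sections are replaced by generators with the same values at x, for
    -- which the bracket is known.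
    refine (bigPairing_courant_congr (pullThree_cycle s) (h.isIsotropic s j) h₁ h₂ (hg v₃ f₃ hf₃)
      (hg v₁ f₁ hf₁) (hg v₂ f₂ hf₂) m₁ m₂ (mg v₃ f₃) (mg v₁ f₁) (mg v₂ f₂) he₁.symm
      he₂.symm).trans ?_
    rw [bigPairing_courant_gen s j hJ (h.skew j) h.equivariant (h.tmap_biv j) (h.smooth_act j)
      (h.smooth_biv j) v₁ v₂ v₃ hf₁ hf₂ hf₃, h.quasiPoisson.lie v₁ f₂ f₃ hf₂ hf₃,
      h.quasiPoisson.lie v₂ f₃ f₁ hf₃ hf₁, h.quasiPoisson.lie v₃ f₁ f₂ hf₁ hf₂,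
      h.quasiPoisson.schouten f₁ f₂ f₃ hf₁ hf₂ hf₃, h.quasiPoisson.action.bracket,
      h.quasiPoisson.action.bracket, h.quasiPoisson.action.bracket]
    ring

theorem IsHamiltonianQP.isStrongDirac (hJ : ContMDiff 𝓘(ℝ, E) 𝓘(ℝ, ES) ∞ J)
    (h : IsHamiltonianQP Q j J biv ρ) : IsStrongDirac J (diracOf s j J biv ρ) s.phiS s.LS where
  dirac := h.isDirac s j hJ
  forward x Y β := by
    constructor
    · rintro ⟨v, hv, hvY⟩
      refine ⟨ρ ⟨v, hv⟩ x, (h.equivariant x ⟨v, hv⟩).trans (congrArg Prod.fst hvY), ?_⟩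
      have hβ : s.star (J x) v = β := congrArg Prod.snd hvY
      rw [← hβ]
      exact rhoHat_mem_diracOf s j x ⟨v, hv⟩
    · rintro ⟨X, rfl, hX⟩
      -- The pairing of (dJ X, β) with (ρ(v), σ(v)) equals that of (X, J^*β) with ρ̂_M(v), and both
      -- of the latter are in the isotropic L.
      refine mem_LS_of_orthogonal s fun v => ?_
      have h1 := h.isIsotropic s j x _ hX _ (rhoHat_mem_diracOf s j x v)
      rw [← h1]
      change P.form v (s.toFun (J x) (tmap E ES J x X)) + β (Q.rhoS (J x) v)
        = P.form v (s.toFun (J x) (tmap E ES J x X)) + β (tmap E ES J x (ρ v x))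
      rw [h.equivariant]
  transversal x X hX hm := by
    -- A vector in ker dJ gives an element (X, 0) of the backward image of C_S, with μ = 0; that
    -- backward image meets L only in 0.
    have hc : ((X, 0) : BigTan E x) ∈ backwardImage J (s.CS j) x :=
      (mem_backwardImage_CS s j).2 ⟨0, by rw [map_zero, map_zero]; exact hX, by
        rw [map_zero, map_zero, map_zero]⟩
    have hd := (isCompl_of_isotropic (h.isIsotropic s j x) (isIsotropic_backwardImage_CS s j x)
      (h.sup_eq_top s j x)).disjoint
    exact congrArg Prod.fst (Submodule.disjoint_def.1 hd _ hm hc)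

theorem IsHamiltonianQP.isInducedAction (h : IsHamiltonianQP Q j J biv ρ) :
    IsInducedAction s J (diracOf s j J biv ρ) ρ := fun v x =>
  ⟨h.equivariant x v, rhoHat_mem_diracOf s j x v⟩

theorem IsHamiltonianQP.isAssocBivector (h : IsHamiltonianQP Q j J biv ρ) :
    IsAssocBivector (diracOf s j J biv ρ) (backwardImage J (s.CS j)) biv := by
  intro x α
  have hg : gen s j J biv ρ x 0 α = (biv x α, (gen s j J biv ρ x 0 α).2) := by
    refine Prod.ext ?_ rfl
    change ρ 0 x + biv x α = biv x α
    rw [map_zero]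
    exact zero_add _
  refine ⟨(gen s j J biv ρ x 0 α).2, ?_, fun c hc => ?_⟩
  · rw [← hg]
    exact (mem_diracOf s j).2 ⟨0, α, rfl⟩
  · obtain ⟨μ, h1, h2⟩ := (mem_backwardImage_CS s j).1 hc
    rw [← hg]
    have h3 := bigPairing_lift s (tmap_gen j h.equivariant (h.tmap_biv j) x 0 α) h1
    -- The 𝔡-valued coefficient of h(α) and that of c both lie in j(𝔤^*), so only α(c.1) remains of
    -- the pairing.
    have h4 : P.form (genCoeff j ρ x 0 α) (j.toFun μ) = 0 := by
      rw [genCoeff, ZeroMemClass.coe_zero, zero_sub, map_neg, neg_apply, j.isotropic, neg_zero]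
    have e : bigPairing (gen s j J biv ρ x 0 α) c
        = bigPairing (liftBig s J x (ρ 0 x + biv x α) (genCoeff j ρ x 0 α))
          (liftBig s J x c.1 (j.toFun μ)) + α c.1 := by
      simp only [bigPairing, gen, _root_.add_apply, h2]
      ring
    rw [e, h3, h4, zero_add]

end ToDirac

/-! ### Smoothness of a section detected by its pairings -/

section PairingSmooth

variable {E : Type*} [NormedAddCommGroup E] [NormedSpace ℝ E] [FiniteDimensional ℝ E]
  {M : Type*} [TopologicalSpace M] [ChartedSpace E M] [IsManifold 𝓘(ℝ, E) ∞ M]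

/-- Smoothness of a section of `TM ⊕ T*M` at a point. -/
structure SmoothBigAt (e : ∀ x : M, BigTan E x) (x : M) : Prop where
  vf : SmoothVFAt (fun y => (e y).1) x
  form : SmoothFormAt (fun y => (e y).2) x

theorem SmoothBigAt.add {e e' : ∀ x : M, BigTan E x} {x : M} (h : SmoothBigAt e x)
    (h' : SmoothBigAt e' x) : SmoothBigAt (fun y => e y + e' y) x :=
  ⟨h.vf.add h'.vf, h.form.add h'.form⟩

theorem SmoothBigAt.smul {e : ∀ x : M, BigTan E x} {f : M → ℝ} {x : M} (hf : SmoothAt E f x)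
    (h : SmoothBigAt e x) : SmoothBigAt (fun y => f y • e y) x :=
  ⟨h.vf.smul hf, h.form.smul hf⟩

theorem smoothBigAt_zero (x : M) : SmoothBigAt (fun y => (0 : BigTan E y)) x :=
  ⟨smoothVFAt_zero x, smoothFormAt_zero x⟩

theorem SmoothBigAt.bigPairing {e e' : ∀ x : M, BigTan E x} {x : M} (h : SmoothBigAt e x)
    (h' : SmoothBigAt e' x) : SmoothAt E (fun y => bigPairing (e y) (e' y)) x :=
  (h'.form.apply h.vf).add (h.form.apply h'.vf)

theorem SmoothBigAt.sum {ι : Type*} {t : Finset ι} {e : ι → ∀ x : M, BigTan E x} {x : M}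
    (h : ∀ i ∈ t, SmoothBigAt (e i) x) : SmoothBigAt (fun y => ∑ i ∈ t, e i y) x := by
  classical
  induction t using Finset.induction_on with
  | empty => simpa using smoothBigAt_zero x
  | insert a t ha ih =>
    simp only [Finset.sum_insert ha]
    exact (h a (Finset.mem_insert_self a t)).add
      (ih fun i hi => h i (Finset.mem_insert_of_mem hi))

theorem SmoothBigAt.congr {e e' : ∀ x : M, BigTan E x} {x : M} (h : SmoothBigAt e x)
    (he : ∀ᶠ y in 𝓝 x, e' y = e y) : SmoothBigAt e' x :=
  ⟨h.vf.congr (he.mono fun y hy => by rw [hy]), h.form.congr (he.mono fun y hy => by rw [hy])⟩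

/-- The values at `x` of the smooth local sections whose pairing with `R` is smooth. -/
def smoothPairingSubmodule (R : ∀ x : M, BigTan E x) (x : M) : Submodule ℝ (BigTan E x) where
  carrier := {a | ∃ g : ∀ y : M, BigTan E y, SmoothBigAt g x ∧ g x = a ∧
    SmoothAt E (fun y => bigPairing (R y) (g y)) x}
  add_mem' := by
    rintro a b ⟨g, hg, rfl, hR⟩ ⟨g', hg', rfl, hR'⟩
    refine ⟨fun y => g y + g' y, hg.add hg', rfl, ?_⟩
    simp only [bigPairing_add_right]
    exact hR.add hR'
  zero_mem' := by
    refine ⟨fun y => 0, smoothBigAt_zero x, rfl, ?_⟩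
    simp only [bigPairing, Prod.fst_zero, Prod.snd_zero, map_zero, zero_apply, add_zero]
    exact contMDiffAt_const
  smul_mem' := by
    rintro r a ⟨g, hg, rfl, hR⟩
    refine ⟨fun y => r • g y, SmoothBigAt.smul contMDiffAt_const hg, rfl, ?_⟩
    simp only [bigPairing_smul_right]
    exact contMDiffAt_const.mul hR

theorem bigPairing_sum_right {x : M} {ι : Type*} (t : Finset ι) (a : BigTan E x)
    (b : ι → BigTan E x) : bigPairing a (∑ i ∈ t, b i) = ∑ i ∈ t, bigPairing a (b i) :=
  map_sum (bigPairingL a) b t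

/-- A section is smooth at `x` if its pairings with enough smooth sections are. -/
theorem smoothBigAt_of_pairing {R : ∀ x : M, BigTan E x} {x : M}
    (h : smoothPairingSubmodule R x = ⊤) : SmoothBigAt R x := by
  have hf : ∀ y : M, FiniteDimensional ℝ (BigTan E y) := fun y =>
    inferInstanceAs (FiniteDimensional ℝ (E × (E →L[ℝ] ℝ)))
  obtain ⟨n, b, hn⟩ : ∃ (n : ℕ) (_ : Module.Basis (Fin n) ℝ (BigTan E x)),
      n = Module.finrank ℝ (E × (E →L[ℝ] ℝ)) := ⟨_, Module.finBasis ℝ (BigTan E x), rfl⟩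
  have hb : ∀ i, ∃ g : ∀ y : M, BigTan E y, SmoothBigAt g x ∧ g x = b i ∧
      SmoothAt E (fun y => bigPairing (R y) (g y)) x := fun i =>
    h.ge (Submodule.mem_top (x := b i))
  choose g hg hgx hR using hb
  -- A is the Gram matrix of the local sections g_k. It is invertible at x by nondegeneracy of the
  -- pairing, and the coefficients of R in the g_k are found by solving the corresponding linear
  -- system.
  let A : M → (Fin n → ℝ) →L[ℝ] (Fin n → ℝ) := fun y => LinearMap.toContinuousLinearMap
    (Matrix.toLin' (Matrix.of fun i k => bigPairing (g i y) (g k y)))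
  have hA : ∀ y c i, A y c i = bigPairing (g i y) (∑ k, c k • g k y) := by
    intro y c i
    rw [bigPairing_sum_right]
    simp only [bigPairing_smul_right, A]
    change (Matrix.of fun i k => bigPairing (g i y) (g k y)).mulVec c i = _
    simp only [Matrix.mulVec, dotProduct, Matrix.of_apply, mul_comm]
  have hAs : SmoothAt E A x := by
    refine smoothAt_clm_of_apply fun c => contMDiffAt_pi_space.2 fun i => ?_
    simp only [hA]
    exact (hg i).bigPairing (SmoothBigAt.sum fun k _ => SmoothBigAt.smul contMDiffAt_const (hg k))
  have hinj : Function.Injective (A x) := by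
    refine (injective_iff_map_eq_zero (A x)).2 fun c hc => ?_
    have h0 : ∑ k, c k • b k = 0 := by
      refine eq_zero_of_bigPairing fun a => ?_
      rw [← b.sum_repr a, bigPairing_sum_right]
      refine Finset.sum_eq_zero fun i _ => ?_
      have h1 := hA x c i
      rw [hc] at h1
      simp only [hgx] at h1
      rw [bigPairing_smul_right, bigPairing_comm, ← h1, Pi.zero_apply, mul_zero]
    funext k
    exact Fintype.linearIndependent_iff.1 b.linearIndependent c h0 k
  let e : (Fin n → ℝ) ≃L[ℝ] (Fin n → ℝ) :=
    (LinearEquiv.ofInjectiveEndo (A x).toLinearMap hinj).toContinuousLinearEquiv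
  have he : (e : (Fin n → ℝ) →L[ℝ] (Fin n → ℝ)) = A x := by ext; rfl
  have hnear : ∀ᶠ y in 𝓝 x, A y ∈ range ((↑) : ((Fin n → ℝ) ≃L[ℝ] (Fin n → ℝ)) → _) :=
    hAs.continuousAt.eventually (he ▸ e.nhds)
  have hinv : SmoothAt E (fun y => (A y).inverse) x := by
    have h1 : ContDiffAt ℝ ∞ (ContinuousLinearMap.inverse :
        ((Fin n → ℝ) →L[ℝ] (Fin n → ℝ)) → _) (A x) := he ▸ contDiffAt_map_inverse e
    exact h1.contMDiffAt.comp x hAs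
  have hc : SmoothAt E (fun y => (A y).inverse fun i => bigPairing (R y) (g i y)) x :=
    hinv.clm_apply (contMDiffAt_pi_space.2 hR)
  have hsum : SmoothBigAt
      (fun y => ∑ k, (A y).inverse (fun i => bigPairing (R y) (g i y)) k • g k y) x :=
    SmoothBigAt.sum fun k _ => SmoothBigAt.smul (contMDiffAt_pi_space.1 hc k) (hg k)
  refine hsum.congr ?_
  filter_upwards [hnear] with y ⟨e', he'⟩
  -- Where the Gram matrix is invertible the g_k are independent, hence a basis because their number
  -- is the rank of the bundle.
  have hli : LinearIndependent ℝ (fun k => g k y) := by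
    refine Fintype.linearIndependent_iff.2 fun c hc => ?_
    have h1 : A y c = 0 := by
      funext i
      rw [hA, hc]
      exact (bigPairingL (g i y)).map_zero
    rw [← he'] at h1
    exact fun i => congrFun (e'.map_eq_zero_iff.1 h1) i
  have hspan : ⊤ ≤ Submodule.span ℝ (range fun k => g k y) :=
    (hli.span_eq_top_of_card_eq_finrank' (by
      rw [Fintype.card_fin, hn]
      rfl)).ge
  let B := Module.Basis.mk hli hspan
  have hRB : ∑ k, B.repr (R y) k • g k y = R y := by
    have := B.sum_repr (R y)
    simpa only [B, Module.Basis.coe_mk] using this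
  have h2 : A y (fun k => B.repr (R y) k) = fun i => bigPairing (R y) (g i y) := by
    funext i
    rw [hA, hRB, bigPairing_comm]
  rw [← h2, ← he', ContinuousLinearMap.inverse_equiv]
  simp only [ContinuousLinearEquiv.coe_coe, ContinuousLinearEquiv.symm_apply_apply]
  exact hRB.symm

end PairingSmooth

/-! ### The action, complement and bivector field of a strong Dirac map -/

section FromDirac

variable {𝔡 : Type*} [NormedAddCommGroup 𝔡] [NormedSpace ℝ 𝔡] [FiniteDimensional ℝ 𝔡]
  {P : ManinPair 𝔡}
  {ED : Type*} [NormedAddCommGroup ED] [NormedSpace ℝ ED] [FiniteDimensional ℝ ED]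
  {ES : Type*} [NormedAddCommGroup ES] [NormedSpace ℝ ES] [FiniteDimensional ℝ ES]
  {D : Type*} [TopologicalSpace D] [ChartedSpace ED D] [Group D] [LieGroup 𝓘(ℝ, ED) ∞ D]
  [ConnectedSpace D]
  {G : Subgroup D} [ChartedSpace ES (D ⧸ G)] [IsManifold 𝓘(ℝ, ES) ∞ (D ⧸ G)]
  {Q : GroupPair P ED ES G} {s : ConnectionSplitting Q} (j : IsotropicSplitting P)
  {E : Type*} [NormedAddCommGroup E] [NormedSpace ℝ E] [FiniteDimensional ℝ E]
  {M : Type*} [TopologicalSpace M] [ChartedSpace E M] [IsManifold 𝓘(ℝ, E) ∞ M] {J : M → D ⧸ G}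
  {L : ∀ x : M, Submodule ℝ (BigTan E x)}
  {biv : ∀ x : M, Cot E x →L[ℝ] Tan E x} {ρ : P.sub →ₗ[ℝ] ∀ x : M, Tan E x}

/-- Existence is the f-Dirac condition at (ρ(v), σ(v)) ∈ L_S. Two solutions differ by an element of
ker dJ ∩ L ∩ TM, which is 0. -/
theorem IsStrongDirac.existsUnique_vec (h : IsStrongDirac J L s.phiS s.LS) (v : P.sub) (x : M) :
    ∃! X : Tan E x, tmap E ES J x X = Q.rhoS (J x) v ∧
      (X, cotmap E ES J x (s.star (J x) v)) ∈ L x := by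
  obtain ⟨X, hX, hm⟩ := (h.forward x (Q.rhoS (J x) v) (s.star (J x) v)).1 ⟨v, v.2, rfl⟩
  refine ⟨X, ⟨hX, hm⟩, fun Y hY => ?_⟩
  rw [← sub_eq_zero]
  refine h.transversal x _ (by rw [map_sub, hX, hY.1, sub_self]) ?_
  have := (L x).sub_mem hY.2 hm
  rwa [Prod.mk_sub_mk, sub_self] at this

theorem IsStrongDirac.existsUnique_act (h : IsStrongDirac J L s.phiS s.LS) :
    ∃! ρ : P.sub →ₗ[ℝ] ∀ x : M, Tan E x, IsInducedAction s J L ρ := by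
  choose X hX hu using fun v x => h.existsUnique_vec v x
  have hadd : ∀ v w x, X (v + w) x = X v x + X w x := fun v w x => by
    refine (hu _ x _ ⟨?_, ?_⟩).symm
    · rw [map_add, (hX v x).1, (hX w x).1, Submodule.coe_add, map_add]
    · have := (L x).add_mem (hX v x).2 (hX w x).2
      rw [Submodule.coe_add, map_add, map_add]
      exact this
  have hsmul : ∀ (r : ℝ) v x, X (r • v) x = r • X v x := fun r v x => by
    refine (hu _ x _ ⟨?_, ?_⟩).symm
    · rw [map_smul, (hX v x).1, Submodule.coe_smul, map_smul]
    · have := (L x).smul_mem r (hX v x).2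
      rw [Submodule.coe_smul, map_smul, map_smul]
      exact this
  refine ⟨{ toFun := X, map_add' := fun v w => funext (hadd v w),
            map_smul' := fun r v => funext (hsmul r v) }, hX, fun ρ hρ => ?_⟩
  ext v x
  exact hu v x _ (hρ v x)

/-- Orthogonality to L puts a in L; orthogonality to tangent vectors kills its cotangent part, and
orthogonality to pulled-back covectors kills dJ of its tangent part. The strong condition does the
rest. It serves both to show L + C is everything and to supply enough test sections for smoothness.
-/
theorem eq_zero_of_transversal (h : IsStrongDirac J L s.phiS s.LS) {x : M} {a : BigTan E x}
    {W : Submodule ℝ (BigTan E x)} (hW : ∀ b ∈ W, bigPairing a b = 0) (hL : L x ≤ W)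
    (hv : ∀ X : Tan E x, ((X, 0) : BigTan E x) ∈ W)
    (hξ : ∀ ξ : Cot ES (J x), ((0, cotmap E ES J x ξ) : BigTan E x) ∈ W) : a = 0 := by
  have ha : a ∈ L x := (h.dirac.lagrangian x a).2 fun b hb => hW b (hL hb)
  have h2 : a.2 = 0 := by
    ext X
    have := hW _ (hv X)
    simpa [bigPairing] using this
  have h1 : tmap E ES J x a.1 = 0 := by
    refine eq_zero_of_cot fun ξ => ?_
    have h3 := hW _ (hξ ξ)
    have h4 : ξ (tmap E ES J x a.1) + a.2 0 = 0 := h3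
    rwa [map_zero, add_zero] at h4
  have h5 : a.1 = 0 := h.transversal x _ h1 (by rw [← h2]; exact ha)
  exact Prod.ext h5 h2

theorem IsInducedAction.equivariant (hρ : IsInducedAction s J L ρ) (x : M) (v : P.sub) :
    tmap E ES J x (ρ v x) = Q.rhoS (J x) v := (hρ v x).1

/-- Local sections of L pair to the zero function with any section of L, smooth or not. -/
theorem IsStrongDirac.mem_smoothPairing (h : IsStrongDirac J L s.phiS s.LS)
    {R : ∀ x : M, BigTan E x} (hR : ∀ x, R x ∈ L x) (x : M) :
    L x ≤ smoothPairingSubmodule R x := by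
  intro a ha
  obtain ⟨U, hU, hx, e, he, heL, rfl⟩ := h.dirac.smooth x a ha
  refine ⟨e, ⟨he.1.at hU hx, he.2.at hU hx⟩, rfl, ?_⟩
  have h0 : SmoothAt E (fun _ : M => (0 : ℝ)) x := contMDiffAt_const
  refine h0.congr_of_eventuallyEq ?_
  filter_upwards [hU.mem_nhds hx] with y hy
  exact h.dirac.isotropic y _ (hR y) _ (heL y hy)

theorem exists_smoothFormAt_eq {E N : Type*} [NormedAddCommGroup E] [NormedSpace ℝ E]
    [TopologicalSpace N] [ChartedSpace E N] [IsManifold 𝓘(ℝ, E) ∞ N] (x : N) (α : Cot E x) :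
    ∃ β : ∀ y : N, Cot E y, SmoothFormAt β x ∧ β x = α := by
  obtain ⟨a, rfl⟩ : ∃ a : E →L[ℝ] ℝ, (a : Cot E x) = α := ⟨α, rfl⟩
  have hg : SmoothAt E (fun y => a (extChartAt 𝓘(ℝ, E) x y)) x :=
    (ContinuousLinearMap.contMDiff a).contMDiffAt.comp x (smoothAt_chart x)
  refine ⟨dvec (E := E) (fun y => a (extChartAt 𝓘(ℝ, E) x y)), smoothFormAt_dvec hg, ?_⟩
  refine ContinuousLinearMap.ext fun v => ?_
  exact (dvec_clm (E := E) a (smoothAt_chart x).mdiff v).trans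
    (congrArg a (dvec_extChartAt_self (E := E) x v))

/-- Test ρ̂_M(v) against three kinds of sections: those of L give 0, (X, 0) gives ⟨v, s(dJ X)⟩, and
(0, J^*β) gives β(ρ_S(v)) ∘ J. All are smooth, and together they span. -/
theorem IsStrongDirac.smooth_act (hJ : ContMDiff 𝓘(ℝ, E) 𝓘(ℝ, ES) ∞ J)
    (h : IsStrongDirac J L s.phiS s.LS) (hρ : IsInducedAction s J L ρ) (v : P.sub) (x : M) :
    SmoothVFAt (ρ v) x := by
  refine (smoothBigAt_of_pairing (R := fun y => (ρ v y, cotmap E ES J y (s.star (J y) v)))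
    (eq_top_of_orthogonal fun a ha => eq_zero_of_transversal h ha
      (h.mem_smoothPairing (fun y => (hρ v y).2) x) (fun X => ?_) fun ξ => ?_)).vf
  · refine ⟨fun y => (coordVF (E := E) x X y, 0),
      ⟨smoothVFAt_coordVF (E := E) x X, smoothFormAt_zero x⟩, Prod.ext (coordVF_self (E := E) x X) rfl, ?_⟩
    have h1 : SmoothAt E (fun y => P.form (v : 𝔡) (pullS s J y (coordVF (E := E) x X y))) x :=
      smoothAt_bilin P.form contMDiffAt_const
        ((smoothFormAt_pullS s hJ x).apply (smoothVFAt_coordVF (E := E) x X))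
    refine h1.congr_of_eventuallyEq (Filter.Eventually.of_forall fun y => ?_)
    exact zero_add _
  · obtain ⟨β, hβ, hβx⟩ := exists_smoothFormAt_eq (J x) ξ
    refine ⟨fun y => (0, cotmap E ES J y (β (J y))),
      ⟨smoothVFAt_zero x, SmoothFormAt.pullback hJ hβ⟩,
      Prod.ext rfl (congrArg (cotmap E ES J x) hβx), ?_⟩
    have h1 : SmoothAt E (fun y => β (J y) (Q.rhoS (J y) v)) x := by
      have h2 := hβ.apply (smoothVFAt_rhoS Q (v : 𝔡) (J x))
      exact ContMDiffAt.comp x h2 hJ.contMDiffAt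
    refine h1.congr_of_eventuallyEq (Filter.Eventually.of_forall fun y => ?_)
    change β (J y) (tmap E ES J y (ρ v y)) + P.form v (s.toFun (J y) (tmap E ES J y 0)) = _
    rw [(hρ v y).1, map_zero, map_zero, map_zero, add_zero]

/-- The component along `C` of a covector pulled back from `S`. -/
theorem cot_sub_mem_backwardImage (hρ : ∀ (x : M) (v : P.sub), tmap E ES J x (ρ v x) = Q.rhoS (J x) v)
    (s : ConnectionSplitting Q) (x : M) (ξ : Cot ES (J x)) :
    ((0, cotmap E ES J x ξ) : BigTan E x)
        - (ρ (sigmaBar Q j (J x) ξ) x, cotmap E ES J x (s.star (J x) (sigmaBar Q j (J x) ξ)))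
      ∈ backwardImage J (s.CS j) x := by
  obtain ⟨k, hk, hk'⟩ := exists_kappa s (J x) ξ
  rw [sigmaBar_eq j hk']
  have hdec : j.toFun (P.res k) = k - (j.star k : 𝔡) := eq_sub_of_add_eq' (j.star_add_res k)
  have hs : s.star (J x) k = ξ := by
    ext Y
    rw [star_apply, hk', s.splits]
  refine (mem_backwardImage_CS s j).2 ⟨P.res k, ?_, ?_⟩
  · change tmap E ES J x (0 - ρ (j.star k) x) = _
    rw [zero_sub, map_neg, hρ, hdec, map_sub, hk, zero_sub]
  · change cotmap E ES J x ξ - cotmap E ES J x (s.star (J x) (j.star k)) = _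
    rw [hdec, map_sub, map_sub, hs]

theorem IsStrongDirac.sup_eq_top (h : IsStrongDirac J L s.phiS s.LS)
    (hρ : IsInducedAction s J L ρ) (x : M) : L x ⊔ backwardImage J (s.CS j) x = ⊤ := by
  refine eq_top_of_orthogonal fun a ha => eq_zero_of_transversal h ha le_sup_left
    (vec_mem_sup s j hρ.equivariant fun v => (hρ v x).2) fun ξ => ?_
  exact Submodule.mem_sup.2 ⟨_, (hρ _ x).2, _,
    cot_sub_mem_backwardImage j hρ.equivariant s x ξ, add_sub_cancel _ _⟩

theorem IsStrongDirac.isCompl (h : IsStrongDirac J L s.phiS s.LS)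
    (hρ : IsInducedAction s J L ρ) (x : M) : IsCompl (L x) (backwardImage J (s.CS j) x) :=
  isCompl_of_isotropic (h.dirac.isotropic x) (isIsotropic_backwardImage_CS s j x)
    (h.sup_eq_top j hρ x)

theorem IsStrongDirac.lagrangian_C (h : IsStrongDirac J L s.phiS s.LS)
    (hρ : IsInducedAction s J L ρ) (x : M) (a : BigTan E x) :
    a ∈ backwardImage J (s.CS j) x ↔ ∀ b ∈ backwardImage J (s.CS j) x, bigPairing a b = 0 :=
  lagrangian_of_isotropic (isIsotropic_backwardImage_CS s j x) (h.dirac.isotropic x)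
    (sup_comm (L x) _ ▸ h.sup_eq_top j hρ x) a

theorem IsStrongDirac.isAlmostDirac_C [T2Space M] (hJ : ContMDiff 𝓘(ℝ, E) 𝓘(ℝ, ES) ∞ J)
    (h : IsStrongDirac J L s.phiS s.LS) (hρ : IsInducedAction s J L ρ) :
    IsAlmostDirac (backwardImage (E := E) J (s.CS j)) where
  lagrangian := h.lagrangian_C j hρ
  smooth x a ha := by
    obtain ⟨μ, h1, h2⟩ := (mem_backwardImage_CS s j).1 ha
    obtain ⟨X, hX, hXx⟩ := exists_smooth_vf_eq x a.1
    -- A smooth extension X of the tangent part is pushed into C by subtracting the action of w. At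
    -- x itself w vanishes, so the prescribed value is kept.
    let w : M → P.sub := fun y => j.star (pullS s J y (X y) - projS s (J y) (j.toFun μ))
    have hw : ∀ y, SmoothAt E w y := fun y => by
      have h3 : SmoothAt E (fun y => pullS s J y (X y) - projS s (J y) (j.toFun μ)) y :=
        ((smoothFormAt_pullS s hJ y).apply (hX y)).sub (smoothAt_projS_comp s hJ contMDiffAt_const)
      exact j.star.contMDiff.contMDiffAt.comp y h3
    have hw' : ∀ y, SmoothAt E (fun y => j.toFun μ - (w y : 𝔡)) y := fun y =>
      contMDiffAt_const.sub (P.sub.subtypeL.contMDiff.contMDiffAt.comp y (hw y))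
    refine ⟨univ, isOpen_univ, mem_univ x, fun y => liftBig s J y (X y - ρ (w y) y)
      (j.toFun μ - (w y : 𝔡)), ⟨smoothVFOn_univ.2 fun y => ?_, smoothFormOn_univ.2 fun y => ?_⟩,
      fun y _ => mem_backwardImage_of_act s j (hρ.equivariant y) (X y) μ, ?_⟩
    · exact (hX y).sub (smoothVFAt_act (h.smooth_act hJ hρ) (hw y))
    · exact smoothFormAt_of_apply fun Y hY =>
        smoothAt_bilin P.form (hw' y) ((smoothFormAt_pullS s hJ y).apply hY)
    · have hwx : w x = 0 := by
        simp only [w]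
        rw [hXx, pullS_apply, h1, ← projS_apply, sub_self, map_zero]
      refine Prod.ext ?_ ?_
      · change X x - ρ (w x) x = a.1
        rw [hwx, map_zero, hXx]
        exact sub_zero _
      · change cotmap E ES J x (s.star (J x) (j.toFun μ - (w x : 𝔡))) = a.2
        rw [hwx, h2, ZeroMemClass.coe_zero, sub_zero]

theorem IsStrongDirac.existsUnique_biv (h : IsStrongDirac J L s.phiS s.LS)
    (hρ : IsInducedAction s J L ρ) :
    ∃! biv : ∀ x : M, Cot E x →L[ℝ] Tan E x,
      IsAssocBivector L (backwardImage J (s.CS j)) biv := by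
  have hf : ∀ x : M, FiniteDimensional ℝ (Cot E x) := fun x =>
    inferInstanceAs (FiniteDimensional ℝ (E →L[ℝ] ℝ))
  have hu : ∀ (x : M) (a b : BigTan E x), a ∈ L x → b ∈ L x →
      (∀ c ∈ backwardImage J (s.CS j) x, bigPairing a c = bigPairing b c) → a = b := by
    intro x a b ha hb hc
    rw [← sub_eq_zero]
    refine eq_zero_of_bigPairing fun d => ?_
    obtain ⟨l, hl, c, hcC, rfl⟩ := Submodule.mem_sup.1
      ((h.sup_eq_top j hρ x).ge (Submodule.mem_top (x := d)))
    rw [bigPairing_add_right, h.dirac.isotropic x _ ((L x).sub_mem ha hb) _ hl,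
      bigPairing_sub_left, hc c hcC, sub_self, add_zero]
  have hex : ∀ (x : M) (α : Cot E x), ∃ l ∈ L x,
      ∀ c ∈ backwardImage J (s.CS j) x, bigPairing l c = α c.1 := by
    intro x α
    -- The element of L representing α on C is the L-component of (0, α), since the other component
    -- pairs to 0 with C.
    obtain ⟨l, hl, c, hc, hlc⟩ := Submodule.mem_sup.1
      ((h.sup_eq_top j hρ x).ge (Submodule.mem_top (x := ((0, α) : BigTan E x))))
    refine ⟨l, hl, fun c' hc' => ?_⟩
    have h1 : bigPairing ((0, α) : BigTan E x) c' = α c'.1 := by simp [bigPairing]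
    rw [← h1, ← hlc, bigPairing_add_left, isIsotropic_backwardImage_CS s j x _ hc _ hc', add_zero]
  choose l hl hlc using hex
  have hadd : ∀ x α β, l x (α + β) = l x α + l x β := fun x α β =>
    hu x _ _ (hl x _) ((L x).add_mem (hl x α) (hl x β)) fun c hc => by
      rw [hlc x _ c hc, bigPairing_add_left, hlc x _ c hc, hlc x _ c hc]; rfl
  have hsmul : ∀ x (r : ℝ) α, l x (r • α) = r • l x α := fun x r α =>
    hu x _ _ (hl x _) ((L x).smul_mem r (hl x α)) fun c hc => by
      rw [hlc x _ c hc, bigPairing_comm, bigPairing_smul_right, bigPairing_comm, hlc x _ c hc]; rfl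
  refine ⟨fun x => LinearMap.toContinuousLinearMap
    { toFun := fun α => (l x α).1
      map_add' := fun α β => congrArg Prod.fst (hadd x α β)
      map_smul' := fun r α => congrArg Prod.fst (hsmul x r α) },
    fun x α => ⟨(l x α).2, hl x α, hlc x α⟩, fun biv hb => ?_⟩
  funext x
  ext α
  obtain ⟨γ, hγ, hγc⟩ := hb x α
  exact congrArg Prod.fst (hu x _ _ hγ (hl x α) fun c hc => by rw [hγc c hc, hlc x α c hc])

end FromDirac

/-! ### The quasi-Poisson axioms from the Dirac condition -/

section Hamiltonian

variable {𝔡 : Type*} [NormedAddCommGroup 𝔡] [NormedSpace ℝ 𝔡] [FiniteDimensional ℝ 𝔡]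
  {P : ManinPair 𝔡}
  {ED : Type*} [NormedAddCommGroup ED] [NormedSpace ℝ ED] [FiniteDimensional ℝ ED]
  {ES : Type*} [NormedAddCommGroup ES] [NormedSpace ℝ ES] [FiniteDimensional ℝ ES]
  {D : Type*} [TopologicalSpace D] [ChartedSpace ED D] [Group D] [LieGroup 𝓘(ℝ, ED) ∞ D]
  [ConnectedSpace D]
  {G : Subgroup D} [ChartedSpace ES (D ⧸ G)] [IsManifold 𝓘(ℝ, ES) ∞ (D ⧸ G)]
  {Q : GroupPair P ED ES G} {s : ConnectionSplitting Q} {j : IsotropicSplitting P}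
  {E : Type*} [NormedAddCommGroup E] [NormedSpace ℝ E] [FiniteDimensional ℝ E]
  {M : Type*} [TopologicalSpace M] [ChartedSpace E M] [IsManifold 𝓘(ℝ, E) ∞ M] {J : M → D ⧸ G}
  {L : ∀ x : M, Submodule ℝ (BigTan E x)}
  {biv : ∀ x : M, Cot E x →L[ℝ] Tan E x} {ρ : P.sub →ₗ[ℝ] ∀ x : M, Tan E x}

theorem gen_zero_left (x : M) (α : Cot E x) :
    gen s j J biv ρ x 0 α
      = (biv x α, α - cotmap E ES J x (s.star (J x) (j.toFun (dualAct ρ x α)))) := by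
  refine Prod.ext ?_ ?_
  · change ρ 0 x + biv x α = biv x α
    rw [map_zero]
    exact zero_add _
  · change cotmap E ES J x (s.star (J x) (genCoeff j ρ x 0 α)) + α = _
    rw [genCoeff, ZeroMemClass.coe_zero, zero_sub, map_neg, map_neg]
    change _ = α - _
    abel

/-- The difference of (0, α) and the representing element is orthogonal to C, hence in C, so it lies
over some jμ. Pairing with ρ̂_M(v) identifies μ as ρ_M^*α, which shows that the representing element
is h(α). -/
theorem IsAssocBivector.spec (h : IsStrongDirac J L s.phiS s.LS) (hρ : IsInducedAction s J L ρ)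
    (hb : IsAssocBivector L (backwardImage J (s.CS j)) biv) (x : M) (α : Cot E x) :
    gen s j J biv ρ x 0 α ∈ L x ∧
      tmap E ES J x (biv x α) = - Q.rhoS (J x) (j.toFun (dualAct ρ x α)) ∧
      ∀ c ∈ backwardImage J (s.CS j) x, bigPairing (gen s j J biv ρ x 0 α) c = α c.1 := by
  obtain ⟨γ, hγ, hγc⟩ := hb x α
  have hc : ((- biv x α, α - γ) : BigTan E x) ∈ backwardImage J (s.CS j) x := by
    rw [h.lagrangian_C j hρ]
    intro c hc
    have h1 := hγc c hc
    simp only [bigPairing, map_neg, _root_.sub_apply] at h1 ⊢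
    linarith
  obtain ⟨μ, h1, h2⟩ := (mem_backwardImage_CS s j).1 hc
  simp only at h1 h2
  have hμ : μ = dualAct ρ x α := by
    ext v
    have h3 := bigPairing_lift s h1 (hρ.equivariant x v)
    rw [j.splits] at h3
    rw [← h3, dualAct_apply]
    have h4 := h.dirac.isotropic x _ hγ _ (hρ v x).2
    simp only [liftBig, ← h2]
    simp only [bigPairing, map_neg, _root_.sub_apply] at h4 ⊢
    linarith
  subst hμ
  have hg : gen s j J biv ρ x 0 α = (biv x α, γ) := by
    rw [gen_zero_left, ← h2]
    exact Prod.ext rfl (sub_sub_cancel _ _)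
  refine ⟨hg ▸ hγ, ?_, fun c hc => ?_⟩
  · rw [← h1, map_neg, neg_neg]
  · rw [hg, hγc c hc]

theorem IsAssocBivector.gen_mem (h : IsStrongDirac J L s.phiS s.LS) (hρ : IsInducedAction s J L ρ)
    (hb : IsAssocBivector L (backwardImage J (s.CS j)) biv) (x : M) (v : P.sub) (α : Cot E x) :
    gen s j J biv ρ x v α ∈ L x := by
  have h1 := (L x).add_mem (hρ v x).2 (hb.spec h hρ x α).1
  rw [gen_zero_left] at h1
  convert h1 using 1
  refine Prod.ext rfl ?_
  change cotmap E ES J x (s.star (J x) (genCoeff j ρ x v α)) + α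
    = cotmap E ES J x (s.star (J x) v) + (α - _)
  rw [genCoeff, map_sub, map_sub]
  abel

/-- The generators lie in L and already span a supplement of C, while L meets C only in 0, so
nothing more fits in L. -/
theorem IsAssocBivector.diracOf_eq (h : IsStrongDirac J L s.phiS s.LS)
    (hρ : IsInducedAction s J L ρ)
    (hb : IsAssocBivector L (backwardImage J (s.CS j)) biv) : diracOf s j J biv ρ = L := by
  funext x
  have hle : diracOf s j J biv ρ x ≤ L x := by
    intro a ha
    obtain ⟨v, α, rfl⟩ := (mem_diracOf s j).1 ha
    exact hb.gen_mem h hρ x v α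
  refine le_antisymm hle fun a ha => ?_
  obtain ⟨d, hd, c, hc, rfl⟩ := Submodule.mem_sup.1 ((diracOf_sup_eq_top s j hρ.equivariant
    (fun x α => (hb.spec h hρ x α).2.1) x).ge (Submodule.mem_top (x := a)))
  have hcL : c ∈ L x := by
    have := (L x).sub_mem ha (hle hd)
    rwa [add_sub_cancel_left] at this
  rw [Submodule.disjoint_def.1 (h.isCompl j hρ x).disjoint c hcL hc, add_zero]
  exact hd

theorem IsAssocBivector.skew (h : IsStrongDirac J L s.phiS s.LS) (hρ : IsInducedAction s J L ρ)
    (hb : IsAssocBivector L (backwardImage J (s.CS j)) biv) (x : M) (α β : Cot E x) :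
    β (biv x α) = - α (biv x β) := by
  obtain ⟨hα, hα', -⟩ := hb.spec h hρ x α
  obtain ⟨hβ, hβ', -⟩ := hb.spec h hρ x β
  have h1 := h.dirac.isotropic x _ hα _ hβ
  have h2 := bigPairing_lift s (u := - j.toFun (dualAct ρ x α)) (v := - j.toFun (dualAct ρ x β))
    (by rw [hα', map_neg]) (by rw [hβ', map_neg])
  rw [gen_zero_left, gen_zero_left] at h1
  simp only [map_neg, neg_apply, j.isotropic, neg_zero, bigPairing, _root_.sub_apply] at h1 h2
  linarith

/-- For smooth α the section h(α) pairs to 0 with sections of L and to α(c.1) with sections c of C,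
and these span. -/
theorem IsAssocBivector.smooth [T2Space M] (hJ : ContMDiff 𝓘(ℝ, E) 𝓘(ℝ, ES) ∞ J)
    (h : IsStrongDirac J L s.phiS s.LS) (hρ : IsInducedAction s J L ρ)
    (hb : IsAssocBivector L (backwardImage J (s.CS j)) biv) (x : M) : SmoothBivAt biv x := by
  refine smoothBivAt_of_apply fun α hα => ?_
  have hR : SmoothBigAt (fun y => gen s j J biv ρ y 0 (α y)) x := by
    refine smoothBigAt_of_pairing (top_le_iff.1 ?_)
    rw [← h.sup_eq_top j hρ x]
    refine sup_le (h.mem_smoothPairing (fun y => (hb.spec h hρ y _).1) x) fun a ha => ?_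
    obtain ⟨U, hU, hx, e, he, heC, rfl⟩ := (h.isAlmostDirac_C j hJ hρ).smooth x a ha
    refine ⟨e, ⟨he.1.at hU hx, he.2.at hU hx⟩, rfl, ?_⟩
    have h0 : SmoothAt E (fun y => α y (e y).1) x := hα.apply (he.1.at hU hx)
    refine h0.congr_of_eventuallyEq ?_
    filter_upwards [hU.mem_nhds hx] with y hy
    exact (hb.spec h hρ y _).2.2 _ (heC y hy)
  refine hR.vf.congr (Filter.Eventually.of_forall fun y => ?_)
  rw [gen_zero_left]

/-- Both h(J^*ξ) and ρ̂_M(σ̄ξ) are the L-component of (0, J^*ξ) along C, so their tangent parts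
agree. -/
theorem IsAssocBivector.moment (h : IsStrongDirac J L s.phiS s.LS) (hρ : IsInducedAction s J L ρ)
    (hb : IsAssocBivector L (backwardImage J (s.CS j)) biv) (x : M) (ξ : Cot ES (J x)) :
    biv x (cotmap E ES J x ξ) = ρ (sigmaBar Q j (J x) ξ) x := by
  obtain ⟨h1, h2, -⟩ := hb.spec h hρ x (cotmap E ES J x ξ)
  have h3 := cot_sub_mem_backwardImage j hρ.equivariant s x ξ
  have h4 : ((0, cotmap E ES J x ξ) : BigTan E x) - gen s j J biv ρ x 0 (cotmap E ES J x ξ)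
      ∈ backwardImage J (s.CS j) x := by
    refine (mem_backwardImage_CS s j).2 ⟨dualAct ρ x (cotmap E ES J x ξ), ?_, ?_⟩
    · rw [gen_zero_left]
      change tmap E ES J x (0 - biv x (cotmap E ES J x ξ)) = _
      rw [zero_sub, map_neg, h2, neg_neg]
    · rw [gen_zero_left]
      exact sub_sub_cancel _ _
  have h5 := (backwardImage J (s.CS j) x).sub_mem h3 h4
  rw [sub_sub_sub_cancel_left] at h5
  have h6 := Submodule.disjoint_def.1 (h.isCompl j hρ x).disjoint _
    ((L x).sub_mem h1 (hρ _ x).2) h5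
  rw [sub_eq_zero, gen_zero_left] at h6
  exact congrArg Prod.fst h6

theorem IsStrongDirac.isHamiltonianQP [T2Space M] (hJ : ContMDiff 𝓘(ℝ, E) 𝓘(ℝ, ES) ∞ J)
    (h : IsStrongDirac J L s.phiS s.LS) (hρ : IsInducedAction s J L ρ)
    (hb : IsAssocBivector L (backwardImage J (s.CS j)) biv) : IsHamiltonianQP Q j J biv ρ := by
  have hρs := fun v x => h.smooth_act hJ hρ v x
  have hbs := fun x => hb.smooth hJ h hρ x
  have hz : ∀ v₁ v₂ v₃ (f₁ f₂ f₃ : M → ℝ), ContMDiff 𝓘(ℝ, E) 𝓘(ℝ, ℝ) ∞ f₁ →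
      ContMDiff 𝓘(ℝ, E) 𝓘(ℝ, ℝ) ∞ f₂ → ContMDiff 𝓘(ℝ, E) 𝓘(ℝ, ℝ) ∞ f₃ → ∀ x, _ = (0 : ℝ) :=
    fun v₁ v₂ v₃ f₁ f₂ f₃ hf₁ hf₂ hf₃ x =>
      (bigPairing_courant_gen s j hJ (hb.skew h hρ) hρ.equivariant
        (fun x α => (hb.spec h hρ x α).2.1) hρs hbs v₁ v₂ v₃ hf₁ hf₂ hf₃ (x := x)).symm.trans
      (h.dirac.isotropic x _ (h.dirac.integrable _ _ (smoothBigOn_gen s j hJ hρs hbs hf₁ v₁)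
        (smoothBigOn_gen s j hJ hρs hbs hf₂ v₂) (fun y => hb.gen_mem h hρ y _ _)
        (fun y => hb.gen_mem h hρ y _ _) x) _ (hb.gen_mem h hρ x v₃ _))
  have hρ0 : (ρ 0 : ∀ x : M, Tan E x) = 0 := map_zero ρ
  have hb1 : ∀ v : P.sub, P.subBracket 0 v = 0 := fun v => Subtype.ext (by
    change P.bracket 0 v = 0
    rw [map_zero, zero_apply])
  have hb2 : ∀ v : P.sub, P.subBracket v 0 = 0 := fun v => Subtype.ext (by
    change P.bracket v 0 = 0
    rw [map_zero])
  have A1 : ∀ (v : P.sub) (f : M → ℝ) (x : M),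
      dvec (E := E) f x (mlieBracket 𝓘(ℝ, E) (ρ 0) (ρ v) x)
        - dvec (E := E) f x (ρ (P.subBracket 0 v) x) = 0 := fun v f x => by
    rw [hb1, hρ0, mlieBracket_zero_left, sub_self]
  have A2 : ∀ (v : P.sub) (f : M → ℝ) (x : M),
      dvec (E := E) f x (mlieBracket 𝓘(ℝ, E) (ρ v) (ρ 0) x)
        - dvec (E := E) f x (ρ (P.subBracket v 0) x) = 0 := fun v f x => by
    rw [hb2, hρ0, mlieBracket_zero_right, sub_self]
  have B0 : ∀ (f g : M → ℝ) (x : M), lieBiv (ρ 0) biv f g x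
      + j.cobracket 0 (dualAct ρ x (dfun f x)) (dualAct ρ x (dfun g x)) = 0 := fun f g x => by
    have e : ∀ f : M → ℝ, (fun y => dfun (E := E) f y (ρ 0 y)) = fun _ => 0 := fun f => by
      funext y
      rw [hρ0]
      exact map_zero _
    have d0 : dfun (E := E) (fun _ : M => (0 : ℝ)) x = 0 := dvec_const 0 x
    have c0 : j.cobracket 0 (dualAct ρ x (dfun f x)) (dualAct ρ x (dfun g x)) = 0 := by
      simp [IsotropicSplitting.cobracket]
    rw [c0, lieBiv, e, e, hρ0]
    simp [bivBracket, d0]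
  have S0 : ∀ (f₁ f₂ f₃ : M → ℝ), ContMDiff 𝓘(ℝ, E) 𝓘(ℝ, ℝ) ∞ f₁ →
      ContMDiff 𝓘(ℝ, E) 𝓘(ℝ, ℝ) ∞ f₂ → ContMDiff 𝓘(ℝ, E) 𝓘(ℝ, ℝ) ∞ f₃ → ∀ x,
      (1 / 2 : ℝ) * schoutenSelf biv f₁ f₂ f₃ x - j.chi (dualAct ρ x (dfun f₁ x))
        (dualAct ρ x (dfun f₂ x)) (dualAct ρ x (dfun f₃ x)) = 0 := by
    intro f₁ f₂ f₃ hf₁ hf₂ hf₃ x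
    -- With no Lie algebra elements only the defect of [π, π] survives.
    have := hz 0 0 0 f₁ f₂ f₃ hf₁ hf₂ hf₃ x
    rw [A1, A1, A1, B0, B0, B0] at this
    linarith
  have B1 : ∀ (v : P.sub) (f g : M → ℝ), ContMDiff 𝓘(ℝ, E) 𝓘(ℝ, ℝ) ∞ f →
      ContMDiff 𝓘(ℝ, E) 𝓘(ℝ, ℝ) ∞ g → ∀ x, lieBiv (ρ v) biv f g x
      + j.cobracket v (dualAct ρ x (dfun f x)) (dualAct ρ x (dfun g x)) = 0 := by
    intro v f g hf hg x
    -- With v in the first place only the Lie derivative defect on the last two functions survives;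
    -- the first function is arbitrary and taken to be f.
    have := hz v 0 0 f f g hf hf hg x
    rw [A2, A1, A1, B0, B0, S0 f f g hf hf hg] at this
    linarith
  refine ⟨⟨⟨isBivector_smooth_iff.2 hbs, hb.skew h hρ⟩,
    ⟨fun v => smoothVFOn_univ.2 (hρs v), fun v w => ?_⟩, fun v f g hf hg x => ?_,
    fun f g k hf hg hk x => ?_⟩, hρ.equivariant, hb.moment h hρ⟩
  · funext x
    rw [← sub_eq_zero]
    refine eq_zero_of_cot fun α => ?_
    obtain ⟨f, hf, rfl⟩ := exists_smooth_dvec_eq x α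
    -- With the other defects gone, what remains is the bracket defect of v and w tested on df, and
    -- every covector at x is such a differential.
    have := hz v w 0 f f f hf hf hf x
    rw [A1, A2, B0, B1 v f f hf hf, B1 w f f hf hf, S0 f f f hf hf hf] at this
    rw [map_sub]
    linarith
  · linarith [B1 v f g hf hg x]
  · linarith [S0 f g k hf hg hk x]

end Hamiltonian

/-! ### f-Dirac maps over S versus equivariant maps preserving the bivector field -/

section Morphisms

variable {𝔡 : Type*} [NormedAddCommGroup 𝔡] [NormedSpace ℝ 𝔡] [FiniteDimensional ℝ 𝔡]
  {P : ManinPair 𝔡}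
  {ED : Type*} [NormedAddCommGroup ED] [NormedSpace ℝ ED] [FiniteDimensional ℝ ED]
  {ES : Type*} [NormedAddCommGroup ES] [NormedSpace ℝ ES] [FiniteDimensional ℝ ES]
  {D : Type*} [TopologicalSpace D] [ChartedSpace ED D] [Group D] [LieGroup 𝓘(ℝ, ED) ∞ D]
  [ConnectedSpace D]
  {G : Subgroup D} [ChartedSpace ES (D ⧸ G)] [IsManifold 𝓘(ℝ, ES) ∞ (D ⧸ G)]
  {Q : GroupPair P ED ES G} (s : ConnectionSplitting Q) (j : IsotropicSplitting P)
  {E : Type*} [NormedAddCommGroup E] [NormedSpace ℝ E] [FiniteDimensional ℝ E]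
  {M : Type*} [TopologicalSpace M] [ChartedSpace E M] [IsManifold 𝓘(ℝ, E) ∞ M] [T2Space M]
  {J : M → D ⧸ G}
  {biv : ∀ x : M, Cot E x →L[ℝ] Tan E x} {ρ : P.sub →ₗ[ℝ] ∀ x : M, Tan E x}
  {E' : Type*} [NormedAddCommGroup E'] [NormedSpace ℝ E'] [FiniteDimensional ℝ E']
  {M' : Type*} [TopologicalSpace M'] [ChartedSpace E' M'] [IsManifold 𝓘(ℝ, E') ∞ M'] [T2Space M']
  {J' : M' → D ⧸ G}
  {biv' : ∀ x : M', Cot E' x →L[ℝ] Tan E' x} {ρ' : P.sub →ₗ[ℝ] ∀ x : M', Tan E' x}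

theorem isForwardDirac_iff (hJ : ContMDiff 𝓘(ℝ, E) 𝓘(ℝ, ES) ∞ J)
    (hJ' : ContMDiff 𝓘(ℝ, E') 𝓘(ℝ, ES) ∞ J') (h : IsHamiltonianQP Q j J biv ρ)
    (h' : IsHamiltonianQP Q j J' biv' ρ') {f : M → M'} (hf : ContMDiff 𝓘(ℝ, E) 𝓘(ℝ, E') ∞ f)
    (hJf : J = fun x => J' (f x)) :
    IsForwardDirac f (diracOf s j J biv ρ) (diracOf s j J' biv' ρ') ↔
      (∀ (x : M) (β : Cot E' (f x)),
        tmap E E' f x (biv x (cotmap E E' f x β)) = biv' (f x) β) ∧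
      ∀ (x : M) (v : P.sub), tmap E E' f x (ρ v x) = ρ' v (f x) := by
  subst hJf
  have ht : ∀ (x : M) (X : Tan E x), tmap E ES (fun x => J' (f x)) x X
      = tmap E' ES J' (f x) (tmap E E' f x X) := fun x X =>
    congrArg (fun A : E →L[ℝ] ES => A X)
      (mfderiv_comp x (mdiff_of_contMDiff hJ' (f x)) (mdiff_of_contMDiff hf x))
  have hct : ∀ (x : M) (ξ : Cot ES (J' (f x))), cotmap E ES (fun x => J' (f x)) x ξ
      = cotmap E E' f x (cotmap E' ES J' (f x) ξ) := fun x ξ =>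
    ContinuousLinearMap.ext fun X => congrArg ξ (ht x X)
  have hμ : (∀ (x : M) (v : P.sub), tmap E E' f x (ρ v x) = ρ' v (f x)) →
      ∀ (x : M) (β : Cot E' (f x)), dualAct ρ x (cotmap E E' f x β) = dualAct ρ' (f x) β := by
    intro he x β
    ext v
    change β (tmap E E' f x (ρ v x)) = β (ρ' v (f x))
    rw [he]
  have hsd := h.isStrongDirac s j hJ
  have hsd' := h'.isStrongDirac s j hJ'
  constructor
  · intro hF
    have he : ∀ (x : M) (v : P.sub), tmap E E' f x (ρ v x) = ρ' v (f x) := by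
      intro x v
      obtain ⟨X, hX, hm⟩ := (hF x _ _).1 (rhoHat_mem_diracOf s j (biv := biv') (f x) v)
      -- A lift of ρ_M'(v) provided by the f-Dirac condition lies over ρ_S(v) and in L, and such a
      -- vector is unique.
      have h1 := (hsd.existsUnique_vec v x).unique (y₁ := X) (y₂ := ρ v x)
        ⟨by rw [ht, hX, h'.equivariant], by rw [hct]; exact hm⟩
        ⟨h.equivariant x v, rhoHat_mem_diracOf s j x v⟩
      rw [← h1, hX]
    refine ⟨fun x β => ?_, he⟩
    have hm' : gen s j J' biv' ρ' (f x) 0 β ∈ diracOf s j J' biv' ρ' (f x) :=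
      (mem_diracOf s j).2 ⟨0, β, rfl⟩
    rw [gen_zero_left] at hm'
    obtain ⟨X, hX, hm⟩ := (hF x _ _).1 hm'
    have hm2 : gen s j (fun x => J' (f x)) biv ρ x 0 (cotmap E E' f x β)
        ∈ diracOf s j (fun x => J' (f x)) biv ρ x := (mem_diracOf s j).2 ⟨0, _, rfl⟩
    rw [gen_zero_left, hμ he, hct] at hm2
    have h3 := (diracOf s j (fun x => J' (f x)) biv ρ x).sub_mem hm hm2
    rw [Prod.mk_sub_mk, map_sub, sub_self] at h3
    -- The lift of h(β) and h(f^*β) have the same covector and the same image under dJ;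
    -- transversality forces their tangent parts to agree.
    have h4 := hsd.transversal x _ (by
      rw [map_sub, ht, hX, h'.tmap_biv j, h.tmap_biv j, hμ he, sub_self]) h3
    rw [sub_eq_zero] at h4
    rw [← h4, hX]
  · rintro ⟨hp, he⟩ x Y β
    -- The generator for (v, f^*α) upstairs is related by f to the generator for (v, α) downstairs.
    -- This gives one inclusion directly and the other by orthogonality, since the target is
    -- Lagrangian.
    have hgen : ∀ (v : P.sub) (α : Cot E' (f x)),
        tmap E E' f x (gen s j (fun x => J' (f x)) biv ρ x v (cotmap E E' f x α)).1
          = (gen s j J' biv' ρ' (f x) v α).1 ∧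
        (gen s j (fun x => J' (f x)) biv ρ x v (cotmap E E' f x α)).2
          = cotmap E E' f x (gen s j J' biv' ρ' (f x) v α).2 := by
      intro v α
      constructor
      · change tmap E E' f x (ρ v x + biv x (cotmap E E' f x α)) = ρ' v (f x) + biv' (f x) α
        rw [map_add, hp, he]
      · change cotmap E ES (fun x => J' (f x)) x (s.star (J' (f x)) (genCoeff j ρ x v _)) + _
          = cotmap E E' f x (cotmap E' ES J' (f x) (s.star (J' (f x)) (genCoeff j ρ' (f x) v α)) + α)
        rw [hct, map_add, genCoeff, genCoeff, hμ he]
    constructor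
    · intro hm
      obtain ⟨v, α, hg⟩ := (mem_diracOf s j).1 hm
      obtain ⟨g1, g2⟩ := hgen v α
      rw [hg] at g1 g2
      refine ⟨_, g1, ?_⟩
      rw [← g2]
      exact (mem_diracOf s j).2 ⟨v, _, rfl⟩
    · rintro ⟨X, rfl, hm⟩
      refine (hsd'.dirac.lagrangian (f x) _).2 fun b hb => ?_
      obtain ⟨v, α, rfl⟩ := (mem_diracOf s j).1 hb
      obtain ⟨g1, g2⟩ := hgen v α
      have h1 := h.isIsotropic s j x _ hm _
        ((mem_diracOf s j).2 ⟨v, cotmap E E' f x α, rfl⟩)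
      rw [← h1]
      simp only [bigPairing]
      rw [g2, ← g1]
      rfl

end Morphisms

/-! ### The two functors and their compositions -/

section Functors

variable {𝔡 : Type*} [NormedAddCommGroup 𝔡] [NormedSpace ℝ 𝔡] [FiniteDimensional ℝ 𝔡]
  {P : ManinPair 𝔡}
  {ED : Type*} [NormedAddCommGroup ED] [NormedSpace ℝ ED] [FiniteDimensional ℝ ED]
  {ES : Type*} [NormedAddCommGroup ES] [NormedSpace ℝ ES] [FiniteDimensional ℝ ES]
  {D : Type*} [TopologicalSpace D] [ChartedSpace ED D] [Group D] [LieGroup 𝓘(ℝ, ED) ∞ D]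
  [ConnectedSpace D]
  {G : Subgroup D} [ChartedSpace ES (D ⧸ G)] [IsManifold 𝓘(ℝ, ES) ∞ (D ⧸ G)]
  {Q : GroupPair P ED ES G} {s : ConnectionSplitting Q} (j : IsotropicSplitting P)

/-- The action induced by a strong Dirac map. -/
def DiracSpace.act (X : DiracSpace.{u} s) : P.sub →ₗ[ℝ] ∀ x : X.base.carrier, Tan X.base.model x :=
  X.strong.existsUnique_act.choose

theorem DiracSpace.isInducedAction (X : DiracSpace.{u} s) :
    IsInducedAction s X.base.J X.L X.act :=
  X.strong.existsUnique_act.choose_spec.1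

/-- The bivector field induced by a strong Dirac map. -/
def DiracSpace.biv (X : DiracSpace.{u} s) (x : X.base.carrier) :
    Cot X.base.model x →L[ℝ] Tan X.base.model x :=
  (X.strong.existsUnique_biv j X.isInducedAction).choose x

theorem DiracSpace.isAssocBivector (X : DiracSpace.{u} s) :
    IsAssocBivector X.L (backwardImage X.base.J (s.CS j)) (X.biv j) :=
  (X.strong.existsUnique_biv j X.isInducedAction).choose_spec.1

/-- The Hamiltonian quasi-Poisson space of a strong Dirac map. -/
def DiracSpace.toQP (X : DiracSpace.{u} s) : QPSpace.{u} Q j where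
  base := X.base
  biv := X.biv j
  act := X.act
  ham := X.strong.isHamiltonianQP X.base.smooth X.isInducedAction (X.isAssocBivector j)

theorem DiracSpace.diracOf_eq (X : DiracSpace.{u} s) :
    diracOf s j X.base.J (X.biv j) X.act = X.L :=
  (X.isAssocBivector j).diracOf_eq X.strong X.isInducedAction

variable {j}

theorem DiracSpace.toQP_eq (X : DiracSpace.{u} s)
    {biv : ∀ x : X.base.carrier, Cot X.base.model x →L[ℝ] Tan X.base.model x}
    {ρ : P.sub →ₗ[ℝ] ∀ x : X.base.carrier, Tan X.base.model x}
    (h : IsHamiltonianQP Q j X.base.J biv ρ) (hρ : IsInducedAction s X.base.J X.L ρ)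
    (hb : IsAssocBivector X.L (backwardImage X.base.J (s.CS j)) biv) :
    X.toQP j = ⟨X.base, biv, ρ, h⟩ := by
  have h1 : X.act = ρ := X.strong.existsUnique_act.unique X.isInducedAction hρ
  have h2 : X.biv j = biv := (X.strong.existsUnique_biv j X.isInducedAction).unique
    (X.isAssocBivector j) hb
  subst h1 h2
  rfl

variable (s)

/-- The strong Dirac map of a Hamiltonian quasi-Poisson space. -/
def QPSpace.toDirac (Y : QPSpace.{u} Q j) : DiracSpace.{u} s where
  base := Y.base
  L := diracOf s j Y.base.J Y.biv Y.act
  strong := Y.ham.isStrongDirac s j Y.base.smooth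

theorem QPSpace.toQP_toDirac (Y : QPSpace.{u} Q j) : (Y.toDirac s).toQP j = Y :=
  (Y.toDirac s).toQP_eq Y.ham (Y.ham.isInducedAction s j) (Y.ham.isAssocBivector s j)

variable {s}

theorem DiracSpace.toDirac_toQP (X : DiracSpace.{u} s) : (X.toQP j).toDirac s = X := by
  have h := X.diracOf_eq j
  obtain ⟨base, L, strong⟩ := X
  simp only [QPSpace.toDirac, DiracSpace.toQP] at h ⊢
  congr

theorem isForwardDirac_toDirac_iff {X Y : QPSpace.{u} Q j} (f : ManifoldOver.Hom X.base Y.base) :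
    IsForwardDirac f.toFun (diracOf s j X.base.J X.biv X.act)
        (diracOf s j Y.base.J Y.biv Y.act) ↔
      (∀ (x : X.base.carrier) (β : Cot Y.base.model (f.toFun x)),
        tmap X.base.model Y.base.model f.toFun x
          (X.biv x (cotmap X.base.model Y.base.model f.toFun x β)) = Y.biv (f.toFun x) β) ∧
      ∀ (x : X.base.carrier) (v : P.sub),
        tmap X.base.model Y.base.model f.toFun x (X.act v x) = Y.act v (f.toFun x) :=
  isForwardDirac_iff s j X.base.smooth Y.base.smooth X.ham Y.ham f.smooth
    (funext fun x => (f.comm x).symm)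

theorem isForwardDirac_toQP_iff {X Y : DiracSpace.{u} s} (f : ManifoldOver.Hom X.base Y.base) :
    IsForwardDirac f.toFun X.L Y.L ↔
      (∀ (x : X.base.carrier) (β : Cot Y.base.model (f.toFun x)),
        tmap X.base.model Y.base.model f.toFun x
          (X.biv j x (cotmap X.base.model Y.base.model f.toFun x β)) = Y.biv j (f.toFun x) β) ∧
      ∀ (x : X.base.carrier) (v : P.sub),
        tmap X.base.model Y.base.model f.toFun x (X.act v x) = Y.act v (f.toFun x) := by
  have h := isForwardDirac_iff s j X.base.smooth Y.base.smooth (X.toQP j).ham (Y.toQP j).ham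
    f.smooth (funext fun x => (f.comm x).symm)
  change IsForwardDirac f.toFun (diracOf s j X.base.J (X.biv j) X.act)
    (diracOf s j Y.base.J (Y.biv j) Y.act) ↔ _ at h
  rw [X.diracOf_eq j, Y.diracOf_eq j] at h
  exact h

variable (s j)

/-- The functor from strong Dirac maps to Hamiltonian quasi-Poisson spaces. -/
def toQPFunctor : DiracSpace.{u} s ⥤ QPSpace.{u} Q j where
  obj X := X.toQP j
  map {X Y} f := (⟨f.map, ((isForwardDirac_toQP_iff f.map).1 f.forward).1,
    ((isForwardDirac_toQP_iff (j := j) f.map).1 f.forward).2⟩ : QPSpace.Hom (X.toQP j) (Y.toQP j))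
  map_id _ := rfl
  map_comp _ _ := rfl

/-- The functor from Hamiltonian quasi-Poisson spaces to strong Dirac maps. -/
def toDiracFunctor : QPSpace.{u} Q j ⥤ DiracSpace.{u} s where
  obj Y := Y.toDirac s
  map {X Y} f := (⟨f.map, (isForwardDirac_toDirac_iff f.map).2 ⟨f.push, f.equivariant⟩⟩ :
    DiracSpace.Hom (X.toDirac s) (Y.toDirac s))
  map_id _ := rfl
  map_comp _ _ := rfl

instance : (DiracSpace.forget.{u} s).Faithful where
  map_injective h := DiracSpace.Hom.ext h

instance : (QPSpace.forget.{u} Q j).Faithful where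
  map_injective h := QPSpace.Hom.ext h

theorem toQPFunctor_comp_toDiracFunctor :
    toQPFunctor.{u} s j ⋙ toDiracFunctor s j = 𝟭 (DiracSpace.{u} s) := by
  have hobj : ∀ X : DiracSpace.{u} s, (toQPFunctor.{u} s j ⋙ toDiracFunctor s j).obj X
      = (𝟭 (DiracSpace.{u} s)).obj X := fun X => X.toDirac_toQP
  refine CategoryTheory.Functor.ext hobj fun X Y f => ?_
  -- The identities of objects are only propositional and introduce transport morphisms. The
  -- forgetful functor is faithful, and on underlying manifolds the objects agree definitionally, so
  -- the transports become identities.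
  apply (DiracSpace.forget s).map_injective
  rw [CategoryTheory.Functor.map_comp, CategoryTheory.Functor.map_comp, eqToHom_map, eqToHom_map]
  exact ((Category.id_comp _).trans (Category.comp_id _)).symm

theorem toDiracFunctor_comp_toQPFunctor :
    toDiracFunctor.{u} s j ⋙ toQPFunctor s j = 𝟭 (QPSpace.{u} Q j) := by
  have hobj : ∀ Y : QPSpace.{u} Q j, (toDiracFunctor.{u} s j ⋙ toQPFunctor s j).obj Y
      = (𝟭 (QPSpace.{u} Q j)).obj Y := fun Y => Y.toQP_toDirac s
  refine CategoryTheory.Functor.ext hobj fun X Y f => ?_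
  apply (QPSpace.forget Q j).map_injective
  rw [CategoryTheory.Functor.map_comp, CategoryTheory.Functor.map_comp, eqToHom_map, eqToHom_map]
  exact ((Category.id_comp _).trans (Category.comp_id _)).symm

end Functors

end QPDirac

end

/-! ### The main theorem -/

theorem theorem5p3
    {𝔡 : Type*} [NormedAddCommGroup 𝔡] [NormedSpace ℝ 𝔡] [FiniteDimensional ℝ 𝔡]
    (P : QPDirac.ManinPair 𝔡)
    {ED : Type*} [NormedAddCommGroup ED] [NormedSpace ℝ ED] [FiniteDimensional ℝ ED]
    {ES : Type*} [NormedAddCommGroup ES] [NormedSpace ℝ ES] [FiniteDimensional ℝ ES]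
    {D : Type*} [TopologicalSpace D] [ChartedSpace ED D] [Group D]
    [LieGroup 𝓘(ℝ, ED) ∞ D] [ConnectedSpace D]
    (G : Subgroup D) [ChartedSpace ES (D ⧸ G)] [IsManifold 𝓘(ℝ, ES) ∞ (D ⧸ G)]
    (Q : QPDirac.GroupPair P ED ES G)
    (s : QPDirac.ConnectionSplitting Q) (j : QPDirac.IsotropicSplitting P) :
    -- (i) from strong Dirac maps to Hamiltonian quasi-Poisson spaces
    (∀ (X : QPDirac.ManifoldOver.{u} ES (D ⧸ G))
        (L : ∀ x : X.carrier, Submodule ℝ (QPDirac.BigTan X.model x)),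
      QPDirac.IsStrongDirac X.J L s.phiS s.LS →
      QPDirac.IsAlmostDirac (QPDirac.backwardImage (E := X.model) X.J (s.CS j)) ∧
      (∀ x, IsCompl (L x) (QPDirac.backwardImage (E := X.model) X.J (s.CS j) x)) ∧
      (∃! ρ : P.sub →ₗ[ℝ] ∀ x : X.carrier, QPDirac.Tan X.model x,
        QPDirac.IsInducedAction s X.J L ρ) ∧
      (∃! biv : ∀ x : X.carrier, QPDirac.Cot X.model x →L[ℝ] QPDirac.Tan X.model x,
        QPDirac.IsAssocBivector L (QPDirac.backwardImage X.J (s.CS j)) biv) ∧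
      ∀ ρ biv, QPDirac.IsInducedAction s X.J L ρ →
        QPDirac.IsAssocBivector L (QPDirac.backwardImage X.J (s.CS j)) biv →
        QPDirac.IsHamiltonianQP Q j X.J biv ρ ∧
        -- the construction of (ii) recovers `L`
        QPDirac.diracOf s j X.J biv ρ = L) ∧
    -- (ii) from Hamiltonian quasi-Poisson spaces to strong Dirac maps
    (∀ (X : QPDirac.ManifoldOver.{u} ES (D ⧸ G))
        (biv : ∀ x : X.carrier, QPDirac.Cot X.model x →L[ℝ] QPDirac.Tan X.model x)
        (ρ : P.sub →ₗ[ℝ] ∀ x : X.carrier, QPDirac.Tan X.model x),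
      QPDirac.IsHamiltonianQP Q j X.J biv ρ →
      QPDirac.IsStrongDirac X.J (QPDirac.diracOf s j X.J biv ρ) s.phiS s.LS ∧
      -- the construction of (i) recovers the action and the bivector field
      QPDirac.IsInducedAction s X.J (QPDirac.diracOf s j X.J biv ρ) ρ ∧
      QPDirac.IsAssocBivector (QPDirac.diracOf s j X.J biv ρ)
        (QPDirac.backwardImage X.J (s.CS j)) biv) ∧
    -- the isomorphism of categories, which leaves the underlying maps `J` and morphisms unchanged
    ∃ (Φ : QPDirac.DiracSpace.{u} s ⥤ QPDirac.QPSpace.{u} Q j)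
      (Ψ : QPDirac.QPSpace.{u} Q j ⥤ QPDirac.DiracSpace.{u} s),
      Φ ⋙ Ψ = 𝟭 (QPDirac.DiracSpace.{u} s) ∧ Ψ ⋙ Φ = 𝟭 (QPDirac.QPSpace.{u} Q j) ∧
      Φ ⋙ QPDirac.QPSpace.forget Q j = QPDirac.DiracSpace.forget s ∧
      Ψ ⋙ QPDirac.DiracSpace.forget s = QPDirac.QPSpace.forget Q j ∧
      (∀ (X : QPDirac.DiracSpace.{u} s)
          (biv : ∀ x : X.base.carrier,
            QPDirac.Cot X.base.model x →L[ℝ] QPDirac.Tan X.base.model x)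
          (ρ : P.sub →ₗ[ℝ] ∀ x : X.base.carrier, QPDirac.Tan X.base.model x)
          (h : QPDirac.IsHamiltonianQP Q j X.base.J biv ρ),
        QPDirac.IsInducedAction s X.base.J X.L ρ →
        QPDirac.IsAssocBivector X.L (QPDirac.backwardImage X.base.J (s.CS j)) biv →
        Φ.obj X = ⟨X.base, biv, ρ, h⟩) ∧
      (∀ (Y : QPDirac.QPSpace.{u} Q j)
          (h : QPDirac.IsStrongDirac Y.base.J
            (QPDirac.diracOf s j Y.base.J Y.biv Y.act) s.phiS s.LS),
        Ψ.obj Y = ⟨Y.base, QPDirac.diracOf s j Y.base.J Y.biv Y.act, h⟩) := by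
  refine ⟨fun X L h => ?_, fun X biv ρ h => ⟨h.isStrongDirac s j X.smooth,
    h.isInducedAction s j, h.isAssocBivector s j⟩, QPDirac.toQPFunctor s j,
    QPDirac.toDiracFunctor s j, QPDirac.toQPFunctor_comp_toDiracFunctor s j,
    QPDirac.toDiracFunctor_comp_toQPFunctor s j, rfl, rfl,
    fun X biv ρ h hρ hb => X.toQP_eq h hρ hb, fun Y h => rfl⟩
  -- The properties of C and the uniqueness of the bivector field use some induced action as a tool,
  -- although their statements do not involve one.
  obtain ⟨ρ₀, hρ₀, -⟩ := h.existsUnique_act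
  exact ⟨h.isAlmostDirac_C j X.smooth hρ₀, fun x => h.isCompl j hρ₀ x, h.existsUnique_act,
    h.existsUnique_biv j hρ₀, fun ρ biv hρ hb =>
      ⟨h.isHamiltonianQP X.smooth hρ hb, hb.diracOf_eq h hρ⟩⟩
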